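/- Let $\mathcal{G}_{2,3}\subset\mathbb{P}^9$ be the Zariski closure, in the complex projective space whose homogeneous coordinates $m_{ij}$ are indexed by the pairs $i,j\ge 0$ with $i+j\le 3$, of the set of points $(m_{ij})_{i+j\le 3}$ defined by $$\sum_{i,j\ge 0}\frac{m_{ij}}{i!\,j!}\,t_1^i t_2^j=\exp(\mu_1t_1+\mu_2t_2)\cdot\exp\Bigl(\tfrac12\bigl(\sigma_{11}t_1^2+2\sigma_{12}t_1t_2+\sigma_{22}t_2^2\bigr)\Bigr),$$ where $\mu_1,\mu_2,\sigma_{11},\sigma_{12},\sigma_{22}$ range over $\mathbb{C}$ (the moments of order at most $3$ of bivariate Gaussians). Let $S=\mathbb{C}[m_{ij}: i+j\le 3]$ with its standard grading, and let $I\subset S$ be the ideal of all polynomials that vanish on the affine cone over $\mathcal{G}_{2,3}$. Then $\mathcal{G}_{2,3}$ has dimension $5$ and degree $16$ in $\mathbb{P}^9$. The ideal $I$ is homogeneous and prime, and it is minimally generated by $14$ cubics and $4$ quartics, where the $14$ cubics can be chosen to include the four cumulant cubics $$k_{30}=2m_{10}^3-3m_{00}m_{10}m_{20}+m_{00}^2m_{30},$$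 $$k_{21}=2m_{01}m_{10}^2-2m_{00}m_{10}m_{11}-m_{00}m_{01}m_{20}+m_{00}^2m_{21},$$ $$k_{12}=2m_{01}^2m_{10}-m_{00}m_{02}m_{10}-2m_{00}m_{01}m_{11}+m_{00}^2m_{12},$$ $$k_{03}=2m_{01}^3-3m_{00}m_{01}m_{02}+m_{00}^2m_{03}.$$ The Hilbert series of $S/I$ is $$\sum_{k\ge 0}\dim_{\mathbb{C}}(S/I)_k\,t^k=\frac{1+4t+10t^2+6t^3-4t^4-t^5}{(1-t)^6}.$$ Moreover, $I$ is the saturation $$I=\langle k_{30},k_{21},k_{12},k_{03}\rangle:\langle m_{00}\rangle^\infty .$$ -/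

import Mathlib

open MvPolynomial
open scoped Nat

noncomputable section

/-! ### Complex projective space with its Zariski topology -/

/-- The complex projective space whose homogeneous coordinates are indexed by `σ`
(so `ℙ^N` when `σ` has `N + 1` elements). It is a type of its own so that it can carry the
Zariski topology. -/
def ProjSpace (σ : Type) : Type := Projectivization ℂ (σ → ℂ)

/-- The point of projective space with homogeneous coordinates `v ≠ 0`. -/
def ProjSpace.mk {σ : Type} (v : σ → ℂ) (hv : v ≠ 0) : ProjSpace σ := Projectivization.mk ℂ v hv

/-- The set of points at which the polynomial `f` does not vanish
(meaningful for homogeneous `f`). -/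
def ProjSpace.basicOpen {σ : Type} (f : MvPolynomial σ ℂ) : Set (ProjSpace σ) :=
  {x | ∃ (v : σ → ℂ) (hv : v ≠ 0), x = ProjSpace.mk v hv ∧ eval v f ≠ 0}

/-- The Zariski topology: the complements of the zero sets of homogeneous polynomials are a basis
of open sets. -/
instance ProjSpace.zariskiTopology (σ : Type) : TopologicalSpace (ProjSpace σ) :=
  TopologicalSpace.generateFrom
    {U | ∃ (f : MvPolynomial σ ℂ) (k : ℕ), f.IsHomogeneous k ∧ U = ProjSpace.basicOpen f}

/-- The homogeneous ideal of a set of points of projective space: all polynomials that vanish at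
all homogeneous coordinate vectors of all its points. -/
def homogeneousIdealOf {σ : Type} (Z : Set (ProjSpace σ)) : Ideal (MvPolynomial σ ℂ) :=
  vanishingIdeal ℂ {v : σ → ℂ | ∃ hv : v ≠ 0, ProjSpace.mk v hv ∈ Z}

/-! ### Hilbert function, Hilbert series, degree, minimal generators, saturation -/

/-- The Hilbert function of `S / I`: the dimension of the image of the space of forms of
degree `k`. -/
def hilbertFunction {σ : Type} (I : Ideal (MvPolynomial σ ℂ)) (k : ℕ) : ℕ :=
  Module.finrank ℂ
    ((homogeneousSubmodule σ ℂ k).map (Ideal.Quotient.mkₐ ℂ I).toLinearMap)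

/-- The Hilbert series of `S / I`. -/
def hilbertSeries {σ : Type} (I : Ideal (MvPolynomial σ ℂ)) : PowerSeries ℚ :=
  PowerSeries.mk fun k => (hilbertFunction I k : ℚ)

/-- The set `Z` in projective space has degree `e`: the Hilbert polynomial of its homogeneous
coordinate ring has some degree `r` and leading coefficient `e / r!`. -/
def HasProjectiveDegree {σ : Type} (Z : Set (ProjSpace σ)) (e : ℕ) : Prop :=
  ∃ P : Polynomial ℚ,
    (∀ᶠ k : ℕ in Filter.atTop,
      (hilbertFunction (homogeneousIdealOf Z) k : ℚ) = P.eval (k : ℚ)) ∧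
    (P.natDegree ! : ℚ) * P.leadingCoeff = e

/-- `G` is a minimal generating set of the ideal `I`: it generates `I`, and no proper subset does. -/
def IsMinimalGeneratingSet {R : Type} [CommRing R] (I : Ideal R) (G : Set R) : Prop :=
  Ideal.span G = I ∧ ∀ T : Set R, T ⊂ G → Ideal.span T ≠ I

/-- The saturation `J : 𝔞^∞`, the union of the increasing chain of ideal quotients `J : 𝔞^k`. -/
def idealSaturation {R : Type} [CommRing R] (J 𝔞 : Ideal R) : Ideal R :=
  ⨆ k : ℕ, J.colon ((𝔞 ^ k : Ideal R) : Set R)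

/-! ### Gaussian moment varieties -/

/-- The exponents `i = (i₁, …, iₙ)` of the moments of order at most `d`. -/
def MomentIndex (n d : ℕ) : Type := {i : Fin n → ℕ // ∑ j, i j ≤ d}

/-- The moment generating function
`exp (∑ i, tᵢ μᵢ) * exp (1/2 * ∑ i j, σᵢⱼ tᵢ tⱼ)`, a formal power series in `t₁, …, tₙ`. -/
def gaussianMGF {n : ℕ} (μ : Fin n → ℂ) (Sg : Matrix (Fin n) (Fin n) ℂ) :
    MvPowerSeries (Fin n) ℂ :=
  (PowerSeries.exp ℂ).subst
      (∑ i, MvPowerSeries.C (μ i) * MvPowerSeries.X i : MvPowerSeries (Fin n) ℂ) *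
    (PowerSeries.exp ℂ).subst
      (MvPowerSeries.C (1 / 2) *
        ∑ i, ∑ j, MvPowerSeries.C (Sg i j) * MvPowerSeries.X i * MvPowerSeries.X j :
          MvPowerSeries (Fin n) ℂ)

/-- The moment `m_{i₁ ⋯ iₙ}`: the coefficient of `t₁^i₁ ⋯ tₙ^iₙ` in the moment generating
function is `m_{i₁ ⋯ iₙ} / (i₁! ⋯ iₙ!)`. -/
def gaussianMoment {n : ℕ} (μ : Fin n → ℂ) (Sg : Matrix (Fin n) (Fin n) ℂ) (i : Fin n → ℕ) : ℂ :=
  (∏ j, ((i j) ! : ℂ)) *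
    MvPowerSeries.coeff (Finsupp.equivFunOnFinite.symm i) (gaussianMGF μ Sg)

/-- The vector of all moments of order at most `d`. -/
def gaussianMomentVector {n : ℕ} (d : ℕ) (μ : Fin n → ℂ) (Sg : Matrix (Fin n) (Fin n) ℂ) :
    MomentIndex n d → ℂ :=
  fun i => gaussianMoment μ Sg i.1

theorem gaussianMoment_zero {n : ℕ} (μ : Fin n → ℂ) (Sg : Matrix (Fin n) (Fin n) ℂ) :
    gaussianMoment μ Sg 0 = 1 := by
  have key : ∀ a : MvPowerSeries (Fin n) ℂ, MvPowerSeries.constantCoeff a = 0 →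
      MvPowerSeries.constantCoeff ((PowerSeries.exp ℂ).subst a) = 1 := by
    intro a ha
    rw [PowerSeries.constantCoeff_subst (PowerSeries.HasSubst.of_constantCoeff_zero ha),
      finsum_eq_single _ 0]
    · simp
    · intro k hk
      simp [ha, hk]
  have h0 : (Finsupp.equivFunOnFinite.symm (0 : Fin n → ℕ)) = 0 := by
    ext; simp
  rw [gaussianMoment, h0, MvPowerSeries.coeff_zero_eq_constantCoeff_apply, gaussianMGF, map_mul,
    key _ (by simp), key _ (by simp)]
  simp

theorem gaussianMomentVector_ne_zero {n : ℕ} (d : ℕ) (μ : Fin n → ℂ)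
    (Sg : Matrix (Fin n) (Fin n) ℂ) : gaussianMomentVector d μ Sg ≠ 0 := by
  intro h
  have h1 := congrFun h ⟨0, by simp⟩
  have h2 : gaussianMoment μ Sg 0 = 0 := h1
  rw [gaussianMoment_zero] at h2
  exact one_ne_zero h2

/-- The Gaussian moment variety `𝒢_{n,d}`: the Zariski closure of the set of all points whose
homogeneous coordinates are the moments of order at most `d` for a mean vector `μ` and a
symmetric matrix `Sg`. -/
def gaussianMomentVariety (n d : ℕ) : Set (ProjSpace (MomentIndex n d)) :=
  closure {x | ∃ (μ : Fin n → ℂ) (Sg : Matrix (Fin n) (Fin n) ℂ), Sg.IsSymm ∧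
    x = ProjSpace.mk (gaussianMomentVector d μ Sg) (gaussianMomentVector_ne_zero d μ Sg)}

/-! The ten coordinates `m_{ij}` of the projective space of bivariate moments of order at most
`3`, and four cumulants, written as homogeneous cubics in these coordinates. -/

def m00 : MvPolynomial (MomentIndex 2 3) ℂ := X ⟨![0, 0], by decide⟩
def m10 : MvPolynomial (MomentIndex 2 3) ℂ := X ⟨![1, 0], by decide⟩
def m01 : MvPolynomial (MomentIndex 2 3) ℂ := X ⟨![0, 1], by decide⟩
def m20 : MvPolynomial (MomentIndex 2 3) ℂ := X ⟨![2, 0], by decide⟩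
def m11 : MvPolynomial (MomentIndex 2 3) ℂ := X ⟨![1, 1], by decide⟩
def m02 : MvPolynomial (MomentIndex 2 3) ℂ := X ⟨![0, 2], by decide⟩
def m30 : MvPolynomial (MomentIndex 2 3) ℂ := X ⟨![3, 0], by decide⟩
def m21 : MvPolynomial (MomentIndex 2 3) ℂ := X ⟨![2, 1], by decide⟩
def m12 : MvPolynomial (MomentIndex 2 3) ℂ := X ⟨![1, 2], by decide⟩
def m03 : MvPolynomial (MomentIndex 2 3) ℂ := X ⟨![0, 3], by decide⟩

/-- The cumulant `k₃₀`. -/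
def cumulantCubic30 : MvPolynomial (MomentIndex 2 3) ℂ :=
  2 * m10 ^ 3 - 3 * m00 * m10 * m20 + m00 ^ 2 * m30

/-- The cumulant `k₂₁`. -/
def cumulantCubic21 : MvPolynomial (MomentIndex 2 3) ℂ :=
  2 * m01 * m10 ^ 2 - 2 * m00 * m10 * m11 - m00 * m01 * m20
    + m00 ^ 2 * m21

/-- The cumulant `k₁₂`. -/
def cumulantCubic12 : MvPolynomial (MomentIndex 2 3) ℂ :=
  2 * m01 ^ 2 * m10 - m00 * m02 * m10 - 2 * m00 * m01 * m11
    + m00 ^ 2 * m12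

/-- The cumulant `k₀₃`. -/
def cumulantCubic03 : MvPolynomial (MomentIndex 2 3) ℂ :=
  2 * m01 ^ 3 - 3 * m00 * m01 * m02 + m00 ^ 2 * m03

end

open MvPolynomial
open scoped Nat

noncomputable section

/-! ### The moments of order at most three of a bivariate Gaussian -/

/-! Put x = μ₁/3, y = μ₂/3, and let a, b, c be the entries of σ + μμᵀ/3. With ℓ = xs + yt and q =
as² + 2bst + ct², the moments of orders one, two and three, read as binary forms with binomial
coefficients, are 3ℓ, q + 6ℓ² and 9ℓq. In these parameters the third-order moments are bilinear in
(x, y) and (a, b, c). Let φ = `momentHom` be the resulting map to ℂ[x, y, a, b, c]. A form lies in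
the ideal I if and only if φ kills it, so the Hilbert function is k ↦ dim φ(S_k), the dimension of
`momentForms k`. With one more variable to record the degree, I is the kernel of a map to a domain
(`momentConeHom`), hence prime. The generators and the Hilbert function come from two bounds that
meet.

Upper bound. The ideal J ⊆ I generated by the listed cubics and quartics contains twenty polynomials
with known leading monomials. The monomials divisible by none of these span S modulo J
(`homogeneousSubmodule_le_sup`). They are covered by 22 translates of free coordinate monoids, and
counting these bounds their number (`finrank_standardSpan_le`).

Lower bound. Enlarge φ(S_{n+2}) by R·C_n and B_l·C_{n+1} for l = 0, 1. Here C_m is spanned by the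
m-fold products of third-order moments, of dimension at most binom(m+3, 3), R is the resultant of ℓ
and q, and the B_l are the bilinear covariants xb − ya and xc − yb. The enlarged space contains all
monomials of total degree at most 2n+3 and (a, b, c)-degree at most n+1
(`paramMonomial_mem_lowForms`), many multiples of R (`paramRes_mul_paramMonomial_mem_lowForms`),
and, modulo terms of lower (a, b, c)-degree, all monomials of (a, b, c)-degree n+2 and (x, y)-degree
at most n+2 (`paramMonomial_mem_highForms`). These are linearly independent. Their number minus the
dimensions allowed for the enlargement is exactly the upper bound (`count_identity`), whence I = J
and the Hilbert series and degree.

Minimality holds because no monomial of another generator divides the leading monomial of a given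
one. For the saturation, inverting m₀₀ lets the cumulants eliminate the third-order moments, while
the six lower coordinates satisfy no relation on the cone. The dimension is bounded above by
transcendence degrees of coordinate rings and below by a flag of linear subspaces of the parameter
space. -/

theorem MvPowerSeries.coeff_eq_zero_of_four_le_order {f : MvPowerSeries (Fin 2) ℂ} (hf : 4 ≤ f.order)
    {e : Fin 2 →₀ ℕ} (he : e.degree ≤ 3) : MvPowerSeries.coeff e f = 0 := by
  apply MvPowerSeries.coeff_of_lt_order
  refine lt_of_lt_of_le ?_ hf
  exact_mod_cast Nat.lt_succ_of_le he

theorem MvPowerSeries.order_pow_ge {f : MvPowerSeries (Fin 2) ℂ} {a : ℕ} (hf : (a : ℕ∞) ≤ f.order)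
    (n : ℕ) : ((n * a : ℕ) : ℕ∞) ≤ (f ^ n).order := by
  refine le_trans ?_ (MvPowerSeries.le_order_pow n)
  rw [nsmul_eq_mul]
  push_cast
  gcongr

theorem MvPowerSeries.le_order_mul_of_le {f g : MvPowerSeries (Fin 2) ℂ} {a b c : ℕ}
    (hf : (a : ℕ∞) ≤ f.order) (hg : (b : ℕ∞) ≤ g.order) (h : c ≤ a + b) :
    (c : ℕ∞) ≤ (f * g).order := by
  refine le_trans ?_ MvPowerSeries.le_order_mul
  refine le_trans ?_ (add_le_add hf hg)
  exact_mod_cast h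

/-- The exponential series minus its cubic Taylor polynomial is divisible by the fourth power of the
variable, and substitution preserves this. -/
theorem exp_subst_eq (a : MvPowerSeries (Fin 2) ℂ) (ha : MvPowerSeries.constantCoeff a = 0) :
    ∃ g : MvPowerSeries (Fin 2) ℂ, (PowerSeries.exp ℂ).subst a =
      1 + a + MvPowerSeries.C (1 / 2) * a ^ 2 + MvPowerSeries.C (1 / 6) * a ^ 3 + a ^ 4 * g := by
  have hs := PowerSeries.HasSubst.of_constantCoeff_zero ha
  let q : Polynomial ℂ := 1 + Polynomial.X + Polynomial.C (1 / 2) * Polynomial.X ^ 2 +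
    Polynomial.C (1 / 6) * Polynomial.X ^ 3
  have hd : (PowerSeries.X : PowerSeries ℂ) ^ 4 ∣ PowerSeries.exp ℂ - (q : PowerSeries ℂ) := by
    rw [PowerSeries.X_pow_dvd_iff]
    intro m hm
    interval_cases m <;>
      simp [q, PowerSeries.coeff_exp, Polynomial.coeff_one, Polynomial.coeff_X,
        Polynomial.coeff_X_pow, Polynomial.coeff_C, PowerSeries.coeff_X, Nat.factorial]
  obtain ⟨g, hg⟩ := hd
  refine ⟨g.subst a, ?_⟩
  have h1 : PowerSeries.exp ℂ = (q : PowerSeries ℂ) + PowerSeries.X ^ 4 * g := by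
    rw [← hg]; ring
  rw [h1, PowerSeries.subst_add hs, PowerSeries.subst_mul hs, PowerSeries.subst_pow hs,
    PowerSeries.subst_X hs, PowerSeries.subst_coe hs]
  congr 1
  simp [q, MvPowerSeries.algebraMap_apply]

theorem coeff_C_mul_X_pow_mul_X_pow (c : ℂ) (i j k l : ℕ) :
    MvPowerSeries.coeff (Finsupp.equivFunOnFinite.symm ![k, l])
      (MvPowerSeries.C c * (MvPowerSeries.X 0 ^ i * MvPowerSeries.X 1 ^ j) :
        MvPowerSeries (Fin 2) ℂ) = if k = i ∧ l = j then c else 0 := by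
  classical
  have h : (MvPowerSeries.X 0 ^ i * MvPowerSeries.X 1 ^ j : MvPowerSeries (Fin 2) ℂ) =
      MvPowerSeries.monomial (Finsupp.equivFunOnFinite.symm ![i, j]) 1 := by
    rw [MvPowerSeries.X_pow_eq, MvPowerSeries.X_pow_eq, MvPowerSeries.monomial_mul_monomial]
    rw [mul_one, show (Finsupp.single 0 i + Finsupp.single 1 j : Fin 2 →₀ ℕ) =
      Finsupp.equivFunOnFinite.symm ![i, j] by ext x; fin_cases x <;> simp]
  rw [h, MvPowerSeries.coeff_C_mul, MvPowerSeries.coeff_monomial]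
  have : (Finsupp.equivFunOnFinite.symm ![k, l] : Fin 2 →₀ ℕ) =
      Finsupp.equivFunOnFinite.symm ![i, j] ↔ k = i ∧ l = j := by
    rw [Equiv.apply_eq_iff_eq]
    constructor
    · intro h
      exact ⟨by simpa using congrFun h 0, by simpa using congrFun h 1⟩
    · rintro ⟨rfl, rfl⟩; rfl
  simp [this]

/-- The linear exponent a has order at least one and the quadratic exponent b order at least two. In
the product of the two exponentials everything divisible by a⁴, b² or a²b therefore has order at
least four, and only (1 + a + a²/2 + a³/6) + b + ab is left. -/
theorem gaussianMGF_two (μ : Fin 2 → ℂ) (Sg : Matrix (Fin 2) (Fin 2) ℂ) (hS : Sg.IsSymm) :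
    ∃ g : MvPowerSeries (Fin 2) ℂ, 4 ≤ g.order ∧ gaussianMGF μ Sg =
      MvPowerSeries.C 1 * (MvPowerSeries.X 0 ^ 0 * MvPowerSeries.X 1 ^ 0) +
      MvPowerSeries.C (μ 0) * (MvPowerSeries.X 0 ^ 1 * MvPowerSeries.X 1 ^ 0) +
      MvPowerSeries.C (μ 1) * (MvPowerSeries.X 0 ^ 0 * MvPowerSeries.X 1 ^ 1) +
      MvPowerSeries.C ((Sg 0 0 + μ 0 ^ 2) / 2) *
        (MvPowerSeries.X 0 ^ 2 * MvPowerSeries.X 1 ^ 0) +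
      MvPowerSeries.C (Sg 0 1 + μ 0 * μ 1) * (MvPowerSeries.X 0 ^ 1 * MvPowerSeries.X 1 ^ 1) +
      MvPowerSeries.C ((Sg 1 1 + μ 1 ^ 2) / 2) *
        (MvPowerSeries.X 0 ^ 0 * MvPowerSeries.X 1 ^ 2) +
      MvPowerSeries.C ((μ 0 ^ 3 + 3 * μ 0 * Sg 0 0) / 6) *
        (MvPowerSeries.X 0 ^ 3 * MvPowerSeries.X 1 ^ 0) +
      MvPowerSeries.C ((μ 0 ^ 2 * μ 1 + 2 * μ 0 * Sg 0 1 + μ 1 * Sg 0 0) / 2) *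
        (MvPowerSeries.X 0 ^ 2 * MvPowerSeries.X 1 ^ 1) +
      MvPowerSeries.C ((μ 0 * μ 1 ^ 2 + 2 * μ 1 * Sg 0 1 + μ 0 * Sg 1 1) / 2) *
        (MvPowerSeries.X 0 ^ 1 * MvPowerSeries.X 1 ^ 2) +
      MvPowerSeries.C ((μ 1 ^ 3 + 3 * μ 1 * Sg 1 1) / 6) *
        (MvPowerSeries.X 0 ^ 0 * MvPowerSeries.X 1 ^ 3) + g := by
  have h10 : Sg 1 0 = Sg 0 1 := hS.apply 0 1
  let a : MvPowerSeries (Fin 2) ℂ :=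
    MvPowerSeries.C (μ 0) * MvPowerSeries.X 0 + MvPowerSeries.C (μ 1) * MvPowerSeries.X 1
  let b : MvPowerSeries (Fin 2) ℂ := MvPowerSeries.C (1 / 2) *
    (MvPowerSeries.C (Sg 0 0) * MvPowerSeries.X 0 ^ 2 +
      2 * MvPowerSeries.C (Sg 0 1) * MvPowerSeries.X 0 * MvPowerSeries.X 1 +
      MvPowerSeries.C (Sg 1 1) * MvPowerSeries.X 1 ^ 2)
  have hX (i : Fin 2) : ((1 : ℕ) : ℕ∞) ≤ (MvPowerSeries.X i : MvPowerSeries (Fin 2) ℂ).order := by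
    rw [Nat.cast_one, MvPowerSeries.one_le_order_iff_constCoeff_eq_zero]
    simp
  have hC (f : MvPowerSeries (Fin 2) ℂ) : ((0 : ℕ) : ℕ∞) ≤ f.order := by simp
  have hadd {f g : MvPowerSeries (Fin 2) ℂ} {n : ℕ} (hf : (n : ℕ∞) ≤ f.order)
      (hg : (n : ℕ∞) ≤ g.order) : (n : ℕ∞) ≤ (f + g).order :=
    le_trans (le_min hf hg) MvPowerSeries.min_order_le_add
  have ha : ((1 : ℕ) : ℕ∞) ≤ a.order :=
    hadd (MvPowerSeries.le_order_mul_of_le (hC _) (hX 0) (by norm_num))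
      (MvPowerSeries.le_order_mul_of_le (hC _) (hX 1) (by norm_num))
  have hb : ((2 : ℕ) : ℕ∞) ≤ b.order := by
    refine MvPowerSeries.le_order_mul_of_le (a := 0) (b := 2) (hC _) (hadd (hadd ?_ ?_) ?_) (by norm_num)
    · exact MvPowerSeries.le_order_mul_of_le (hC _) (MvPowerSeries.order_pow_ge (hX 0) 2) (by norm_num)
    · exact MvPowerSeries.le_order_mul_of_le (MvPowerSeries.le_order_mul_of_le (c := 1) (hC _) (hX 0)
        (by norm_num)) (hX 1) (by norm_num)
    · exact MvPowerSeries.le_order_mul_of_le (hC _) (MvPowerSeries.order_pow_ge (hX 1) 2) (by norm_num)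
  obtain ⟨g₁, hg₁⟩ := exp_subst_eq a (by simp [a])
  obtain ⟨g₂, hg₂⟩ := exp_subst_eq b (by simp [b])
  have hF : gaussianMGF μ Sg = (1 + a + MvPowerSeries.C (1 / 2) * a ^ 2 +
      MvPowerSeries.C (1 / 6) * a ^ 3 + a ^ 4 * g₁) * (1 + b + MvPowerSeries.C (1 / 2) * b ^ 2 +
      MvPowerSeries.C (1 / 6) * b ^ 3 + b ^ 4 * g₂) := by
    rw [← hg₁, ← hg₂, gaussianMGF]
    simp only [Fin.sum_univ_two, h10, a, b]
    congr 2
    ring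
  refine ⟨a ^ 4 * (g₁ * (1 + b + MvPowerSeries.C (1 / 2) * b ^ 2 +
      MvPowerSeries.C (1 / 6) * b ^ 3 + b ^ 4 * g₂)) + b ^ 2 * ((1 + a + MvPowerSeries.C (1 / 2) *
      a ^ 2 + MvPowerSeries.C (1 / 6) * a ^ 3) * (MvPowerSeries.C (1 / 2) +
      MvPowerSeries.C (1 / 6) * b + b ^ 2 * g₂)) + (a ^ 2 * b) * (MvPowerSeries.C (1 / 2) +
      MvPowerSeries.C (1 / 6) * a), ?_, ?_⟩
  · refine hadd (n := 4) (hadd ?_ ?_) ?_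
    · exact MvPowerSeries.le_order_mul_of_le (MvPowerSeries.order_pow_ge ha 4) (hC _) (by norm_num)
    · exact MvPowerSeries.le_order_mul_of_le (MvPowerSeries.order_pow_ge hb 2) (hC _) (by norm_num)
    · exact MvPowerSeries.le_order_mul_of_le (MvPowerSeries.le_order_mul_of_le (c := 4)
        (MvPowerSeries.order_pow_ge ha 2) hb (by norm_num)) (hC _) (by norm_num)
  -- The constant series are atoms for `ring`, so the relations between 1/2, 1/6 and the numerals
  -- are supplied by hand.
  · have hh : MvPowerSeries.C (2⁻¹) * 2 = (1 : MvPowerSeries (Fin 2) ℂ) := by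
      rw [show (2 : MvPowerSeries (Fin 2) ℂ) = MvPowerSeries.C 2 from (map_ofNat _ 2).symm,
        ← map_mul]
      norm_num
    have hs : MvPowerSeries.C (2⁻¹) = (3 * MvPowerSeries.C (6⁻¹) : MvPowerSeries (Fin 2) ℂ) := by
      rw [show (3 : MvPowerSeries (Fin 2) ℂ) = MvPowerSeries.C 3 from (map_ofNat _ 3).symm,
        ← map_mul]
      norm_num
    rw [hF]
    simp only [div_eq_mul_inv, map_mul, map_add, map_pow, map_one, map_ofNat, a, b]
    linear_combination (MvPowerSeries.C (Sg 0 1) * MvPowerSeries.X 0 * MvPowerSeries.X 1 +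
      MvPowerSeries.C (μ 0) * MvPowerSeries.C (μ 1) * MvPowerSeries.X 0 * MvPowerSeries.X 1 +
      (MvPowerSeries.X 0 ^ 2 * MvPowerSeries.X 1 * MvPowerSeries.C (μ 0) *
        MvPowerSeries.C (Sg 0 1) + MvPowerSeries.X 0 * MvPowerSeries.X 1 ^ 2 *
        MvPowerSeries.C (μ 1) * MvPowerSeries.C (Sg 0 1)) * 0) * hh +
      (MvPowerSeries.X 0 ^ 3 * MvPowerSeries.C (μ 0) * MvPowerSeries.C (Sg 0 0) +
      MvPowerSeries.X 1 ^ 3 * MvPowerSeries.C (μ 1) * MvPowerSeries.C (Sg 1 1) -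
      MvPowerSeries.X 0 ^ 2 * MvPowerSeries.X 1 * MvPowerSeries.C (μ 0) ^ 2 *
        MvPowerSeries.C (μ 1) - MvPowerSeries.X 0 * MvPowerSeries.X 1 ^ 2 *
        MvPowerSeries.C (μ 0) * MvPowerSeries.C (μ 1) ^ 2) * hs

/-- The moments of order at most three of a bivariate Gaussian. -/
theorem gaussianMoment_two (μ : Fin 2 → ℂ) (Sg : Matrix (Fin 2) (Fin 2) ℂ) (hS : Sg.IsSymm) :
    gaussianMoment μ Sg ![0, 0] = 1 ∧ gaussianMoment μ Sg ![1, 0] = μ 0 ∧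
    gaussianMoment μ Sg ![0, 1] = μ 1 ∧ gaussianMoment μ Sg ![2, 0] = Sg 0 0 + μ 0 ^ 2 ∧
    gaussianMoment μ Sg ![1, 1] = Sg 0 1 + μ 0 * μ 1 ∧
    gaussianMoment μ Sg ![0, 2] = Sg 1 1 + μ 1 ^ 2 ∧
    gaussianMoment μ Sg ![3, 0] = μ 0 ^ 3 + 3 * μ 0 * Sg 0 0 ∧
    gaussianMoment μ Sg ![2, 1] = μ 0 ^ 2 * μ 1 + 2 * μ 0 * Sg 0 1 + μ 1 * Sg 0 0 ∧
    gaussianMoment μ Sg ![1, 2] = μ 0 * μ 1 ^ 2 + 2 * μ 1 * Sg 0 1 + μ 0 * Sg 1 1 ∧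
    gaussianMoment μ Sg ![0, 3] = μ 1 ^ 3 + 3 * μ 1 * Sg 1 1 := by
  obtain ⟨g, hg, h⟩ := gaussianMGF_two μ Sg hS
  have key (k l : ℕ) (hkl : k + l ≤ 3) :
      MvPowerSeries.coeff (Finsupp.equivFunOnFinite.symm ![k, l]) g = 0 := by
    apply MvPowerSeries.coeff_eq_zero_of_four_le_order hg
    simpa [Finsupp.degree_eq_sum] using hkl
  refine ⟨?_, ?_, ?_, ?_, ?_, ?_, ?_, ?_, ?_, ?_⟩ <;>
  · rw [gaussianMoment, h]
    simp only [LinearMap.map_add, coeff_C_mul_X_pow_mul_X_pow]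
    rw [key _ _ (by norm_num)]
    simp [Fin.prod_univ_two, Nat.factorial]
    try ring

/-! ### The ten coordinates and the parametrization -/

/-- The ten exponents `(i, j)` with `i + j ≤ 3`. -/
def momentIndex : Fin 10 → MomentIndex 2 3 :=
  ![⟨![0, 0], by decide⟩, ⟨![1, 0], by decide⟩, ⟨![0, 1], by decide⟩, ⟨![2, 0], by decide⟩,
    ⟨![1, 1], by decide⟩, ⟨![0, 2], by decide⟩, ⟨![3, 0], by decide⟩, ⟨![2, 1], by decide⟩,
    ⟨![1, 2], by decide⟩, ⟨![0, 3], by decide⟩]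

theorem momentIndex_bijective : Function.Bijective momentIndex := by
  constructor
  · have h : ∀ i j : Fin 10, (momentIndex i).1 = (momentIndex j).1 → i = j := by decide
    intro i j hij
    exact h i j (congrArg Subtype.val hij)
  · rintro ⟨i, hi⟩
    obtain ⟨a, b, rfl⟩ : ∃ a b, i = ![a, b] := ⟨i 0, i 1, by ext x; fin_cases x <;> rfl⟩
    have hab : a + b ≤ 3 := by simpa using hi
    have key : ∀ a < 4, ∀ b < 4, a + b ≤ 3 → ∃ j, (momentIndex j).1 = ![a, b] := by decide
    obtain ⟨j, hj⟩ := key a (by omega) b (by omega) hab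
    exact ⟨j, Subtype.ext hj⟩

/-- The ten exponents `(i, j)` with `i + j ≤ 3`, as an equivalence. -/
def momentEquiv : Fin 10 ≃ MomentIndex 2 3 := Equiv.ofBijective momentIndex momentIndex_bijective

instance : Finite (MomentIndex 2 3) := Finite.of_equiv _ momentEquiv

theorem card_momentIndex : Nat.card (MomentIndex 2 3) = 9 + 1 := by
  rw [← Nat.card_congr momentEquiv]; simp

/-- The ten coordinates, as variables. -/
def momentVar (j : Fin 10) : MvPolynomial (MomentIndex 2 3) ℂ := X (momentEquiv j)

/-- The values of the ten coordinates in the affine parametrization of the moment variety. -/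
def momentPoly : Fin 10 → MvPolynomial (Fin 5) ℂ :=
  ![1, 3 * X 0, 3 * X 1, X 2 + 6 * X 0 ^ 2, X 3 + 6 * (X 0 * X 1), X 4 + 6 * X 1 ^ 2,
    9 * (X 0 * X 2), 6 * (X 0 * X 3) + 3 * (X 1 * X 2), 3 * (X 0 * X 4) + 6 * (X 1 * X 3),
    9 * (X 1 * X 4)]

/-- The affine parametrization of the moment variety, on coordinate rings. -/
def momentHom : MvPolynomial (MomentIndex 2 3) ℂ →ₐ[ℂ] MvPolynomial (Fin 5) ℂ :=
  aeval fun i => momentPoly (momentEquiv.symm i)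

@[simp] theorem momentHom_momentVar (j : Fin 10) : momentHom (momentVar j) = momentPoly j := by
  simp [momentHom, momentVar]

theorem momentVar_eq : m00 = momentVar 0 ∧ m10 = momentVar 1 ∧ m01 = momentVar 2 ∧
    m20 = momentVar 3 ∧ m11 = momentVar 4 ∧ m02 = momentVar 5 ∧ m30 = momentVar 6 ∧
    m21 = momentVar 7 ∧ m12 = momentVar 8 ∧ m03 = momentVar 9 :=
  ⟨rfl, rfl, rfl, rfl, rfl, rfl, rfl, rfl, rfl, rfl⟩

@[simp] theorem momentHom_m00 : momentHom m00 = 1 := momentHom_momentVar 0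
@[simp] theorem momentHom_m10 : momentHom m10 = 3 * X 0 := momentHom_momentVar 1
@[simp] theorem momentHom_m01 : momentHom m01 = 3 * X 1 := momentHom_momentVar 2
@[simp] theorem momentHom_m20 : momentHom m20 = X 2 + 6 * X 0 ^ 2 := momentHom_momentVar 3
@[simp] theorem momentHom_m11 : momentHom m11 = X 3 + 6 * (X 0 * X 1) := momentHom_momentVar 4
@[simp] theorem momentHom_m02 : momentHom m02 = X 4 + 6 * X 1 ^ 2 := momentHom_momentVar 5
@[simp] theorem momentHom_m30 : momentHom m30 = 9 * (X 0 * X 2) := momentHom_momentVar 6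
@[simp] theorem momentHom_m21 : momentHom m21 = 6 * (X 0 * X 3) + 3 * (X 1 * X 2) :=
  momentHom_momentVar 7
@[simp] theorem momentHom_m12 : momentHom m12 = 3 * (X 0 * X 4) + 6 * (X 1 * X 3) :=
  momentHom_momentVar 8
@[simp] theorem momentHom_m03 : momentHom m03 = 9 * (X 1 * X 4) := momentHom_momentVar 9

/-- The point of the affine parametrization with the given parameters. -/
def momentPoint (u : Fin 5 → ℂ) (i : MomentIndex 2 3) : ℂ :=
  eval u (momentPoly (momentEquiv.symm i))

theorem eval_momentPoint (u : Fin 5 → ℂ) (f : MvPolynomial (MomentIndex 2 3) ℂ) :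
    eval (momentPoint u) f = eval u (momentHom f) := by
  have h : (eval (momentPoint u)) = (eval u).comp momentHom.toRingHom := by
    apply MvPolynomial.ringHom_ext
    · intro r
      change _ = eval u (momentHom (C r))
      rw [MvPolynomial.algHom_C]
      simp [MvPolynomial.algebraMap_eq]
    · intro i
      simp [momentHom, momentPoint]
  rw [h]; rfl

theorem momentPoint_ne_zero (u : Fin 5 → ℂ) : momentPoint u ≠ 0 := by
  intro h
  have := congrFun h (momentEquiv 0)
  simp [momentPoint, momentPoly] at this

/-- The shift of the covariance by μμᵀ/3 absorbs the cubic terms in the mean: μ³ + 3μσ = 9·(μ/3)·(σ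
+ μ²/3). -/
theorem gaussianMomentVector_eq_momentPoint (μ : Fin 2 → ℂ) (Sg : Matrix (Fin 2) (Fin 2) ℂ)
    (hS : Sg.IsSymm) : gaussianMomentVector 3 μ Sg = momentPoint ![μ 0 / 3, μ 1 / 3,
      Sg 0 0 + μ 0 ^ 2 / 3, Sg 0 1 + μ 0 * μ 1 / 3, Sg 1 1 + μ 1 ^ 2 / 3] := by
  obtain ⟨h0, h1, h2, h3, h4, h5, h6, h7, h8, h9⟩ := gaussianMoment_two μ Sg hS
  funext i
  obtain ⟨j, rfl⟩ := momentEquiv.surjective i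
  rw [momentPoint, Equiv.symm_apply_apply]
  have e (j : Fin 10) : (momentEquiv j).1 = (momentIndex j).1 := rfl
  rw [gaussianMomentVector, e]
  fin_cases j <;> simp [momentIndex, momentPoly, *] <;> ring

theorem exists_gaussianMomentVector_eq (u : Fin 5 → ℂ) :
    ∃ (μ : Fin 2 → ℂ) (Sg : Matrix (Fin 2) (Fin 2) ℂ), Sg.IsSymm ∧
      gaussianMomentVector 3 μ Sg = momentPoint u := by
  let Sg : Matrix (Fin 2) (Fin 2) ℂ :=
    !![u 2 - 3 * u 0 ^ 2, u 3 - 3 * (u 0 * u 1); u 3 - 3 * (u 0 * u 1), u 4 - 3 * u 1 ^ 2]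
  have hS : Sg.IsSymm := by
    ext i j; fin_cases i <;> fin_cases j <;> simp [Sg]
  refine ⟨![3 * u 0, 3 * u 1], Sg, hS, ?_⟩
  rw [gaussianMomentVector_eq_momentPoint _ _ hS]
  congr 1
  funext j
  fin_cases j <;> simp [Sg] <;> ring

/-! ### Zariski closures and vanishing ideals -/

theorem ProjSpace.mk_eq_mk_iff {σ : Type} {v w : σ → ℂ} (hv : v ≠ 0) (hw : w ≠ 0) :
    ProjSpace.mk v hv = ProjSpace.mk w hw ↔ ∃ c : ℂ, c ≠ 0 ∧ c • w = v := by
  refine (Projectivization.mk_eq_mk_iff ℂ v w hv hw).trans ?_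
  constructor
  · rintro ⟨a, ha⟩; exact ⟨a, a.ne_zero, ha⟩
  · rintro ⟨c, hc, h⟩; exact ⟨Units.mk0 c hc, h⟩

theorem eval_smul_of_isHomogeneous {σ : Type} {f : MvPolynomial σ ℂ} {k : ℕ}
    (hf : f.IsHomogeneous k) (c : ℂ) (v : σ → ℂ) : eval (c • v) f = c ^ k * eval v f := by
  rw [eval_eq, eval_eq, Finset.mul_sum]
  refine Finset.sum_congr rfl fun d hd => ?_
  have h : d.degree = k := by
    rw [Finsupp.degree_eq_weight_one]
    exact hf (mem_support_iff.mp hd)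
  simp only [Pi.smul_apply, smul_eq_mul, mul_pow, Finset.prod_mul_distrib,
    Finset.prod_pow_eq_pow_sum]
  rw [← h, Finsupp.degree_apply]
  ring

theorem ProjSpace.mk_mem_basicOpen {σ : Type} {f : MvPolynomial σ ℂ} {k : ℕ}
    (hf : f.IsHomogeneous k) {v : σ → ℂ} (hv : v ≠ 0) :
    ProjSpace.mk v hv ∈ ProjSpace.basicOpen f ↔ eval v f ≠ 0 := by
  constructor
  · rintro ⟨w, hw, h, hne⟩
    obtain ⟨c, hc, rfl⟩ := (ProjSpace.mk_eq_mk_iff hv hw).mp h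
    rw [eval_smul_of_isHomogeneous hf]
    exact mul_ne_zero (pow_ne_zero _ hc) hne
  · intro h; exact ⟨v, hv, rfl, h⟩

theorem ProjSpace.isOpen_basicOpen {σ : Type} {f : MvPolynomial σ ℂ} {k : ℕ}
    (hf : f.IsHomogeneous k) : IsOpen (ProjSpace.basicOpen f) :=
  TopologicalSpace.isOpen_generateFrom_of_mem ⟨f, k, hf, rfl⟩

theorem sum_homogeneousComponent_smul {σ : Type} (f : MvPolynomial σ ℂ) (c : ℂ) (v : σ → ℂ) :
    eval (c • v) f = ∑ k ∈ Finset.range (f.totalDegree + 1),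
      c ^ k * eval v (homogeneousComponent k f) := by
  conv_lhs => rw [← sum_homogeneousComponent f]
  rw [map_sum]
  exact Finset.sum_congr rfl fun k _ =>
    eval_smul_of_isHomogeneous (homogeneousComponent_isHomogeneous k f) c v

/-- A polynomial lies in the ideal of the closure of a set of points if and only if all its
homogeneous components vanish on this set. -/
theorem mem_homogeneousIdealOf_closure_iff {σ : Type} (Z : Set (ProjSpace σ))
    (f : MvPolynomial σ ℂ) : f ∈ homogeneousIdealOf (closure Z) ↔
      ∀ k (v : σ → ℂ) (hv : v ≠ 0), ProjSpace.mk v hv ∈ Z →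
        eval v (homogeneousComponent k f) = 0 := by
  rw [homogeneousIdealOf, mem_vanishingIdeal_iff]
  simp only [Set.mem_ofPred_eq, forall_exists_index, aeval_eq_eval, coe_aeval_eq_eval]
  constructor
  · intro h k v hv hZ
    -- As a function of c, this is the value of `f` at `c • v`. It vanishes for all nonzero c, so
    -- all its coefficients vanish.
    let p : Polynomial ℂ := ∑ k ∈ Finset.range (f.totalDegree + 1),
      Polynomial.C (eval v (homogeneousComponent k f)) * Polynomial.X ^ k
    have hp : ∀ c : ℂ, c ≠ 0 → p.eval c = 0 := by
      intro c hc
      have hcv : c • v ≠ 0 := smul_ne_zero hc hv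
      have := h (c • v) hcv (subset_closure
        (by rwa [(ProjSpace.mk_eq_mk_iff hcv hv).mpr ⟨c, hc, rfl⟩]))
      rw [← this, sum_homogeneousComponent_smul]
      rw [Polynomial.eval_finsetSum]
      refine Finset.sum_congr rfl fun k _ => ?_
      rw [Polynomial.eval_mul, Polynomial.eval_C, Polynomial.eval_pow, Polynomial.eval_X, mul_comm]
    have hp0 : p = 0 := by
      refine Polynomial.eq_zero_of_infinite_isRoot p (Set.Infinite.mono (s := {0}ᶜ) ?_ ?_)
      · intro c hc; exact hp c hc
      · exact (Set.finite_singleton 0).infinite_compl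
    by_cases hk : k ∈ Finset.range (f.totalDegree + 1)
    · have := congrArg (fun q => Polynomial.coeff q k) hp0
      simp only [p, Polynomial.finsetSum_coeff, Polynomial.coeff_C_mul_X_pow,
        Polynomial.coeff_zero] at this
      rwa [Finset.sum_ite_eq, if_pos hk] at this
    · rw [homogeneousComponent_eq_zero _ _ (by simpa using hk), map_zero]
  · intro h v hv hZ
    conv_lhs => rw [← sum_homogeneousComponent f]
    rw [map_sum]
    refine Finset.sum_eq_zero fun k _ => ?_
    by_contra hne
    -- A component that does not vanish at a point of the closure defines an open neighbourhood of
    -- it, which must meet the original set.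
    have hh := homogeneousComponent_isHomogeneous k f
    obtain ⟨x, hx, hxZ⟩ := mem_closure_iff.mp hZ _ (ProjSpace.isOpen_basicOpen hh)
      ((ProjSpace.mk_mem_basicOpen hh hv).mpr hne)
    obtain ⟨w, hw, rfl, hne'⟩ := hx
    exact hne' (h k w hw hxZ)

/-- The ideal of the moment variety, through the parametrization. -/
theorem mem_ideal_iff (f : MvPolynomial (MomentIndex 2 3) ℂ) :
    f ∈ homogeneousIdealOf (gaussianMomentVariety 2 3) ↔
      ∀ k, momentHom (homogeneousComponent k f) = 0 := by
  rw [gaussianMomentVariety, mem_homogeneousIdealOf_closure_iff]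
  constructor
  · intro h k
    apply MvPolynomial.funext
    intro u
    obtain ⟨μ, Sg, hS, e⟩ := exists_gaussianMomentVector_eq u
    rw [map_zero, ← eval_momentPoint, ← e]
    exact h k _ (gaussianMomentVector_ne_zero 3 μ Sg) ⟨μ, Sg, hS, rfl⟩
  · rintro h k v hv ⟨μ, Sg, hS, e⟩
    obtain ⟨c, -, rfl⟩ := (ProjSpace.mk_eq_mk_iff hv _).mp e
    rw [eval_smul_of_isHomogeneous (homogeneousComponent_isHomogeneous k f),
      gaussianMomentVector_eq_momentPoint _ _ hS, eval_momentPoint, h, map_zero, mul_zero]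

/-! ### The homogeneous ideal as the kernel of a homogeneous parametrization -/

/-- The parametrization of the affine cone over the moment variety, on coordinate rings. -/
def momentConeHom :
    MvPolynomial (MomentIndex 2 3) ℂ →ₐ[ℂ] Polynomial (MvPolynomial (Fin 5) ℂ) :=
  aeval fun i => Polynomial.C (momentPoly (momentEquiv.symm i)) * Polynomial.X

/-- The extra variable records the degree, so the vanishing of all homogeneous components under
`momentHom` becomes the vanishing of a single image in a domain. -/
theorem coeff_momentConeHom (f : MvPolynomial (MomentIndex 2 3) ℂ) (k : ℕ) :
    (momentConeHom f).coeff k = momentHom (homogeneousComponent k f) := by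
  induction f using MvPolynomial.induction_on' with
  | add p q hp hq => simp [hp, hq]
  | monomial d c =>
    have h1 : momentConeHom (monomial d c) =
        Polynomial.C (momentHom (monomial d c)) * Polynomial.X ^ d.degree := by
      rw [momentConeHom, momentHom, aeval_monomial, aeval_monomial, map_mul]
      simp only [Finsupp.prod, mul_pow, Finset.prod_mul_distrib, Finset.prod_pow_eq_pow_sum,
        Finsupp.degree_apply, map_prod, map_pow]
      rw [mul_assoc]
      rfl
    rw [h1, Polynomial.coeff_C_mul_X_pow]
    have h2 : monomial d c ∈ homogeneousSubmodule (MomentIndex 2 3) ℂ d.degree :=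
      isHomogeneous_monomial c rfl
    rw [homogeneousComponent_of_mem h2]
    split_ifs <;> simp

/-- The homogeneous ideal of the moment variety. -/
def momentIdeal : Ideal (MvPolynomial (MomentIndex 2 3) ℂ) := RingHom.ker momentConeHom

theorem mem_momentIdeal {f : MvPolynomial (MomentIndex 2 3) ℂ} :
    f ∈ momentIdeal ↔ ∀ k, momentHom (homogeneousComponent k f) = 0 := by
  rw [momentIdeal, RingHom.mem_ker, Polynomial.ext_iff]
  simp [coeff_momentConeHom]

theorem homogeneousIdealOf_eq :
    homogeneousIdealOf (gaussianMomentVariety 2 3) = momentIdeal := by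
  ext f
  rw [mem_ideal_iff, mem_momentIdeal]

instance momentIdeal_isPrime : momentIdeal.IsPrime := RingHom.ker_isPrime _

theorem mem_momentIdeal_of_isHomogeneous {f : MvPolynomial (MomentIndex 2 3) ℂ} {k : ℕ}
    (hf : f.IsHomogeneous k) : f ∈ momentIdeal ↔ momentHom f = 0 := by
  rw [mem_momentIdeal]
  constructor
  · intro h
    simpa [homogeneousComponent_of_mem hf] using h k
  · intro h j
    rw [homogeneousComponent_of_mem hf]
    split_ifs <;> simp [h]

theorem homogeneousComponent_mem_momentIdeal {f : MvPolynomial (MomentIndex 2 3) ℂ}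
    (hf : f ∈ momentIdeal) (k : ℕ) : homogeneousComponent k f ∈ momentIdeal := by
  rw [mem_momentIdeal_of_isHomogeneous (homogeneousComponent_isHomogeneous k f)]
  exact mem_momentIdeal.mp hf k

/-- The image of the forms of degree `k` under the affine parametrization. -/
def momentForms (k : ℕ) : Submodule ℂ (MvPolynomial (Fin 5) ℂ) :=
  (homogeneousSubmodule (MomentIndex 2 3) ℂ k).map momentHom.toLinearMap

/-- Both images are isomorphic to the quotient of `p` by the common kernel. -/
theorem finrank_map_eq_of_ker {M N P : Type} [AddCommGroup M] [Module ℂ M] [AddCommGroup N]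
    [Module ℂ N] [AddCommGroup P] [Module ℂ P] (p : Submodule ℂ M) (f : M →ₗ[ℂ] N)
    (g : M →ₗ[ℂ] P) (h : ∀ x ∈ p, f x = 0 ↔ g x = 0) :
    Module.finrank ℂ (p.map f) = Module.finrank ℂ (p.map g) := by
  rw [← LinearMap.range_domRestrict, ← LinearMap.range_domRestrict]
  have hk : LinearMap.ker (f.domRestrict p) = LinearMap.ker (g.domRestrict p) := by
    ext x
    simpa using h x.1 x.2
  exact LinearEquiv.finrank_eq ((f.domRestrict p).quotKerEquivRange.symm.trans
    ((Submodule.quotEquivOfEq _ _ hk).trans (g.domRestrict p).quotKerEquivRange))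

theorem hilbertFunction_momentIdeal (k : ℕ) :
    hilbertFunction momentIdeal k = Module.finrank ℂ (momentForms k) := by
  refine finrank_map_eq_of_ker _ _ _ fun x hx => ?_
  rw [AlgHom.toLinearMap_apply, AlgHom.toLinearMap_apply, Ideal.Quotient.mkₐ_eq_mk,
    Ideal.Quotient.eq_zero_iff_mem]
  exact mem_momentIdeal_of_isHomogeneous hx

theorem momentForms_mul {j k : ℕ} {f g : MvPolynomial (Fin 5) ℂ} (hf : f ∈ momentForms j)
    (hg : g ∈ momentForms k) : f * g ∈ momentForms (j + k) := by
  obtain ⟨f, hf, rfl⟩ := hf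
  obtain ⟨g, hg, rfl⟩ := hg
  exact ⟨f * g, IsHomogeneous.mul hf hg, map_mul momentHom f g⟩

theorem momentPoly_mem (j : Fin 10) : momentPoly j ∈ momentForms 1 :=
  ⟨momentVar j, isHomogeneous_X _ _, momentHom_momentVar j⟩

/-! ### Monomials in the ten coordinates -/

/-- The monomial in the ten coordinates with given exponents. -/
def momentMonomial (e : Fin 10 → ℕ) : MvPolynomial (MomentIndex 2 3) ℂ :=
  ∏ j, momentVar j ^ e j

theorem momentMonomial_add (e f : Fin 10 → ℕ) :
    momentMonomial (e + f) = momentMonomial e * momentMonomial f := by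
  simp [momentMonomial, pow_add, Finset.prod_mul_distrib]

theorem momentMonomial_eq (e : Fin 10 → ℕ) :
    momentMonomial e =
      monomial (Finsupp.equivFunOnFinite.symm fun i => e (momentEquiv.symm i)) 1 := by
  classical
  letI : Fintype (MomentIndex 2 3) := Fintype.ofEquiv _ momentEquiv
  rw [monomial_eq, Finsupp.prod_fintype _ _ (by simp), momentMonomial, C_1, one_mul]
  exact Fintype.prod_equiv momentEquiv _ _ (by simp [momentVar])

theorem momentMonomial_isHomogeneous (e : Fin 10 → ℕ) :
    (momentMonomial e).IsHomogeneous (∑ j, e j) := by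
  apply IsHomogeneous.prod
  intro j _
  have h := (isHomogeneous_X ℂ (momentEquiv j)).pow (e j)
  rwa [one_mul] at h

theorem monomial_eq_momentMonomial (d : MomentIndex 2 3 →₀ ℕ) (c : ℂ) :
    monomial d c = c • momentMonomial fun j => d (momentEquiv j) := by
  rw [momentMonomial_eq, smul_monomial, smul_eq_mul, mul_one]
  congr
  ext i
  simp

theorem homogeneousSubmodule_le_span (k : ℕ) :
    homogeneousSubmodule (MomentIndex 2 3) ℂ k ≤
      Submodule.span ℂ {f | ∃ e : Fin 10 → ℕ, ∑ j, e j = k ∧ f = momentMonomial e} := by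
  intro f hf
  rw [← support_sum_monomial_coeff f]
  refine Submodule.sum_mem _ fun d hd => ?_
  rw [monomial_eq_momentMonomial]
  refine Submodule.smul_mem _ _ (Submodule.subset_span ⟨_, ?_, rfl⟩)
  letI : Fintype (MomentIndex 2 3) := Fintype.ofEquiv _ momentEquiv
  have h : d.degree = k := by
    rw [Finsupp.degree_eq_weight_one]
    exact hf (mem_support_iff.mp hd)
  rw [← h, Finsupp.degree_eq_sum]
  exact Fintype.sum_equiv momentEquiv _ _ (by simp)

instance momentForms_finite (k : ℕ) : Module.Finite ℂ (momentForms k) := by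
  have hfin : {f | ∃ e : Fin 10 → ℕ, ∑ j, e j = k ∧ f = momentMonomial e}.Finite := by
    refine Set.Finite.subset ((Finset.finite_toSet (Fintype.piFinset fun _ : Fin 10 =>
      Finset.range (k + 1))).image momentMonomial) ?_
    rintro f ⟨e, he, rfl⟩
    refine ⟨e, ?_, rfl⟩
    simp only [Finset.mem_coe, Fintype.mem_piFinset, Finset.mem_range]
    intro j
    have := Finset.single_le_sum (f := e) (fun i _ => Nat.zero_le _) (Finset.mem_univ j)
    omega
  have : Module.Finite ℂ (Submodule.span ℂ
      {f | ∃ e : Fin 10 → ℕ, ∑ j, e j = k ∧ f = momentMonomial e}) :=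
    Module.Finite.span_of_finite ℂ hfin
  have h2 : Module.Finite ℂ (homogeneousSubmodule (MomentIndex 2 3) ℂ k) :=
    Submodule.finiteDimensional_of_le (homogeneousSubmodule_le_span k)
  exact Module.Finite.map _ _

/-! ### Generators of the ideal -/

/-- Fourteen cubics in the ideal of the moment variety. -/
def momentCubic : Fin 14 → MvPolynomial (MomentIndex 2 3) ℂ :=
  ![
    cumulantCubic30,
    cumulantCubic21,
    cumulantCubic12,
    cumulantCubic03,
    m00 * m10 * m03 - 2 * m10 * m01 * m02 + 2 * m01 ^ 2 * m11 - m00 * m01 * m12,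
    m10 * m02 ^ 2 - m10 * m01 * m03 + m00 * m11 * m03 - m01 * m11 * m02 - m00 * m02 * m12 + m01 ^ 2 *
      m12,
    m01 ^ 2 * m30 - m10 * m20 * m02 - m10 * m01 * m21 - m01 * m20 * m11 - m00 * m11 * m21 + 2 * m10
      * m11 ^ 2 + m00 * m20 * m12,
    m01 * m02 * m30 - m10 * m20 * m03 - m10 * m02 * m21 - 2 * m01 * m11 * m21 + m01 * m20 * m12 +
      2 * m10 * m11 * m12,
    m00 * m01 * m30 - 2 * m10 * m01 * m20 - m00 * m10 * m21 + 2 * m10 ^ 2 * m11,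
    m00 * m02 * m30 - 2 * m10 * m20 * m02 - 2 * m10 * m01 * m21 + 2 * m01 * m20 * m11 - m00 * m20
      * m12 + 2 * m10 ^ 2 * m12,
    m01 ^ 2 * m20 - m00 * m01 * m21 - m10 ^ 2 * m02 + m00 * m10 * m12,
    m01 * m20 * m02 - m00 * m02 * m21 - m10 ^ 2 * m03 + m10 * m11 * m02 - 2 * m01 * m11 ^ 2 + m10 *
      m01 * m12 + m00 * m11 * m12,
    m01 * m20 ^ 2 - m00 * m20 * m21 - m10 * m01 * m30 + m10 ^ 2 * m21 + m00 * m11 * m30 - m10 * m20 *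
      m11,
    m00 * m20 * m03 - 3 * m00 * m02 * m21 + 2 * m01 ^ 2 * m21 - 2 * m10 ^ 2 * m03 + 4 * m10 * m11 *
      m02 - 4 * m01 * m11 ^ 2 + 2 * m00 * m11 * m12]

/-- Four quartics in the ideal of the moment variety. -/
def momentQuartic : Fin 4 → MvPolynomial (MomentIndex 2 3) ℂ :=
  ![
    m02 ^ 3 * m30 + m00 * m30 * m03 ^ 2 - 3 * m10 * m20 * m03 ^ 2 - 3 * m10 * m02 * m21 * m03 + 3 * m20
      * m11 * m02 * m03 - 3 * m11 * m02 ^ 2 * m21 - 4 * m11 ^ 3 * m03 - 3 * m20 * m02 ^ 2 * m12 + 3 *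
      m01 * m20 * m12 * m03 - 3 * m00 * m21 * m12 * m03 + 3 * m01 * m02 * m21 * m12 + 6 * m10 *
      m11 * m12 * m03 + 6 * m11 ^ 2 * m02 * m12 - 6 * m01 * m11 * m12 ^ 2 + 2 * m00 * m12 ^ 3,
    m20 * m02 ^ 2 * m30 - m01 * m20 * m30 * m03 + m00 * m30 * m21 * m03 - 2 * m10 * m20 * m21 * m03
      - 2 * m10 * m02 * m21 ^ 2 + m20 ^ 2 * m11 * m03 + 3 * m20 * m11 * m02 * m21 - 2 * m01 * m11 *
      m21 ^ 2 - 2 * m11 ^ 2 * m02 * m30 - 3 * m20 ^ 2 * m02 * m12 + m01 * m20 * m21 * m12 + m00 * m21 ^ 2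
      * m12 + 2 * m10 * m02 * m30 * m12 + 2 * m01 * m11 * m30 * m12 - 2 * m00 * m30 * m12 ^ 2 + 2 *
      m10 * m20 * m12 ^ 2,
    m20 ^ 2 * m02 * m03 - 3 * m20 * m02 ^ 2 * m21 + 2 * m01 * m20 * m21 * m03 - 2 * m00 * m21 ^ 2 * m03
      + 2 * m01 * m02 * m21 ^ 2 - m10 * m02 * m30 * m03 + m11 * m02 ^ 2 * m30 + 2 * m10 * m11 * m21 *
      m03 - 2 * m20 * m11 ^ 2 * m03 + m00 * m30 * m12 * m03 - 2 * m10 * m20 * m12 * m03 - m10 * m02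
      * m21 * m12 + 3 * m20 * m11 * m02 * m12 - 4 * m01 * m11 * m21 * m12 + m00 * m21 * m12 ^ 2 + 2
      * m10 * m11 * m12 ^ 2,
    m20 ^ 3 * m03 + m00 * m30 ^ 2 * m03 - 3 * m20 ^ 2 * m02 * m21 + 2 * m00 * m21 ^ 3 - 3 * m10 * m20 *
      m30 * m03 + 3 * m20 * m11 * m02 * m30 - 6 * m10 * m11 * m21 ^ 2 + 6 * m20 * m11 ^ 2 * m21 - 4 *
      m11 ^ 3 * m30 - 3 * m00 * m30 * m21 * m12 + 3 * m10 * m20 * m21 * m12 - 3 * m20 ^ 2 * m11 * m12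
      + 6 * m10 * m11 * m30 * m12]

/-- The ideal generated by the fourteen cubics and the four quartics. -/
def momentGenIdeal : Ideal (MvPolynomial (MomentIndex 2 3) ℂ) :=
  Ideal.span (Set.range momentCubic ∪ Set.range momentQuartic)

theorem momentCubic_mem (j : Fin 14) : momentCubic j ∈ momentGenIdeal :=
  Ideal.subset_span (Or.inl ⟨j, rfl⟩)

theorem momentQuartic_mem (j : Fin 4) : momentQuartic j ∈ momentGenIdeal :=
  Ideal.subset_span (Or.inr ⟨j, rfl⟩)

/-- The exponents of the leading monomials. -/
def leadExponent : Fin 20 → Fin 10 → ℕ :=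
  ![![2, 0, 0, 0, 0, 0, 1, 0, 0, 0],
    ![1, 0, 1, 1, 0, 0, 0, 0, 0, 0],
    ![1, 1, 0, 0, 0, 1, 0, 0, 0, 0],
    ![2, 0, 0, 0, 0, 0, 0, 0, 0, 1],
    ![1, 1, 0, 0, 0, 0, 0, 0, 0, 1],
    ![0, 1, 0, 0, 0, 2, 0, 0, 0, 0],
    ![0, 0, 2, 0, 0, 0, 1, 0, 0, 0],
    ![0, 0, 1, 0, 0, 1, 1, 0, 0, 0],
    ![1, 0, 1, 0, 0, 0, 1, 0, 0, 0],
    ![1, 0, 0, 0, 0, 1, 1, 0, 0, 0],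
    ![0, 0, 2, 1, 0, 0, 0, 0, 0, 0],
    ![0, 0, 1, 1, 0, 1, 0, 0, 0, 0],
    ![0, 0, 1, 2, 0, 0, 0, 0, 0, 0],
    ![1, 0, 0, 1, 0, 0, 0, 0, 0, 1],
    ![0, 1, 0, 2, 0, 0, 0, 0, 0, 1],
    ![0, 1, 0, 2, 0, 1, 0, 0, 0, 0],
    ![0, 0, 0, 0, 0, 3, 1, 0, 0, 0],
    ![0, 0, 0, 1, 0, 2, 1, 0, 0, 0],
    ![0, 0, 0, 2, 0, 1, 0, 0, 0, 1],
    ![0, 0, 0, 3, 0, 0, 0, 0, 0, 1]]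

/-- The tails of the polynomials with the given leading monomials. -/
def leadTail : Fin 20 → List (ℤ × (Fin 10 → ℕ)) :=
  ![
    [(3, ![1, 1, 0, 1, 0, 0, 0, 0, 0, 0]), (-2, ![0, 3, 0, 0, 0, 0, 0, 0, 0, 0])],
    [(1, ![2, 0, 0, 0, 0, 0, 0, 1, 0, 0]), (2, ![0, 2, 1, 0, 0, 0, 0, 0, 0, 0]), (-2, ![1, 1, 0,
      0, 1, 0, 0, 0, 0, 0])],
    [(2, ![0, 1, 2, 0, 0, 0, 0, 0, 0, 0]), (-2, ![1, 0, 1, 0, 1, 0, 0, 0, 0, 0]), (1, ![2, 0, 0,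
      0, 0, 0, 0, 0, 1, 0])],
    [(3, ![1, 0, 1, 0, 0, 1, 0, 0, 0, 0]), (-2, ![0, 0, 3, 0, 0, 0, 0, 0, 0, 0])],
    [(2, ![0, 1, 1, 0, 0, 1, 0, 0, 0, 0]), (-2, ![0, 0, 2, 0, 1, 0, 0, 0, 0, 0]), (1, ![1, 0, 1,
      0, 0, 0, 0, 0, 1, 0])],
    [(1, ![0, 1, 1, 0, 0, 0, 0, 0, 0, 1]), (-1, ![1, 0, 0, 0, 1, 0, 0, 0, 0, 1]), (1, ![0, 0, 1,
      0, 1, 1, 0, 0, 0, 0]), (1, ![1, 0, 0, 0, 0, 1, 0, 0, 1, 0]), (-1, ![0, 0, 2, 0, 0, 0, 0, 0,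
      1, 0])],
    [(1, ![0, 1, 0, 1, 0, 1, 0, 0, 0, 0]), (1, ![0, 1, 1, 0, 0, 0, 0, 1, 0, 0]), (1, ![0, 0, 1,
      1, 1, 0, 0, 0, 0, 0]), (1, ![1, 0, 0, 0, 1, 0, 0, 1, 0, 0]), (-2, ![0, 1, 0, 0, 2, 0, 0, 0,
      0, 0]), (-1, ![1, 0, 0, 1, 0, 0, 0, 0, 1, 0])],
    [(1, ![0, 1, 0, 1, 0, 0, 0, 0, 0, 1]), (1, ![0, 1, 0, 0, 0, 1, 0, 1, 0, 0]), (2, ![0, 0, 1,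
      0, 1, 0, 0, 1, 0, 0]), (-1, ![0, 0, 1, 1, 0, 0, 0, 0, 1, 0]), (-2, ![0, 1, 0, 0, 1, 0, 0,
      0, 1, 0])],
    [(2, ![0, 1, 1, 1, 0, 0, 0, 0, 0, 0]), (1, ![1, 1, 0, 0, 0, 0, 0, 1, 0, 0]), (-2, ![0, 2, 0,
      0, 1, 0, 0, 0, 0, 0])],
    [(2, ![0, 1, 0, 1, 0, 1, 0, 0, 0, 0]), (2, ![0, 1, 1, 0, 0, 0, 0, 1, 0, 0]), (-2, ![0, 0, 1,
      1, 1, 0, 0, 0, 0, 0]), (1, ![1, 0, 0, 1, 0, 0, 0, 0, 1, 0]), (-2, ![0, 2, 0, 0, 0, 0, 0, 0,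
      1, 0])],
    [(1, ![1, 0, 1, 0, 0, 0, 0, 1, 0, 0]), (1, ![0, 2, 0, 0, 0, 1, 0, 0, 0, 0]), (-1, ![1, 1, 0,
      0, 0, 0, 0, 0, 1, 0])],
    [(1, ![1, 0, 0, 0, 0, 1, 0, 1, 0, 0]), (1, ![0, 2, 0, 0, 0, 0, 0, 0, 0, 1]), (-1, ![0, 1, 0,
      0, 1, 1, 0, 0, 0, 0]), (2, ![0, 0, 1, 0, 2, 0, 0, 0, 0, 0]), (-1, ![0, 1, 1, 0, 0, 0, 0, 0,
      1, 0]), (-1, ![1, 0, 0, 0, 1, 0, 0, 0, 1, 0])],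
    [(1, ![1, 0, 0, 1, 0, 0, 0, 1, 0, 0]), (1, ![0, 1, 1, 0, 0, 0, 1, 0, 0, 0]), (-1, ![0, 2, 0,
      0, 0, 0, 0, 1, 0, 0]), (-1, ![1, 0, 0, 0, 1, 0, 1, 0, 0, 0]), (1, ![0, 1, 0, 1, 1, 0, 0, 0,
      0, 0])],
    [(3, ![1, 0, 0, 0, 0, 1, 0, 1, 0, 0]), (-2, ![0, 0, 2, 0, 0, 0, 0, 1, 0, 0]), (2, ![0, 2, 0,
      0, 0, 0, 0, 0, 0, 1]), (-4, ![0, 1, 0, 0, 1, 1, 0, 0, 0, 0]), (4, ![0, 0, 1, 0, 2, 0, 0, 0,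
      0, 0]), (-2, ![1, 0, 0, 0, 1, 0, 0, 0, 1, 0])],
    [(1, ![0, 1, 0, 1, 0, 1, 0, 1, 0, 0]), (2, ![0, 1, 1, 0, 0, 0, 0, 2, 0, 0]), (1, ![0, 2, 0,
      0, 0, 0, 1, 0, 0, 1]), (-4, ![0, 0, 1, 1, 1, 0, 0, 1, 0, 0]), (-1, ![0, 1, 0, 0, 1, 1, 1,
      0, 0, 0]), (2, ![0, 0, 1, 0, 2, 0, 1, 0, 0, 0]), (2, ![1, 0, 0, 1, 0, 0, 0, 1, 1, 0]), (-3,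
      ![0, 2, 0, 0, 0, 0, 0, 1, 1, 0]), (-2, ![1, 0, 0, 0, 1, 0, 1, 0, 1, 0]), (3, ![0, 1, 0, 1,
      1, 0, 0, 0, 1, 0])],
    [(1, ![0, 1, 1, 1, 0, 0, 0, 1, 0, 0]), (1, ![1, 1, 0, 0, 0, 0, 0, 2, 0, 0]), (1, ![0, 2, 0,
      0, 0, 1, 1, 0, 0, 0]), (-2, ![1, 0, 0, 1, 1, 0, 0, 1, 0, 0]), (-1, ![0, 1, 1, 0, 1, 0, 1,
      0, 0, 0]), (-1, ![0, 2, 0, 0, 1, 0, 0, 1, 0, 0]), (1, ![1, 0, 0, 0, 2, 0, 1, 0, 0, 0]), (1,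
      ![0, 1, 0, 1, 2, 0, 0, 0, 0, 0]), (1, ![1, 0, 0, 2, 0, 0, 0, 0, 1, 0]), (-1, ![1, 1, 0, 0,
      0, 0, 1, 0, 1, 0])],
    [(-1, ![1, 0, 0, 0, 0, 0, 1, 0, 0, 2]), (3, ![0, 1, 0, 1, 0, 0, 0, 0, 0, 2]), (3, ![0, 1, 0,
      0, 0, 1, 0, 1, 0, 1]), (-3, ![0, 0, 0, 1, 1, 1, 0, 0, 0, 1]), (3, ![0, 0, 0, 0, 1, 2, 0, 1,
      0, 0]), (4, ![0, 0, 0, 0, 3, 0, 0, 0, 0, 1]), (3, ![0, 0, 0, 1, 0, 2, 0, 0, 1, 0]), (-3,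
      ![0, 0, 1, 1, 0, 0, 0, 0, 1, 1]), (3, ![1, 0, 0, 0, 0, 0, 0, 1, 1, 1]), (-3, ![0, 0, 1, 0,
      0, 1, 0, 1, 1, 0]), (-6, ![0, 1, 0, 0, 1, 0, 0, 0, 1, 1]), (-6, ![0, 0, 0, 0, 2, 1, 0, 0,
      1, 0]), (6, ![0, 0, 1, 0, 1, 0, 0, 0, 2, 0]), (-2, ![1, 0, 0, 0, 0, 0, 0, 0, 3, 0])],
    [(1, ![0, 0, 1, 1, 0, 0, 1, 0, 0, 1]), (-1, ![1, 0, 0, 0, 0, 0, 1, 1, 0, 1]), (2, ![0, 1, 0,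
      1, 0, 0, 0, 1, 0, 1]), (2, ![0, 1, 0, 0, 0, 1, 0, 2, 0, 0]), (-1, ![0, 0, 0, 2, 1, 0, 0, 0,
      0, 1]), (-3, ![0, 0, 0, 1, 1, 1, 0, 1, 0, 0]), (2, ![0, 0, 1, 0, 1, 0, 0, 2, 0, 0]), (2,
      ![0, 0, 0, 0, 2, 1, 1, 0, 0, 0]), (3, ![0, 0, 0, 2, 0, 1, 0, 0, 1, 0]), (-1, ![0, 0, 1, 1,
      0, 0, 0, 1, 1, 0]), (-1, ![1, 0, 0, 0, 0, 0, 0, 2, 1, 0]), (-2, ![0, 1, 0, 0, 0, 1, 1, 0,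
      1, 0]), (-2, ![0, 0, 1, 0, 1, 0, 1, 0, 1, 0]), (2, ![1, 0, 0, 0, 0, 0, 1, 0, 2, 0]), (-2,
      ![0, 1, 0, 1, 0, 0, 0, 0, 2, 0])],
    [(3, ![0, 0, 0, 1, 0, 2, 0, 1, 0, 0]), (-2, ![0, 0, 1, 1, 0, 0, 0, 1, 0, 1]), (2, ![1, 0, 0,
      0, 0, 0, 0, 2, 0, 1]), (-2, ![0, 0, 1, 0, 0, 1, 0, 2, 0, 0]), (1, ![0, 1, 0, 0, 0, 1, 1, 0,
      0, 1]), (-1, ![0, 0, 0, 0, 1, 2, 1, 0, 0, 0]), (-2, ![0, 1, 0, 0, 1, 0, 0, 1, 0, 1]), (2,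
      ![0, 0, 0, 1, 2, 0, 0, 0, 0, 1]), (-1, ![1, 0, 0, 0, 0, 0, 1, 0, 1, 1]), (2, ![0, 1, 0, 1,
      0, 0, 0, 0, 1, 1]), (1, ![0, 1, 0, 0, 0, 1, 0, 1, 1, 0]), (-3, ![0, 0, 0, 1, 1, 1, 0, 0, 1,
      0]), (4, ![0, 0, 1, 0, 1, 0, 0, 1, 1, 0]), (-1, ![1, 0, 0, 0, 0, 0, 0, 1, 2, 0]), (-2, ![0,
      1, 0, 0, 1, 0, 0, 0, 2, 0])],
    [(-1, ![1, 0, 0, 0, 0, 0, 2, 0, 0, 1]), (3, ![0, 0, 0, 2, 0, 1, 0, 1, 0, 0]), (-2, ![1, 0, 0,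
      0, 0, 0, 0, 3, 0, 0]), (3, ![0, 1, 0, 1, 0, 0, 1, 0, 0, 1]), (-3, ![0, 0, 0, 1, 1, 1, 1, 0,
      0, 0]), (6, ![0, 1, 0, 0, 1, 0, 0, 2, 0, 0]), (-6, ![0, 0, 0, 1, 2, 0, 0, 1, 0, 0]), (4,
      ![0, 0, 0, 0, 3, 0, 1, 0, 0, 0]), (3, ![1, 0, 0, 0, 0, 0, 1, 1, 1, 0]), (-3, ![0, 1, 0, 1,
      0, 0, 0, 1, 1, 0]), (3, ![0, 0, 0, 2, 1, 0, 0, 0, 1, 0]), (-6, ![0, 1, 0, 0, 1, 0, 1, 0, 1,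
      0])]]

/-- Weights of the ten coordinates for which the leading monomials lead. -/
def leadWeight : Fin 10 → ℕ := ![6, 2, 5, 7, 0, 7, 7, 3, 0, 7]

/-- This makes the rewriting of leading monomials terminate within a fixed degree. Since one weight
drops strictly on every tail, no monomial order is needed. -/
theorem leadTail_lt : ∀ i, ∀ p ∈ leadTail i, ∑ j, p.2 j = ∑ j, leadExponent i j ∧
    ∑ j, leadWeight j * p.2 j < ∑ j, leadWeight j * leadExponent i j := by
  decide

theorem momentMonomial_vec (a b c d e f g h i j : ℕ) :
    momentMonomial ![a, b, c, d, e, f, g, h, i, j] = m00 ^ a * m10 ^ b * m01 ^ c * m20 ^ d *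
      m11 ^ e * m02 ^ f * m30 ^ g * m21 ^ h * m12 ^ i * m03 ^ j := by
  obtain ⟨h0, h1, h2, h3, h4, h5, h6, h7, h8, h9⟩ := momentVar_eq
  rw [h0, h1, h2, h3, h4, h5, h6, h7, h8, h9]
  simp only [momentMonomial, Fin.prod_univ_succ, Fin.prod_univ_zero, mul_one, mul_assoc]
  rfl

/-- The polynomial with the given leading monomial and tail. -/
def leadPoly (i : Fin 20) : MvPolynomial (MomentIndex 2 3) ℂ :=
  momentMonomial (leadExponent i) - ((leadTail i).map fun p => p.1 • momentMonomial p.2).sum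

/-- The leading coefficients of the fourteen cubics. -/
def leadSign : Fin 14 → ℤ := ![1, -1, -1, 1, 1, 1, 1, 1, 1, 1, 1, 1, 1, 1]

theorem leadPoly_castLE (j : Fin 14) :
    leadPoly (j.castLE (by norm_num)) = leadSign j • momentCubic j := by
  fin_cases j <;>
  · simp [leadPoly, leadSign, leadExponent, leadTail, momentCubic, momentMonomial_vec,
      cumulantCubic30, cumulantCubic21, cumulantCubic12, cumulantCubic03]
    ring

theorem leadPoly_natAdd (j : Fin 4) : leadPoly (j.natAdd 16) = momentQuartic j := by
  fin_cases j <;>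
  · simp [leadPoly, leadExponent, leadTail, momentQuartic, momentMonomial_vec]
    ring

/-- Positions 0 to 13 are the cubics up to sign and 16 to 19 the quartics. Positions 14 and 15 are
linear syzygy-like combinations of four cubics each, whose leading monomials are divisible by none
of the cubic ones; they are needed for the count but not as generators. -/
theorem leadPoly_mem (i : Fin 20) : leadPoly i ∈ momentGenIdeal := by
  have h3 (j : Fin 14) : leadPoly (j.castLE (by norm_num)) ∈ momentGenIdeal :=
    leadPoly_castLE j ▸ zsmul_mem (momentCubic_mem j) _
  have h4 (j : Fin 4) : leadPoly (j.natAdd 16) ∈ momentGenIdeal :=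
    leadPoly_natAdd j ▸ momentQuartic_mem j
  have h5 (k l m n : Fin 14) (a b c d f : MvPolynomial (MomentIndex 2 3) ℂ)
      (h : f = a * momentCubic k + b * momentCubic l + c * momentCubic m + d * momentCubic n) :
      f ∈ momentGenIdeal := by
    rw [h]
    have h6 (k : Fin 14) (c : MvPolynomial (MomentIndex 2 3) ℂ) :
        c * momentCubic k ∈ momentGenIdeal := Ideal.mul_mem_left _ c (momentCubic_mem k)
    exact add_mem (add_mem (add_mem (h6 k a) (h6 l b)) (h6 m c)) (h6 n d)
  fin_cases i
  exacts [h3 0, h3 1, h3 2, h3 3, h3 4, h3 5, h3 6, h3 7, h3 8, h3 9, h3 10, h3 11, h3 12, h3 13,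
    h5 7 11 9 12 (-m20) m30 m21 m12 _ (by
      simp [leadPoly, leadExponent, leadTail, momentCubic, momentMonomial_vec]; ring),
    h5 6 12 10 8 (-m20) (-m11) m30 m21 _ (by
      simp [leadPoly, leadExponent, leadTail, momentCubic, momentMonomial_vec]; ring),
    h4 0, h4 1, h4 2, h4 3]

/-! ### Standard monomials span the quotient -/

/-- The span of the monomials of degree `k` that no leading monomial divides. -/
def standardSpan (k : ℕ) : Submodule ℂ (MvPolynomial (MomentIndex 2 3) ℂ) :=
  Submodule.span ℂ {f | ∃ e : Fin 10 → ℕ, ∑ j, e j = k ∧ (∀ i, ¬ leadExponent i ≤ e) ∧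
    f = momentMonomial e}

/-- Division with remainder, as induction on the weight: a monomial divisible by a leading monomial
is congruent to a combination of monomials of the same degree and smaller weight. -/
theorem momentMonomial_mem_sup (w : ℕ) : ∀ e : Fin 10 → ℕ, ∑ j, leadWeight j * e j = w →
    momentMonomial e ∈ momentGenIdeal.restrictScalars ℂ ⊔ standardSpan (∑ j, e j) := by
  induction w using Nat.strong_induction_on with
  | _ w ih =>
  intro e he
  by_cases h : ∃ i, leadExponent i ≤ e
  · obtain ⟨i, hi⟩ := h
    obtain ⟨n, rfl⟩ : ∃ n, e = leadExponent i + n := ⟨e - leadExponent i, by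
      funext j; simp only [Pi.add_apply, Pi.sub_apply]
      exact (Nat.add_sub_of_le (hi j)).symm⟩
    set t := ((leadTail i).map fun p => p.1 • momentMonomial p.2).sum with ht
    have h1 : momentMonomial (leadExponent i + n) =
        momentMonomial n * (momentMonomial (leadExponent i) - t) + momentMonomial n * t := by
      rw [momentMonomial_add]; ring
    rw [h1]
    refine Submodule.add_mem _ (Submodule.mem_sup_left
      (Ideal.mul_mem_left _ _ (leadPoly_mem i))) ?_
    rw [ht, ← List.sum_map_mul_left]
    refine list_sum_mem fun f hf => ?_
    obtain ⟨p, hp, rfl⟩ := List.mem_map.mp hf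
    obtain ⟨h2, h3⟩ := leadTail_lt i p hp
    rw [mul_smul_comm, ← momentMonomial_add]
    refine zsmul_mem ?_ _
    have h4 : ∑ j, (n + p.2) j = ∑ j, (leadExponent i + n) j := by
      simp only [Pi.add_apply, Finset.sum_add_distrib, h2]
      ring
    rw [← h4]
    refine ih _ ?_ (n + p.2) rfl
    rw [← he]
    simp only [Pi.add_apply, mul_add, Finset.sum_add_distrib]
    omega
  · push Not at h
    exact Submodule.mem_sup_right (Submodule.subset_span ⟨e, rfl, h, rfl⟩)

theorem homogeneousSubmodule_le_sup (k : ℕ) : homogeneousSubmodule (MomentIndex 2 3) ℂ k ≤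
    momentGenIdeal.restrictScalars ℂ ⊔ standardSpan k := by
  refine (homogeneousSubmodule_le_span k).trans (Submodule.span_le.mpr ?_)
  rintro f ⟨e, rfl, rfl⟩
  exact momentMonomial_mem_sup _ e rfl

/-! ### Counting the standard monomials -/

/-- The smallest exponents in the pieces of a partition of the standard monomials. -/
def pieceExponent : Fin 22 → Fin 10 → ℕ :=
  ![![0, 0, 0, 0, 0, 0, 0, 0, 0, 0],
    ![0, 0, 1, 0, 0, 0, 0, 0, 0, 0],
    ![0, 0, 2, 0, 0, 0, 0, 0, 0, 0],
    ![0, 0, 0, 0, 0, 1, 0, 0, 0, 0],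
    ![0, 0, 1, 0, 0, 1, 0, 0, 0, 0],
    ![0, 0, 0, 0, 0, 2, 0, 0, 0, 0],
    ![0, 0, 0, 0, 0, 2, 1, 0, 0, 0],
    ![0, 0, 0, 1, 0, 0, 0, 0, 0, 0],
    ![0, 0, 0, 1, 0, 1, 0, 0, 0, 0],
    ![0, 0, 0, 1, 0, 2, 0, 0, 0, 0],
    ![0, 0, 0, 2, 0, 0, 0, 0, 0, 0],
    ![0, 0, 0, 2, 0, 0, 0, 0, 0, 1],
    ![0, 0, 0, 2, 0, 1, 0, 0, 0, 0],
    ![0, 0, 0, 2, 0, 2, 0, 0, 0, 0],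
    ![0, 0, 1, 1, 0, 0, 0, 0, 0, 0],
    ![1, 0, 0, 0, 0, 0, 0, 0, 0, 0],
    ![2, 0, 0, 0, 0, 0, 0, 0, 0, 0],
    ![1, 0, 0, 1, 0, 0, 0, 0, 0, 0],
    ![1, 1, 0, 0, 0, 0, 0, 0, 0, 0],
    ![1, 1, 1, 0, 0, 0, 0, 0, 0, 0],
    ![1, 0, 0, 0, 0, 0, 1, 0, 0, 0],
    ![1, 0, 0, 0, 0, 0, 1, 0, 0, 1]]

/-- The free coordinates in the pieces of a partition of the standard monomials. -/
def pieceFree : Fin 22 → Finset (Fin 10) :=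
  ![{1, 4, 6, 7, 8, 9},
    {1, 4, 6, 7, 8, 9},
    {1, 2, 4, 7, 8, 9},
    {1, 4, 6, 7, 8, 9},
    {1, 2, 4, 7, 8, 9},
    {2, 4, 5, 7, 8, 9},
    {4, 6, 7, 8, 9},
    {1, 4, 6, 7, 8, 9},
    {1, 4, 6, 7, 8, 9},
    {4, 5, 7, 8, 9},
    {1, 3, 4, 6, 7, 8},
    {4, 6, 7, 8, 9},
    {3, 4, 6, 7, 8},
    {3, 4, 5, 7, 8},
    {1, 4, 6, 7, 8, 9},
    {2, 4, 5, 7, 8, 9},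
    {0, 2, 4, 5, 7, 8},
    {0, 3, 4, 5, 7, 8},
    {0, 1, 3, 4, 7, 8},
    {0, 1, 2, 4, 7, 8},
    {1, 3, 4, 6, 7, 8},
    {4, 6, 7, 8, 9}]

/-- A decision tree on a few exponents whose leaves are the 22 pieces. Only covering is shown;
disjointness follows from the final equality of dimensions and is not needed. -/
theorem exists_piece (e : Fin 10 → ℕ) (he : ∀ i, ¬ leadExponent i ≤ e) :
    ∃ p, ∀ j, pieceExponent p j ≤ e j ∧ (j ∉ pieceFree p → e j = pieceExponent p j) := by
  -- `K` and `L` list the upper and lower bounds collected along a branch. A coordinate is either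
  -- free, or bounded by `K`, or already at its maximum because raising it by one would create a
  -- multiple of a leading monomial.
  have leaf (p : Fin 22) (K L : List (Fin 10 × ℕ)) (hK : ∀ q ∈ K, e q.1 ≤ q.2)
      (hL : ∀ q ∈ L, q.2 ≤ e q.1) (hpL : ∀ j, pieceExponent p j = 0 ∨ (j, pieceExponent p j) ∈ L)
      (hpK : ∀ j, j ∈ pieceFree p ∨ (j, pieceExponent p j) ∈ K ∨
        ∃ i, ∀ l, leadExponent i l ≤ pieceExponent p l + if l = j then 1 else 0) :
      ∃ p, ∀ j, pieceExponent p j ≤ e j ∧ (j ∉ pieceFree p → e j = pieceExponent p j) := by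
    have hle (j : Fin 10) : pieceExponent p j ≤ e j := by
      rcases hpL j with h | h
      · omega
      · exact hL _ h
    refine ⟨p, fun j => ⟨hle j, fun hj => le_antisymm ?_ (hle j)⟩⟩
    rcases hpK j with h | h | ⟨i, hi⟩
    · exact absurd h hj
    · exact hK _ h
    · by_contra hlt
      refine he i fun l => (hi l).trans ?_
      have := hle l
      split_ifs with hl
      · subst hl; omega
      · omega

  by_cases h10 : e 0 ≤ 0
  · by_cases h23 : e 3 ≤ 0
    · by_cases h35 : e 5 ≤ 0
      · by_cases h42 : e 2 ≤ 0
        · exact leaf 0 [(0, 0), (3, 0), (5, 0), (2, 0)] [] (by simp; try omega)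
            (by simp; try omega) (by decide) (by decide)
        · by_cases h52 : e 2 ≤ 1
          · exact leaf 1 [(0, 0), (3, 0), (5, 0), (2, 1)] [(2, 1)] (by simp; try omega)
              (by simp; try omega) (by decide) (by decide)
          · exact leaf 2 [(0, 0), (3, 0), (5, 0)] [(2, 2)] (by simp; try omega)
              (by simp; try omega) (by decide) (by decide)
      · by_cases h45 : e 5 ≤ 1
        · by_cases h52 : e 2 ≤ 0
          · exact leaf 3 [(0, 0), (3, 0), (5, 1), (2, 0)] [(5, 1)] (by simp; try omega)
              (by simp; try omega) (by decide) (by decide)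
          · exact leaf 4 [(0, 0), (3, 0), (5, 1)] [(2, 1), (5, 1)] (by simp; try omega)
              (by simp; try omega) (by decide) (by decide)
        · by_cases h56 : e 6 ≤ 0
          · exact leaf 5 [(0, 0), (3, 0), (6, 0)] [(5, 2)] (by simp; try omega)
              (by simp; try omega) (by decide) (by decide)
          · exact leaf 6 [(0, 0), (3, 0)] [(5, 2), (6, 1)] (by simp; try omega)
              (by simp; try omega) (by decide) (by decide)
    · by_cases h32 : e 2 ≤ 0
      · by_cases h43 : e 3 ≤ 1
        · by_cases h55 : e 5 ≤ 0
          · exact leaf 7 [(0, 0), (2, 0), (3, 1), (5, 0)] [(3, 1)] (by simp; try omega)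
              (by simp; try omega) (by decide) (by decide)
          · by_cases h65 : e 5 ≤ 1
            · exact leaf 8 [(0, 0), (2, 0), (3, 1), (5, 1)] [(3, 1), (5, 1)] (by simp; try omega)
                (by simp; try omega) (by decide) (by decide)
            · exact leaf 9 [(0, 0), (2, 0), (3, 1)] [(3, 1), (5, 2)] (by simp; try omega)
                (by simp; try omega) (by decide) (by decide)
        · by_cases h55 : e 5 ≤ 0
          · by_cases h69 : e 9 ≤ 0
            · exact leaf 10 [(0, 0), (2, 0), (5, 0), (9, 0)] [(3, 2)] (by simp; try omega)
                (by simp; try omega) (by decide) (by decide)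
            · exact leaf 11 [(0, 0), (2, 0), (5, 0)] [(3, 2), (9, 1)] (by simp; try omega)
                (by simp; try omega) (by decide) (by decide)
          · by_cases h65 : e 5 ≤ 1
            · exact leaf 12 [(0, 0), (2, 0), (5, 1)] [(3, 2), (5, 1)] (by simp; try omega)
                (by simp; try omega) (by decide) (by decide)
            · exact leaf 13 [(0, 0), (2, 0)] [(3, 2), (5, 2)] (by simp; try omega)
                (by simp; try omega) (by decide) (by decide)
      · exact leaf 14 [(0, 0)] [(2, 1), (3, 1)] (by simp; try omega)
          (by simp; try omega) (by decide) (by decide)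
  · by_cases h26 : e 6 ≤ 0
    · by_cases h31 : e 1 ≤ 0
      · by_cases h43 : e 3 ≤ 0
        · by_cases h50 : e 0 ≤ 1
          · exact leaf 15 [(6, 0), (1, 0), (3, 0), (0, 1)] [(0, 1)] (by simp; try omega)
              (by simp; try omega) (by decide) (by decide)
          · exact leaf 16 [(6, 0), (1, 0), (3, 0)] [(0, 2)] (by simp; try omega)
              (by simp; try omega) (by decide) (by decide)
        · exact leaf 17 [(6, 0), (1, 0)] [(0, 1), (3, 1)] (by simp; try omega)
            (by simp; try omega) (by decide) (by decide)
      · by_cases h42 : e 2 ≤ 0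
        · exact leaf 18 [(6, 0), (2, 0)] [(0, 1), (1, 1)] (by simp; try omega)
            (by simp; try omega) (by decide) (by decide)
        · exact leaf 19 [(6, 0)] [(0, 1), (1, 1), (2, 1)] (by simp; try omega)
            (by simp; try omega) (by decide) (by decide)
    · by_cases h39 : e 9 ≤ 0
      · exact leaf 20 [(9, 0)] [(0, 1), (6, 1)] (by simp; try omega)
          (by simp; try omega) (by decide) (by decide)
      · exact leaf 21 [] [(0, 1), (6, 1), (9, 1)] (by simp; try omega)
          (by simp; try omega) (by decide) (by decide)

theorem card_piAntidiag_eq_choose {ι : Type} [DecidableEq ι] (s : Finset ι) (n : ℕ) :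
    (Finset.piAntidiag s n).card = (s.card + n - 1).choose n := by
  rw [← Finset.card_finsuppAntidiag_nat_eq_choose]
  simp [Finset.finsuppAntidiag]

/-- The exponents of degree `k` in a piece of the partition of the standard monomials. -/
def pieceFinset (k : ℕ) (p : Fin 22) : Finset (Fin 10 → ℕ) :=
  if ∑ j, pieceExponent p j ≤ k then
    (Finset.piAntidiag (pieceFree p) (k - ∑ j, pieceExponent p j)).image (pieceExponent p + ·)
  else ∅

/-- Stars and bars for the free coordinates in the remaining degree. Every piece has at least five
free coordinates, so the subtraction of one is not truncated. -/
theorem card_pieceFinset_le (k : ℕ) (p : Fin 22) : (pieceFinset k p).card ≤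
    (k + ((pieceFree p).card - 1) - ∑ j, pieceExponent p j).choose ((pieceFree p).card - 1) := by
  have hc : ∀ p, 5 ≤ (pieceFree p).card := by decide
  have := hc p
  rw [pieceFinset]
  split_ifs with h
  · refine Finset.card_image_le.trans ?_
    rw [card_piAntidiag_eq_choose, ← Nat.choose_symm (by omega)]
    apply le_of_eq
    congr 1 <;> omega
  · simp

theorem mem_pieceFinset (e : Fin 10 → ℕ) (p : Fin 22)
    (h : ∀ j, pieceExponent p j ≤ e j ∧ (j ∉ pieceFree p → e j = pieceExponent p j)) :
    e ∈ pieceFinset (∑ j, e j) p := by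
  have hle : ∑ j, pieceExponent p j ≤ ∑ j, e j := Finset.sum_le_sum fun j _ => (h j).1
  rw [pieceFinset, if_pos hle, Finset.mem_image]
  refine ⟨e - pieceExponent p, ?_, ?_⟩
  · rw [Finset.mem_piAntidiag]
    constructor
    · rw [← Finset.sum_tsub_distrib _ fun j _ => (h j).1]
      refine Finset.sum_subset (Finset.subset_univ _) fun j _ hj => ?_
      simp [(h j).2 hj]
    · intro j hj
      by_contra hj'
      exact hj (by simp [(h j).2 hj'])
  · funext j
    have := (h j).1
    simp only [Pi.add_apply, Pi.sub_apply]
    omega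

instance standardSpan_finite (k : ℕ) : Module.Finite ℂ (standardSpan k) := by
  refine Module.Finite.span_of_finite ℂ (Set.Finite.subset ((Finset.univ.biUnion
    (pieceFinset k)).finite_toSet.image momentMonomial) ?_)
  rintro f ⟨e, rfl, he, rfl⟩
  obtain ⟨p, hp⟩ := exists_piece e he
  exact ⟨e, by simpa using ⟨p, mem_pieceFinset e p hp⟩, rfl⟩

/-- Among the pieces with six free coordinates, 1, 4, 10, 1 start in degrees 0, 1, 2, 3; among those
with five, five start in degree 3 and one in degree 4. This is (1+4t+10t²+t³)/(1−t)⁶ +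
(5t³+t⁴)/(1−t)⁵, a form of the Hilbert series without negative terms, so that the count stays in ℕ.
-/
theorem sum_card_piece (k : ℕ) : ∑ p, (k + ((pieceFree p).card - 1) -
      ∑ j, pieceExponent p j).choose ((pieceFree p).card - 1) =
    (k + 5).choose 5 + 4 * (k + 4).choose 5 + 10 * (k + 3).choose 5 + (k + 2).choose 5 +
      5 * (k + 1).choose 4 + k.choose 4 := by
  have h2 (p : Fin 22) : (pieceFree p).card - 1 = ![5, 5, 5, 5, 5, 5, 4, 5, 5, 4, 5, 4, 4, 4, 5,
      5, 5, 5, 5, 5, 5, 4] p := by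
    revert p; decide
  have h3 (p : Fin 22) : ∑ j, pieceExponent p j = ![0, 1, 2, 1, 2, 2, 3, 1, 2, 3, 2, 3, 3, 4, 2,
      1, 2, 2, 2, 3, 2, 3] p := by
    revert p; decide
  simp only [h2, h3]
  -- With the binomial coefficients hidden in an opaque `F`, the two sides differ only by collecting
  -- equal terms.
  generalize hF : (fun n d : ℕ => (k + n - d).choose n) = F
  have hF' (n d : ℕ) : (k + n - d).choose n = F n d := by rw [← hF]
  have e0 : (k + 5).choose 5 = F 5 0 := hF' 5 0
  have e1 : (k + 4).choose 5 = F 5 1 := hF' 5 1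
  have e2 : (k + 3).choose 5 = F 5 2 := hF' 5 2
  have e3 : (k + 2).choose 5 = F 5 3 := hF' 5 3
  have e4 : (k + 1).choose 4 = F 4 3 := hF' 4 3
  have e5 : k.choose 4 = F 4 4 := hF' 4 4
  simp only [hF', e0, e1, e2, e3, e4, e5]
  clear hF hF' e0 e1 e2 e3 e4 e5 h2 h3
  simp only [Fin.sum_univ_succ, Fin.sum_univ_zero]
  change F 5 0 + (F 5 1 + (F 5 2 + (F 5 1 + (F 5 2 + (F 5 2 + (F 4 3 + (F 5 1 + (F 5 2 + (F 4 3 +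
      (F 5 2 + (F 4 3 + (F 4 3 + (F 4 4 + (F 5 2 + (F 5 1 + (F 5 2 + (F 5 2 + (F 5 2 + (F 5 3 +
      (F 5 2 + (F 4 3 + 0))))))))))))))))))))) = _
  ring

theorem finrank_standardSpan_le (k : ℕ) : Module.finrank ℂ (standardSpan k) ≤
    (k + 5).choose 5 + 4 * (k + 4).choose 5 + 10 * (k + 3).choose 5 + (k + 2).choose 5 +
      5 * (k + 1).choose 4 + k.choose 4 := by
  classical
  rw [← sum_card_piece]
  let B : Finset (Fin 10 → ℕ) := Finset.univ.biUnion (pieceFinset k)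
  have h1 : standardSpan k ≤ Submodule.span ℂ
      ((B.image momentMonomial : Finset _) : Set (MvPolynomial (MomentIndex 2 3) ℂ)) := by
    refine Submodule.span_mono ?_
    rintro f ⟨e, rfl, he, rfl⟩
    obtain ⟨p, hp⟩ := exists_piece e he
    rw [Finset.coe_image]
    exact ⟨e, Finset.mem_biUnion.mpr ⟨p, Finset.mem_univ p, mem_pieceFinset e p hp⟩, rfl⟩
  calc Module.finrank ℂ (standardSpan k) ≤ _ := Submodule.finrank_mono h1
    _ ≤ (B.image momentMonomial).card := finrank_span_finset_le_card _
    _ ≤ B.card := Finset.card_image_le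
    _ ≤ ∑ p, (pieceFinset k p).card := Finset.card_biUnion_le
    _ ≤ _ := Finset.sum_le_sum fun p _ => card_pieceFinset_le k p

/-! ### Monomials and forms in the parameters -/

/-- A monomial in the five parameters. -/
def paramMonomial (i j a b c : ℕ) : MvPolynomial (Fin 5) ℂ :=
  X 0 ^ i * X 1 ^ j * (X 2 ^ a * X 3 ^ b * X 4 ^ c)

/-- The moments of order three, up to scalars. -/
def paramCubic : Fin 4 → MvPolynomial (Fin 5) ℂ :=
  ![X 0 * X 2, 2 * (X 0 * X 3) + X 1 * X 2, X 0 * X 4 + 2 * (X 1 * X 3), X 1 * X 4]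

/-- The linear span of the products of `m` moments of order three. -/
def cubicForms (m : ℕ) : Submodule ℂ (MvPolynomial (Fin 5) ℂ) :=
  Submodule.span ℂ ((Finset.piAntidiag (Finset.univ : Finset (Fin 4)) m).image
    fun e => ∏ l, paramCubic l ^ e l : Finset (MvPolynomial (Fin 5) ℂ))

instance cubicForms_finite (m : ℕ) : Module.Finite ℂ (cubicForms m) :=
  Module.Finite.span_of_finite ℂ (Finset.finite_toSet _)

theorem finrank_cubicForms_le (m : ℕ) : Module.finrank ℂ (cubicForms m) ≤ (m + 3).choose 3 := by
  refine (finrank_span_finset_le_card _).trans (Finset.card_image_le.trans (le_of_eq ?_))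
  rw [card_piAntidiag_eq_choose, ← Nat.choose_symm (by simp)]
  simp only [Finset.card_univ, Fintype.card_fin]
  congr 1 <;> omega

theorem one_mem_cubicForms : 1 ∈ cubicForms 0 :=
  Submodule.subset_span (by simp)

theorem cubicForms_mul {m n : ℕ} {f g : MvPolynomial (Fin 5) ℂ} (hf : f ∈ cubicForms m)
    (hg : g ∈ cubicForms n) : f * g ∈ cubicForms (m + n) := by
  induction hf using Submodule.span_induction with
  | zero => simp
  | add x y _ _ hx hy => rw [add_mul]; exact add_mem hx hy
  | smul c x _ hx => rw [smul_mul_assoc]; exact Submodule.smul_mem _ c hx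
  | mem x hx =>
    induction hg using Submodule.span_induction with
    | zero => simp
    | add y z _ _ hy hz => rw [mul_add]; exact add_mem hy hz
    | smul c y _ hy => rw [mul_smul_comm]; exact Submodule.smul_mem _ c hy
    | mem y hy =>
      simp only [Finset.coe_image, Set.mem_image, Finset.mem_coe, Finset.mem_piAntidiag] at hx hy
      obtain ⟨d, hd, rfl⟩ := hx
      obtain ⟨e, he, rfl⟩ := hy
      refine Submodule.subset_span ?_
      simp only [Finset.coe_image, Set.mem_image, Finset.mem_coe, Finset.mem_piAntidiag]
      refine ⟨d + e, ⟨?_, by simp⟩, ?_⟩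
      · simp only [Pi.add_apply, Finset.sum_add_distrib, hd.1, he.1]
      · simp [pow_add, Finset.prod_mul_distrib]

theorem paramCubic_mem_cubicForms (l : Fin 4) : paramCubic l ∈ cubicForms 1 := by
  refine Submodule.subset_span ?_
  simp only [Finset.coe_image, Set.mem_image, Finset.mem_coe, Finset.mem_piAntidiag]
  refine ⟨Pi.single l 1, ⟨by simp, by simp⟩, ?_⟩
  rw [Finset.prod_eq_single l (by intro b _ hb; simp [Pi.single_eq_of_ne hb]) (by simp)]
  simp

theorem list_sum_mem_momentForms (k : ℕ) (L : List (ℤ × (Fin 10 → ℕ)))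
    (hL : ∀ p ∈ L, ∑ j, p.2 j = k) :
    (L.map fun p => p.1 • momentHom (momentMonomial p.2)).sum ∈ momentForms k := by
  refine list_sum_mem fun g hg => ?_
  obtain ⟨p, hp, rfl⟩ := List.mem_map.mp hg
  refine zsmul_mem ?_ _
  have := momentMonomial_isHomogeneous p.2
  rw [hL p hp] at this
  exact ⟨_, this, rfl⟩

theorem mem_of_intCast_smul_mem {W : Submodule ℂ (MvPolynomial (Fin 5) ℂ)}
    {f : MvPolynomial (Fin 5) ℂ} (n : ℤ) (hn : n ≠ 0) (h : n • f ∈ W) : f ∈ W := by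
  have h2 : f = ((n : ℂ)⁻¹) • (n • f) := by
    rw [← Int.cast_smul_eq_zsmul ℂ n f, smul_smul, inv_mul_cancel₀ (by exact_mod_cast hn),
      one_smul]
  rw [h2]
  exact Submodule.smul_mem _ _ h

theorem mem_of_natCast_mul_mem {W : Submodule ℂ (MvPolynomial (Fin 5) ℂ)}
    {f : MvPolynomial (Fin 5) ℂ} (n : ℕ) [NeZero n] (h : (n : MvPolynomial (Fin 5) ℂ) * f ∈ W) :
    f ∈ W := by
  have h2 : f = ((n : ℂ)⁻¹) • ((n : MvPolynomial (Fin 5) ℂ) * f) := by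
    rw [← nsmul_eq_mul, ← Nat.cast_smul_eq_nsmul ℂ, smul_smul,
      inv_mul_cancel₀ (by exact_mod_cast NeZero.ne n), one_smul]
  rw [h2]
  exact Submodule.smul_mem _ _ h

theorem paramCubic_mem_momentForms (l : Fin 4) : paramCubic l ∈ momentForms 1 := by
  fin_cases l
  · exact mem_of_natCast_mul_mem 9 (by simpa [momentPoly, paramCubic, mul_assoc] using momentPoly_mem 6)
  · refine mem_of_natCast_mul_mem 3 ?_
    convert momentPoly_mem 7 using 1
    simp [momentPoly, paramCubic]; ring
  · refine mem_of_natCast_mul_mem 3 ?_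
    convert momentPoly_mem 8 using 1
    simp [momentPoly, paramCubic]; ring
  · exact mem_of_natCast_mul_mem 9 (by simpa [momentPoly, paramCubic, mul_assoc] using momentPoly_mem 9)

theorem momentForms_zero_one : 1 ∈ momentForms 0 :=
  ⟨1, isHomogeneous_one _ _, map_one momentHom⟩

theorem cubicForms_le_momentForms (m : ℕ) : cubicForms m ≤ momentForms m := by
  refine Submodule.span_le.mpr ?_
  simp only [Finset.coe_image]
  rintro f ⟨e, he, rfl⟩
  rw [Finset.mem_coe, Finset.mem_piAntidiag] at he
  have hpow (l : Fin 4) (n : ℕ) : paramCubic l ^ n ∈ momentForms n := by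
    induction n with
    | zero => simpa using momentForms_zero_one
    | succ n ih => rw [pow_succ]; exact momentForms_mul ih (paramCubic_mem_momentForms l)
  have := momentForms_mul (momentForms_mul (hpow 0 (e 0)) (hpow 1 (e 1)))
    (momentForms_mul (hpow 2 (e 2)) (hpow 3 (e 3)))
  simp only [Fin.sum_univ_four] at he
  simp only [Fin.prod_univ_four, SetLike.mem_coe]
  rw [← he.1]
  convert this using 1
  · congr 1; omega
  · ring

/-! ### The lower part of the monomials -/

/-- The resultant of the linear and the quadratic parameters. -/
def paramRes : MvPolynomial (Fin 5) ℂ := X 1 ^ 2 * X 2 - 2 * (X 0 * X 1 * X 3) + X 0 ^ 2 * X 4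

/-- The forms of degree `n + 2`, enlarged by multiples of the resultant. -/
def lowForms (n : ℕ) : Submodule ℂ (MvPolynomial (Fin 5) ℂ) :=
  momentForms (n + 2) ⊔ (cubicForms n).map (LinearMap.mulLeft ℂ paramRes)

/-- Format for explicit certificates: an integer multiple of `f` is an integer combination of images
of monomials plus a multiple of the resultant. The degrees are checked by `decide` and the identity
by `ring`. -/
theorem mem_lowForms_of_list (n : ℕ) (N : ℤ) (hN : N ≠ 0) (L : List (ℤ × (Fin 10 → ℕ)))
    (hL : ∀ p ∈ L, ∑ j, p.2 j = n + 2) (M : ℤ) {f : MvPolynomial (Fin 5) ℂ}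
    (g : MvPolynomial (Fin 5) ℂ) (hg : g ∈ cubicForms n)
    (h : N • f = (L.map fun p => p.1 • momentHom (momentMonomial p.2)).sum +
      M • (paramRes * g)) :
    f ∈ lowForms n := by
  refine mem_of_intCast_smul_mem N hN ?_
  rw [h]
  exact Submodule.add_mem_sup (list_sum_mem_momentForms _ L hL)
    ⟨M • g, zsmul_mem hg M, by simp [mul_left_comm]⟩

theorem cubicForms_mul_lowForms {m n : ℕ} {f g : MvPolynomial (Fin 5) ℂ} (hf : f ∈ cubicForms m)
    (hg : g ∈ lowForms n) : f * g ∈ lowForms (n + m) := by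
  obtain ⟨a, ha, b, ⟨b', hb, rfl⟩, rfl⟩ := Submodule.mem_sup.mp hg
  rw [mul_add]
  refine Submodule.add_mem_sup ?_ ⟨f * b', ?_, ?_⟩
  · have := momentForms_mul (cubicForms_le_momentForms m hf) ha
    rwa [show m + (n + 2) = n + m + 2 by omega] at this
  · have := cubicForms_mul hf hb
    rwa [add_comm] at this
  · simp only [LinearMap.mulLeft_apply]; ring

/-- The resultant R is linear in q and vanishes for q = ℓ², so the analogous expression in the
second-order moments q + 6ℓ² gives 9R as a form of degree three. The other coordinates of order at
most two also carry R into the forms of degree three, by explicit identities; for the third-order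
moments the product is one of the added multiples of R. -/
theorem momentPoly_mul_paramRes_mem (j : Fin 10) : momentPoly j * paramRes ∈ lowForms 1 := by
  have hP (l : Fin 4) (c : ℕ) : (c : MvPolynomial (Fin 5) ℂ) * (paramCubic l * paramRes) ∈
      lowForms 1 := by
    rw [← nsmul_eq_mul]
    refine nsmul_mem ?_ c
    exact Submodule.mem_sup_right ⟨paramCubic l, paramCubic_mem_cubicForms l,
      by simp [mul_comm]⟩
  fin_cases j
  · refine mem_lowForms_of_list 1 9 (by decide) [(1, ![0, 0, 2, 1, 0, 0, 0, 0, 0, 0]), (1, ![0, 2, 0, 0, 0, 1, 0, 0, 0, 0]), (-2, ![0, 1, 1, 0, 1, 0, 0, 0, 0, 0])]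
      (by decide) 0 0 (zero_mem _) ?_
    simp [momentMonomial_vec, momentPoly, paramRes]; ring
  · refine mem_lowForms_of_list 1 9 (by decide) [(-2, ![0, 1, 1, 0, 0, 0, 0, 1, 0, 0]), (1, ![0, 2, 0, 0, 0, 0, 0, 0, 1, 0]), (1, ![0, 0, 2, 0, 0, 0, 1, 0, 0, 0])]
      (by decide) 0 0 (zero_mem _) ?_
    simp [momentMonomial_vec, momentPoly, paramRes]; ring
  · refine mem_lowForms_of_list 1 9 (by decide) [(1, ![0, 2, 0, 0, 0, 0, 0, 0, 0, 1]), (-2, ![0, 1, 1, 0, 0, 0, 0, 0, 1, 0]), (1, ![0, 0, 2, 0, 0, 0, 0, 1, 0, 0])]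
      (by decide) 0 0 (zero_mem _) ?_
    simp [momentMonomial_vec, momentPoly, paramRes]; ring
  · refine mem_lowForms_of_list 1 9 (by decide) [(1, ![0, 1, 0, 1, 0, 0, 0, 0, 1, 0]), (1, ![0, 1, 0, 0, 0, 1, 1, 0, 0, 0]), (-2, ![0, 1, 0, 0, 1, 0, 0, 1, 0, 0]), (-1, ![1, 0, 0, 0, 0, 0, 1, 0, 1, 0]), (1, ![1, 0, 0, 0, 0, 0, 0, 2, 0, 0])]
      (by decide) 0 0 (zero_mem _) ?_
    simp [momentMonomial_vec, momentPoly, paramRes]; ring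
  · refine mem_lowForms_of_list 1 18 (by decide) [(-1, ![1, 0, 0, 0, 0, 0, 1, 0, 0, 1]), (1, ![1, 0, 0, 0, 0, 0, 0, 1, 1, 0]), (2, ![0, 0, 1, 1, 0, 0, 0, 0, 1, 0]), (2, ![0, 0, 1, 0, 0, 1, 1, 0, 0, 0]), (-4, ![0, 0, 1, 0, 1, 0, 0, 1, 0, 0])]
      (by decide) 0 0 (zero_mem _) ?_
    simp [momentMonomial_vec, momentPoly, paramRes]; ring
  · refine mem_lowForms_of_list 1 9 (by decide) [(-2, ![0, 0, 1, 0, 1, 0, 0, 0, 1, 0]), (1, ![1, 0, 0, 0, 0, 0, 0, 0, 2, 0]), (1, ![0, 0, 1, 1, 0, 0, 0, 0, 0, 1]), (-1, ![1, 0, 0, 0, 0, 0, 0, 1, 0, 1]), (1, ![0, 0, 1, 0, 0, 1, 0, 1, 0, 0])]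
      (by decide) 0 0 (zero_mem _) ?_
    simp [momentMonomial_vec, momentPoly, paramRes]; ring
  · convert hP 0 9 using 1
    simp [momentPoly, paramCubic, mul_assoc]
  · convert hP 1 3 using 1
    simp [momentPoly, paramCubic, mul_assoc]; ring
  · convert hP 2 3 using 1
    simp [momentPoly, paramCubic, mul_assoc]; ring
  · convert hP 3 9 using 1
    simp [momentPoly, paramCubic, mul_assoc]

/-- Adding only R·`cubicForms n`, and not R times all forms of degree n, already gives a family
stable under multiplication by the coordinates. This is what keeps the enlargement small. -/
theorem momentPoly_mul_lowForms (j : Fin 10) {n : ℕ} {f : MvPolynomial (Fin 5) ℂ}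
    (hf : f ∈ lowForms n) : momentPoly j * f ∈ lowForms (n + 1) := by
  obtain ⟨a, ha, b, ⟨b', hb, rfl⟩, rfl⟩ := Submodule.mem_sup.mp hf
  rw [mul_add]
  refine add_mem (Submodule.mem_sup_left ?_) ?_
  · have := momentForms_mul (momentPoly_mem j) ha
    rwa [show 1 + (n + 2) = n + 1 + 2 by omega] at this
  · have := cubicForms_mul_lowForms hb (momentPoly_mul_paramRes_mem j)
    rw [add_comm n 1]
    convert this using 1
    simp only [LinearMap.mulLeft_apply]; ring

theorem natCast_mul_mem {W : Submodule ℂ (MvPolynomial (Fin 5) ℂ)} {f : MvPolynomial (Fin 5) ℂ}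
    (n : ℕ) (h : f ∈ W) : (n : MvPolynomial (Fin 5) ℂ) * f ∈ W := by
  rw [← nsmul_eq_mul]; exact nsmul_mem h n

theorem mem_lowForms_succ {n : ℕ} {f : MvPolynomial (Fin 5) ℂ} (hf : f ∈ lowForms n) :
    f ∈ lowForms (n + 1) := by
  simpa [momentPoly] using momentPoly_mul_lowForms 0 hf

theorem X0_mul_lowForms {n : ℕ} {f : MvPolynomial (Fin 5) ℂ} (hf : f ∈ lowForms n) :
    X 0 * f ∈ lowForms (n + 1) :=
  mem_of_natCast_mul_mem 3 (by
    simpa [momentPoly, mul_assoc] using momentPoly_mul_lowForms 1 hf)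

theorem X1_mul_lowForms {n : ℕ} {f : MvPolynomial (Fin 5) ℂ} (hf : f ∈ lowForms n) :
    X 1 * f ∈ lowForms (n + 1) :=
  mem_of_natCast_mul_mem 3 (by
    simpa [momentPoly, mul_assoc] using momentPoly_mul_lowForms 2 hf)

theorem paramCubic_mul_lowForms (l : Fin 4) {n : ℕ} {f : MvPolynomial (Fin 5) ℂ}
    (hf : f ∈ lowForms n) : paramCubic l * f ∈ lowForms (n + 1) :=
  cubicForms_mul_lowForms (paramCubic_mem_cubicForms l) hf

/-- Multiples of the moments of order three contain all multiples of products of a linear and a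
quadratic parameter by forms of degree at least two in the linear parameters. -/
theorem mem_of_paramCubic_mul_mem {W : Submodule ℂ (MvPolynomial (Fin 5) ℂ)} {m : ℕ} (hm : 2 ≤ m)
    (f : MvPolynomial (Fin 5) ℂ)
    (h : ∀ i j l, i + j = m → paramCubic l * (X 0 ^ i * X 1 ^ j * f) ∈ W) (i j : ℕ)
    (hij : i + j = m + 1) : X 0 ^ i * X 1 ^ j * (X 2 * f) ∈ W ∧
      X 0 ^ i * X 1 ^ j * (X 3 * f) ∈ W ∧ X 0 ^ i * X 1 ^ j * (X 4 * f) ∈ W := by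
  -- The moments xa and yc give the multiples of these directly. Subtracting them from multiples of
  -- 2xb + ya and xc + 2yb isolates b, and then the extreme terms y^(m+1)·a and x^(m+1)·c.
  have hr (i j : ℕ) (hij : i + j = m) : X 0 ^ (i + 1) * X 1 ^ j * (X 2 * f) ∈ W := by
    convert h i j 0 hij using 1; simp [paramCubic]; ring
  have ht (i j : ℕ) (hij : i + j = m) : X 0 ^ i * X 1 ^ (j + 1) * (X 4 * f) ∈ W := by
    convert h i j 3 hij using 1; simp [paramCubic]; ring
  have hs1 (i j : ℕ) (hij : i + j + 1 = m) : X 0 ^ (i + 2) * X 1 ^ j * (X 3 * f) ∈ W := by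
    refine mem_of_natCast_mul_mem 2 ?_
    convert sub_mem (h (i + 1) j 1 (by omega)) (hr i (j + 1) (by omega)) using 1
    simp [paramCubic]; ring
  have hs2 (i j : ℕ) (hij : i + j + 1 = m) : X 0 ^ i * X 1 ^ (j + 2) * (X 3 * f) ∈ W := by
    refine mem_of_natCast_mul_mem 2 ?_
    convert sub_mem (h i (j + 1) 2 (by omega)) (ht (i + 1) j (by omega)) using 1
    simp [paramCubic]; ring
  -- Here m ≥ 2 enters: i + j ≥ 3 forces one of the exponents to be at least two.
  have hs (i j : ℕ) (hij : i + j = m + 1) : X 0 ^ i * X 1 ^ j * (X 3 * f) ∈ W := by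
    rcases le_or_gt 2 i with hi | hi
    · obtain ⟨i, rfl⟩ := Nat.exists_eq_add_of_le' hi
      exact hs1 i j (by omega)
    · obtain ⟨j, rfl⟩ := Nat.exists_eq_add_of_le' (show 2 ≤ j by omega)
      exact hs2 i j (by omega)
  refine ⟨?_, hs i j hij, ?_⟩
  · rcases Nat.eq_zero_or_pos i with rfl | hi
    · obtain ⟨j, rfl⟩ := Nat.exists_eq_add_of_le' (show 1 ≤ j by omega)
      convert sub_mem (h 0 j 1 (by omega)) (natCast_mul_mem 2 (hs 1 j (by omega))) using 1
      simp [paramCubic]; ring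
    · obtain ⟨i, rfl⟩ := Nat.exists_eq_add_of_le' hi
      exact hr i j (by omega)
  · rcases Nat.eq_zero_or_pos j with rfl | hj
    · obtain ⟨i, rfl⟩ := Nat.exists_eq_add_of_le' (show 1 ≤ i by omega)
      convert sub_mem (h i 0 2 (by omega)) (natCast_mul_mem 2 (hs i 1 (by omega))) using 1
      simp [paramCubic]; ring
    · obtain ⟨j, rfl⟩ := Nat.exists_eq_add_of_le' hj
      exact ht i j (by omega)

/-- Only y²a, xyb and x²c need the resultant. The remaining monomials are images of quadratic forms
in the coordinates. -/
theorem paramMonomial_mem_lowForms_zero (i j a b c : ℕ) (h : a + b + c ≤ 1)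
    (h' : i + j + (a + b + c) ≤ 3) : paramMonomial i j a b c ∈ lowForms 0 := by
  obtain ⟨rfl, rfl, rfl⟩ | ⟨rfl, rfl, rfl⟩ | ⟨rfl, rfl, rfl⟩ | ⟨rfl, rfl, rfl⟩ :
      (a = 0 ∧ b = 0 ∧ c = 0) ∨ (a = 1 ∧ b = 0 ∧ c = 0) ∨ (a = 0 ∧ b = 1 ∧ c = 0) ∨
        (a = 0 ∧ b = 0 ∧ c = 1) := by omega
  · obtain rfl | rfl | rfl | rfl : i = 0 ∨ i = 1 ∨ i = 2 ∨ i = 3 := by omega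
    · obtain rfl | rfl | rfl | rfl : j = 0 ∨ j = 1 ∨ j = 2 ∨ j = 3 := by omega
      · refine mem_lowForms_of_list 0 1 (by decide) [(1, ![2, 0, 0, 0, 0, 0, 0, 0, 0, 0])]
          (by decide) 0 1 one_mem_cubicForms ?_
        simp [momentMonomial_vec, momentPoly, paramMonomial, paramRes]
      · refine mem_lowForms_of_list 0 3 (by decide) [(1, ![1, 0, 1, 0, 0, 0, 0, 0, 0, 0])]
          (by decide) 0 1 one_mem_cubicForms ?_
        simp [momentMonomial_vec, momentPoly, paramMonomial, paramRes]
      · refine mem_lowForms_of_list 0 9 (by decide) [(1, ![0, 0, 2, 0, 0, 0, 0, 0, 0, 0])]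
          (by decide) 0 1 one_mem_cubicForms ?_
        simp [momentMonomial_vec, momentPoly, paramMonomial, paramRes]; ring
      · refine mem_lowForms_of_list 0 54 (by decide) [(3, ![0, 0, 1, 0, 0, 1, 0, 0, 0, 0]), (-1, ![1, 0, 0, 0, 0, 0, 0, 0, 0, 1])]
          (by decide) 0 1 one_mem_cubicForms ?_
        simp [momentMonomial_vec, momentPoly, paramMonomial, paramRes]; ring
    · obtain rfl | rfl | rfl : j = 0 ∨ j = 1 ∨ j = 2 := by omega
      · refine mem_lowForms_of_list 0 3 (by decide) [(1, ![1, 1, 0, 0, 0, 0, 0, 0, 0, 0])]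
          (by decide) 0 1 one_mem_cubicForms ?_
        simp [momentMonomial_vec, momentPoly, paramMonomial, paramRes]
      · refine mem_lowForms_of_list 0 9 (by decide) [(1, ![0, 1, 1, 0, 0, 0, 0, 0, 0, 0])]
          (by decide) 0 1 one_mem_cubicForms ?_
        simp [momentMonomial_vec, momentPoly, paramMonomial, paramRes]; ring
      · refine mem_lowForms_of_list 0 54 (by decide) [(-1, ![1, 0, 0, 0, 0, 0, 0, 0, 1, 0]), (2, ![0, 0, 1, 0, 1, 0, 0, 0, 0, 0]), (1, ![0, 1, 0, 0, 0, 1, 0, 0, 0, 0])]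
          (by decide) 0 1 one_mem_cubicForms ?_
        simp [momentMonomial_vec, momentPoly, paramMonomial, paramRes]; ring
    · obtain rfl | rfl : j = 0 ∨ j = 1 := by omega
      · refine mem_lowForms_of_list 0 9 (by decide) [(1, ![0, 2, 0, 0, 0, 0, 0, 0, 0, 0])]
          (by decide) 0 1 one_mem_cubicForms ?_
        simp [momentMonomial_vec, momentPoly, paramMonomial, paramRes]; ring
      · refine mem_lowForms_of_list 0 54 (by decide) [(2, ![0, 1, 0, 0, 1, 0, 0, 0, 0, 0]), (1, ![0, 0, 1, 1, 0, 0, 0, 0, 0, 0]), (-1, ![1, 0, 0, 0, 0, 0, 0, 1, 0, 0])]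
          (by decide) 0 1 one_mem_cubicForms ?_
        simp [momentMonomial_vec, momentPoly, paramMonomial, paramRes]; ring
    · obtain rfl : j = 0 := by omega
      · refine mem_lowForms_of_list 0 54 (by decide) [(-1, ![1, 0, 0, 0, 0, 0, 1, 0, 0, 0]), (3, ![0, 1, 0, 1, 0, 0, 0, 0, 0, 0])]
          (by decide) 0 1 one_mem_cubicForms ?_
        simp [momentMonomial_vec, momentPoly, paramMonomial, paramRes]; ring
  · obtain rfl | rfl | rfl : i = 0 ∨ i = 1 ∨ i = 2 := by omega
    · obtain rfl | rfl | rfl : j = 0 ∨ j = 1 ∨ j = 2 := by omega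
      · refine mem_lowForms_of_list 0 3 (by decide) [(-2, ![0, 2, 0, 0, 0, 0, 0, 0, 0, 0]), (3, ![1, 0, 0, 1, 0, 0, 0, 0, 0, 0])]
          (by decide) 0 1 one_mem_cubicForms ?_
        simp [momentMonomial_vec, momentPoly, paramMonomial, paramRes]; ring
      · refine mem_lowForms_of_list 0 9 (by decide) [(-2, ![0, 1, 0, 0, 1, 0, 0, 0, 0, 0]), (1, ![1, 0, 0, 0, 0, 0, 0, 1, 0, 0]), (2, ![0, 0, 1, 1, 0, 0, 0, 0, 0, 0])]
          (by decide) 0 1 one_mem_cubicForms ?_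
        simp [momentMonomial_vec, momentPoly, paramMonomial, paramRes]; ring
      · refine mem_lowForms_of_list 0 27 (by decide) [(-1, ![0, 1, 0, 0, 0, 0, 0, 0, 1, 0]), (2, ![0, 0, 1, 0, 0, 0, 0, 1, 0, 0])]
          (by decide) 9 1 one_mem_cubicForms ?_
        simp [momentMonomial_vec, momentPoly, paramMonomial, paramRes]; ring
    · obtain rfl | rfl : j = 0 ∨ j = 1 := by omega
      · refine mem_lowForms_of_list 0 9 (by decide) [(1, ![1, 0, 0, 0, 0, 0, 1, 0, 0, 0])]
          (by decide) 0 1 one_mem_cubicForms ?_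
        simp [momentMonomial_vec, momentPoly, paramMonomial, paramRes]
      · refine mem_lowForms_of_list 0 27 (by decide) [(1, ![0, 0, 1, 0, 0, 0, 1, 0, 0, 0])]
          (by decide) 0 1 one_mem_cubicForms ?_
        simp [momentMonomial_vec, momentPoly, paramMonomial, paramRes]; ring
    · obtain rfl : j = 0 := by omega
      · refine mem_lowForms_of_list 0 27 (by decide) [(1, ![0, 1, 0, 0, 0, 0, 1, 0, 0, 0])]
          (by decide) 0 1 one_mem_cubicForms ?_
        simp [momentMonomial_vec, momentPoly, paramMonomial, paramRes]; ring
  · obtain rfl | rfl | rfl : i = 0 ∨ i = 1 ∨ i = 2 := by omega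
    · obtain rfl | rfl | rfl : j = 0 ∨ j = 1 ∨ j = 2 := by omega
      · refine mem_lowForms_of_list 0 3 (by decide) [(-2, ![0, 1, 1, 0, 0, 0, 0, 0, 0, 0]), (3, ![1, 0, 0, 0, 1, 0, 0, 0, 0, 0])]
          (by decide) 0 1 one_mem_cubicForms ?_
        simp [momentMonomial_vec, momentPoly, paramMonomial, paramRes]; ring
      · refine mem_lowForms_of_list 0 9 (by decide) [(-1, ![0, 1, 0, 0, 0, 1, 0, 0, 0, 0]), (1, ![0, 0, 1, 0, 1, 0, 0, 0, 0, 0]), (1, ![1, 0, 0, 0, 0, 0, 0, 0, 1, 0])]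
          (by decide) 0 1 one_mem_cubicForms ?_
        simp [momentMonomial_vec, momentPoly, paramMonomial, paramRes]; ring
      · refine mem_lowForms_of_list 0 54 (by decide) [(-1, ![0, 1, 0, 0, 0, 0, 0, 0, 0, 1]), (3, ![0, 0, 1, 0, 0, 0, 0, 0, 1, 0])]
          (by decide) 0 1 one_mem_cubicForms ?_
        simp [momentMonomial_vec, momentPoly, paramMonomial, paramRes]; ring
    · obtain rfl | rfl : j = 0 ∨ j = 1 := by omega
      · refine mem_lowForms_of_list 0 9 (by decide) [(1, ![0, 1, 0, 0, 1, 0, 0, 0, 0, 0]), (-1, ![0, 0, 1, 1, 0, 0, 0, 0, 0, 0]), (1, ![1, 0, 0, 0, 0, 0, 0, 1, 0, 0])]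
          (by decide) 0 1 one_mem_cubicForms ?_
        simp [momentMonomial_vec, momentPoly, paramMonomial, paramRes]; ring
      · refine mem_lowForms_of_list 0 54 (by decide) [(1, ![0, 1, 0, 0, 0, 0, 0, 0, 1, 0]), (1, ![0, 0, 1, 0, 0, 0, 0, 1, 0, 0])]
          (by decide) (-9) 1 one_mem_cubicForms ?_
        simp [momentMonomial_vec, momentPoly, paramMonomial, paramRes]; ring
    · obtain rfl : j = 0 := by omega
      · refine mem_lowForms_of_list 0 54 (by decide) [(3, ![0, 1, 0, 0, 0, 0, 0, 1, 0, 0]), (-1, ![0, 0, 1, 0, 0, 0, 1, 0, 0, 0])]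
          (by decide) 0 1 one_mem_cubicForms ?_
        simp [momentMonomial_vec, momentPoly, paramMonomial, paramRes]; ring
  · obtain rfl | rfl | rfl : i = 0 ∨ i = 1 ∨ i = 2 := by omega
    · obtain rfl | rfl | rfl : j = 0 ∨ j = 1 ∨ j = 2 := by omega
      · refine mem_lowForms_of_list 0 3 (by decide) [(-2, ![0, 0, 2, 0, 0, 0, 0, 0, 0, 0]), (3, ![1, 0, 0, 0, 0, 1, 0, 0, 0, 0])]
          (by decide) 0 1 one_mem_cubicForms ?_
        simp [momentMonomial_vec, momentPoly, paramMonomial, paramRes]; ring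
      · refine mem_lowForms_of_list 0 9 (by decide) [(1, ![1, 0, 0, 0, 0, 0, 0, 0, 0, 1])]
          (by decide) 0 1 one_mem_cubicForms ?_
        simp [momentMonomial_vec, momentPoly, paramMonomial, paramRes]
      · refine mem_lowForms_of_list 0 27 (by decide) [(1, ![0, 0, 1, 0, 0, 0, 0, 0, 0, 1])]
          (by decide) 0 1 one_mem_cubicForms ?_
        simp [momentMonomial_vec, momentPoly, paramMonomial, paramRes]; ring
    · obtain rfl | rfl : j = 0 ∨ j = 1 := by omega
      · refine mem_lowForms_of_list 0 9 (by decide) [(1, ![1, 0, 0, 0, 0, 0, 0, 0, 1, 0]), (2, ![0, 1, 0, 0, 0, 1, 0, 0, 0, 0]), (-2, ![0, 0, 1, 0, 1, 0, 0, 0, 0, 0])]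
          (by decide) 0 1 one_mem_cubicForms ?_
        simp [momentMonomial_vec, momentPoly, paramMonomial, paramRes]; ring
      · refine mem_lowForms_of_list 0 27 (by decide) [(1, ![0, 1, 0, 0, 0, 0, 0, 0, 0, 1])]
          (by decide) 0 1 one_mem_cubicForms ?_
        simp [momentMonomial_vec, momentPoly, paramMonomial, paramRes]; ring
    · obtain rfl : j = 0 := by omega
      · refine mem_lowForms_of_list 0 27 (by decide) [(2, ![0, 1, 0, 0, 0, 0, 0, 0, 1, 0]), (-1, ![0, 0, 1, 0, 0, 0, 0, 1, 0, 0])]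
          (by decide) 9 1 one_mem_cubicForms ?_
        simp [momentMonomial_vec, momentPoly, paramMonomial, paramRes]; ring

theorem mul_paramMonomial_mem_of_paramCubic_mul_mem {W : Submodule ℂ (MvPolynomial (Fin 5) ℂ)}
    {m N : ℕ} (hm : 2 ≤ m) (g : MvPolynomial (Fin 5) ℂ)
    (h : ∀ l i j a b c, i + j = m → a + b + c = N →
      paramCubic l * (g * paramMonomial i j a b c) ∈ W)
    {i j a b c : ℕ} (hij : i + j = m + 1) (habc : a + b + c = N + 1) :
    g * paramMonomial i j a b c ∈ W := by
  have key (a b c : ℕ) (habc : a + b + c = N) :=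
    mem_of_paramCubic_mul_mem hm (g * (X 2 ^ a * X 3 ^ b * X 4 ^ c)) (W := W)
      (fun i j l hij => by
        convert h l i j a b c hij habc using 1
        simp only [paramMonomial]; ring) i j hij
  rcases a with - | a
  · rcases b with - | b
    · obtain ⟨c, rfl⟩ := Nat.exists_eq_add_of_le' (show 1 ≤ c by omega)
      convert (key 0 0 c (by omega)).2.2 using 1
      simp only [paramMonomial]; ring
    · convert (key 0 b c (by omega)).2.1 using 1
      simp only [paramMonomial]; ring
  · convert (key a b c (by omega)).1 using 1
    simp only [paramMonomial]; ring

/-- Each step in n raises the bounds on (a, b, c)-degree and total degree by one and two. Monomials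
of (x, y)-degree at least three come from third-order moments; the remaining ones from the
second-order moments, used to trade a, b, c for x², xy, y² or conversely. -/
theorem paramMonomial_mem_lowForms (n : ℕ) : ∀ i j a b c : ℕ, a + b + c ≤ n + 1 →
    i + j + (a + b + c) ≤ 2 * n + 3 → paramMonomial i j a b c ∈ lowForms n := by
  induction n with
  | zero => exact fun i j a b c h h' => paramMonomial_mem_lowForms_zero i j a b c (by omega) h'
  | succ n ih =>
    have h1 (i j a b c : ℕ) (hij : 3 ≤ i + j) (hb : 1 ≤ a + b + c) (hb' : a + b + c ≤ n + 2)
        (h : i + j + (a + b + c) ≤ 2 * n + 5) : paramMonomial i j a b c ∈ lowForms (n + 1) := by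
      rw [← one_mul (paramMonomial i j a b c)]
      refine mul_paramMonomial_mem_of_paramCubic_mul_mem (m := i + j - 1) (N := a + b + c - 1)
        (by omega) 1 (fun l i' j' a' b' c' h1 h2 => ?_) (by omega) (by omega)
      rw [one_mul]
      exact paramCubic_mul_lowForms l (ih _ _ _ _ _ (by omega) (by omega))
    have h2 (i j a b c : ℕ) (hb : a + b + c ≤ n + 1) (h : i + j + (a + b + c) ≤ 2 * n + 3) :
        paramMonomial i j a b c ∈ lowForms (n + 1) := mem_lowForms_succ (ih i j a b c hb h)
    have h3 (i j a b c : ℕ) (hij : i + j ≤ 4) (hb : a + b + c = n + 1) :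
        paramMonomial i j a b c ∈ lowForms (n + 1) := by
      rcases le_or_gt 3 (i + j) with h | h
      · exact h1 _ _ _ _ _ h (by omega) (by omega) (by omega)
      · exact h2 _ _ _ _ _ (by omega) (by omega)
    intro i j a b c hb h
    rcases Nat.lt_or_ge 0 (a + b + c) with hb0 | hb0
    · rcases le_or_gt 3 (i + j) with hij | hij
      · exact h1 _ _ _ _ _ hij hb0 (by omega) (by omega)
      -- Now the (x, y)-degree is at most two. A factor a is m₂₀ − 6x², and the correction has (a,
      -- b, c)-degree n+1 and (x, y)-degree at most four, which `h3` covers; similarly for b and c.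
      rcases Nat.lt_or_ge (n + 1) (a + b + c) with hb1 | hb1
      · rcases a with - | a
        · rcases b with - | b
          · obtain ⟨c, rfl⟩ := Nat.exists_eq_add_of_le' (show 1 ≤ c by omega)
            convert sub_mem (momentPoly_mul_lowForms 5 (ih i j 0 0 c (by omega) (by omega)))
              (natCast_mul_mem 6 (h3 i (j + 2) 0 0 c (by omega) (by omega))) using 1
            simp [momentPoly, paramMonomial]; ring
          · convert sub_mem (momentPoly_mul_lowForms 4 (ih i j 0 b c (by omega) (by omega)))
              (natCast_mul_mem 6 (h3 (i + 1) (j + 1) 0 b c (by omega) (by omega))) using 1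
            simp [momentPoly, paramMonomial]; ring
        · convert sub_mem (momentPoly_mul_lowForms 3 (ih i j a b c (by omega) (by omega)))
            (natCast_mul_mem 6 (h3 (i + 2) j a b c (by omega) (by omega))) using 1
          simp [momentPoly, paramMonomial]; ring
      · exact h2 _ _ _ _ _ hb1 (by omega)
    · obtain ⟨rfl, rfl, rfl⟩ : a = 0 ∧ b = 0 ∧ c = 0 := by omega
      rcases le_or_gt (i + j) (2 * n + 3) with h4 | h4
      · exact h2 _ _ _ _ _ (by omega) (by omega)
      -- For powers of x and y alone, total degree 2n+4 is reached by multiplying by x or y, and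
      -- 2n+5 by 6x² = m₂₀ − a or 6y² = m₀₂ − c, where the correction is covered by `h1`.
      rcases Nat.lt_or_ge 1 i with hi | hi
      · obtain ⟨i, rfl⟩ := Nat.exists_eq_add_of_le' hi
        rcases Nat.lt_or_ge (i + 2 + j) (2 * n + 5) with h5 | h5
        · convert X0_mul_lowForms (ih (i + 1) j 0 0 0 (by omega) (by omega)) using 1
          simp [paramMonomial]; ring
        · refine mem_of_natCast_mul_mem 6 ?_
          convert sub_mem (momentPoly_mul_lowForms 3 (ih i j 0 0 0 (by omega) (by omega)))
            (h1 i j 1 0 0 (by omega) (by omega) (by omega) (by omega)) using 1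
          simp [momentPoly, paramMonomial]; ring
      · obtain ⟨j, rfl⟩ := Nat.exists_eq_add_of_le' (show 2 ≤ j by omega)
        rcases Nat.lt_or_ge (i + (j + 2)) (2 * n + 5) with h5 | h5
        · convert X1_mul_lowForms (ih i (j + 1) 0 0 0 (by omega) (by omega)) using 1
          simp [paramMonomial]; ring
        · refine mem_of_natCast_mul_mem 6 ?_
          convert sub_mem (momentPoly_mul_lowForms 5 (ih i j 0 0 0 (by omega) (by omega)))
            (h1 i j 0 0 1 (by omega) (by omega) (by omega) (by omega)) using 1
          simp [momentPoly, paramMonomial]; ring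

theorem paramRes_mul_paramMonomial_mem_lowForms_zero (i j : ℕ) (h : i + j = 3) :
    paramRes * paramMonomial i j 0 0 0 ∈ lowForms 1 := by
  obtain ⟨rfl, rfl⟩ | ⟨rfl, rfl⟩ | ⟨rfl, rfl⟩ | ⟨rfl, rfl⟩ :
      (i = 3 ∧ j = 0) ∨ (i = 2 ∧ j = 1) ∨ (i = 1 ∧ j = 2) ∨ (i = 0 ∧ j = 3) := by omega
  · refine mem_lowForms_of_list 1 324 (by decide)
      [(-2, ![0, 1, 0, 0, 0, 0, 1, 0, 1, 0]), (4, ![0, 0, 0, 0, 2, 0, 1, 0, 0, 0]), (-6, ![0, 0, 0, 1, 1, 0, 0, 1, 0, 0]), (2, ![0, 1, 0, 0, 0, 0, 0, 2, 0, 0]), (-1, ![0, 0, 0, 1, 0, 1, 1, 0, 0, 0]), (3, ![0, 0, 0, 2, 0, 0, 0, 0, 1, 0])]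
      (by decide) 108 (paramCubic 0) (paramCubic_mem_cubicForms 0) ?_
    simp [momentMonomial_vec, momentPoly, paramMonomial, paramRes, paramCubic]; ring
  · refine mem_lowForms_of_list 1 972 (by decide)
      [(-9, ![0, 0, 0, 1, 0, 1, 0, 1, 0, 0]), (2, ![0, 1, 0, 0, 0, 0, 0, 1, 1, 0]), (-2, ![0, 0, 1, 0, 0, 0, 1, 0, 1, 0]), (-2, ![0, 1, 0, 0, 0, 0, 1, 0, 0, 1]), (3, ![0, 0, 0, 2, 0, 0, 0, 0, 0, 1]), (2, ![0, 0, 1, 0, 0, 0, 0, 2, 0, 0]), (6, ![0, 0, 0, 0, 1, 1, 1, 0, 0, 0])]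
      (by decide) 108 (paramCubic 1) (paramCubic_mem_cubicForms 1) ?_
    simp [momentMonomial_vec, momentPoly, paramMonomial, paramRes, paramCubic]; ring
  · refine mem_lowForms_of_list 1 972 (by decide)
      [(2, ![0, 0, 1, 0, 0, 0, 0, 1, 1, 0]), (2, ![0, 1, 0, 0, 0, 0, 0, 0, 2, 0]), (6, ![0, 0, 0, 1, 1, 0, 0, 0, 0, 1]), (-2, ![0, 0, 1, 0, 0, 0, 1, 0, 0, 1]), (-9, ![0, 0, 0, 1, 0, 1, 0, 0, 1, 0]), (3, ![0, 0, 0, 0, 0, 2, 1, 0, 0, 0]), (-2, ![0, 1, 0, 0, 0, 0, 0, 1, 0, 1])]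
      (by decide) 108 (paramCubic 2) (paramCubic_mem_cubicForms 2) ?_
    simp [momentMonomial_vec, momentPoly, paramMonomial, paramRes, paramCubic]; ring
  · refine mem_lowForms_of_list 1 324 (by decide)
      [(3, ![0, 0, 0, 0, 0, 2, 0, 1, 0, 0]), (2, ![0, 0, 1, 0, 0, 0, 0, 0, 2, 0]), (-6, ![0, 0, 0, 0, 1, 1, 0, 0, 1, 0]), (-2, ![0, 0, 1, 0, 0, 0, 0, 1, 0, 1]), (4, ![0, 0, 0, 0, 2, 0, 0, 0, 0, 1]), (-1, ![0, 0, 0, 1, 0, 1, 0, 0, 0, 1])]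
      (by decide) 108 (paramCubic 3) (paramCubic_mem_cubicForms 3) ?_
    simp [momentMonomial_vec, momentPoly, paramMonomial, paramRes, paramCubic]; ring

/-- If the (a, b, c)-degree is maximal, a third-order moment can be split off. Otherwise 6x² = m₂₀ −
a (or 6y² = m₀₂ − c) is used: the product of R with the correction expands into monomials of total
degree 2(n+2)+3, within reach of `paramMonomial_mem_lowForms`. -/
theorem paramRes_mul_paramMonomial_mem_lowForms (n : ℕ) : ∀ i j a b c : ℕ, a + b + c ≤ n →
    i + j + (a + b + c) = 2 * n + 3 → paramRes * paramMonomial i j a b c ∈ lowForms (n + 1) := by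
  induction n with
  | zero =>
    intro i j a b c hb h
    obtain ⟨rfl, rfl, rfl⟩ : a = 0 ∧ b = 0 ∧ c = 0 := by omega
    exact paramRes_mul_paramMonomial_mem_lowForms_zero i j (by omega)
  | succ n ih =>
    intro i j a b c hb h
    rcases Nat.lt_or_ge n (a + b + c) with hb1 | hb1
    · exact mul_paramMonomial_mem_of_paramCubic_mul_mem (m := n + 3) (N := n) (by omega) paramRes
        (fun l i' j' a' b' c' h1 h2 =>
          paramCubic_mul_lowForms l (ih i' j' a' b' c' (by omega) (by omega)))
        (by omega) (by omega)
    · rcases Nat.lt_or_ge 1 i with hi | hi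
      · obtain ⟨i, rfl⟩ := Nat.exists_eq_add_of_le' hi
        have h1 := paramMonomial_mem_lowForms (n + 2) i (j + 2) (a + 2) b c (by omega) (by omega)
        have h2 := paramMonomial_mem_lowForms (n + 2) (i + 1) (j + 1) (a + 1) (b + 1) c
          (by omega) (by omega)
        have h3 := paramMonomial_mem_lowForms (n + 2) (i + 2) j (a + 1) b (c + 1)
          (by omega) (by omega)
        refine mem_of_natCast_mul_mem 6 ?_
        convert sub_mem (momentPoly_mul_lowForms 3 (ih i j a b c (by omega) (by omega)))
          (add_mem (sub_mem h1 (natCast_mul_mem 2 h2)) h3) using 1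
        simp [momentPoly, paramMonomial, paramRes]; ring
      · obtain ⟨j, rfl⟩ := Nat.exists_eq_add_of_le' (show 2 ≤ j by omega)
        have h1 := paramMonomial_mem_lowForms (n + 2) i (j + 2) (a + 1) b (c + 1)
          (by omega) (by omega)
        have h2 := paramMonomial_mem_lowForms (n + 2) (i + 1) (j + 1) a (b + 1) (c + 1)
          (by omega) (by omega)
        have h3 := paramMonomial_mem_lowForms (n + 2) (i + 2) j a b (c + 2)
          (by omega) (by omega)
        refine mem_of_natCast_mul_mem 6 ?_
        convert sub_mem (momentPoly_mul_lowForms 5 (ih i j a b c (by omega) (by omega)))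
          (add_mem (sub_mem h1 (natCast_mul_mem 2 h2)) h3) using 1
        simp [momentPoly, paramMonomial, paramRes]; ring

/-! ### The upper part of the monomials -/

/-- The polynomials of degree less than `k` in the quadratic parameters. -/
def quadDegreeLT (k : ℕ) : Submodule ℂ (MvPolynomial (Fin 5) ℂ) where
  carrier := {f | ∀ e : Fin 5 →₀ ℕ, k ≤ e 2 + e 3 + e 4 → coeff e f = 0}
  zero_mem' := fun e _ => coeff_zero e
  add_mem' := fun {f g} hf hg e he => by rw [coeff_add, hf e he, hg e he, add_zero]
  smul_mem' := fun c f hf e he => by rw [coeff_smul, hf e he, smul_zero]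

theorem quadDegreeLT_mono {k l : ℕ} (h : k ≤ l) : quadDegreeLT k ≤ quadDegreeLT l :=
  fun _ hf e he => hf e (h.trans he)

theorem mul_mem_quadDegreeLT {k l : ℕ} {f g : MvPolynomial (Fin 5) ℂ}
    (hf : f ∈ quadDegreeLT (k + 1)) (hg : g ∈ quadDegreeLT l) : f * g ∈ quadDegreeLT (k + l) := by
  intro e he
  rw [coeff_mul]
  refine Finset.sum_eq_zero fun d hd => ?_
  rw [Finset.HasAntidiagonal.mem_antidiagonal] at hd
  simp only [← hd, Finsupp.add_apply] at he
  rcases le_or_gt (k + 1) (d.1 2 + d.1 3 + d.1 4) with h | h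
  · rw [hf _ h, zero_mul]
  · rw [hg _ (by omega), mul_zero]

/-- The exponent of a monomial in the five parameters. -/
def paramExponent (i j a b c : ℕ) : Fin 5 →₀ ℕ := Finsupp.equivFunOnFinite.symm ![i, j, a, b, c]

theorem paramMonomial_eq (i j a b c : ℕ) :
    paramMonomial i j a b c = monomial (paramExponent i j a b c) 1 := by
  rw [monomial_eq, Finsupp.prod_fintype _ _ (by simp)]
  simp [Fin.prod_univ_five, paramExponent, paramMonomial, mul_assoc]

theorem paramMonomial_mem_quadDegreeLT {i j a b c k : ℕ} (h : a + b + c < k) :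
    paramMonomial i j a b c ∈ quadDegreeLT k := by
  intro e he
  rw [paramMonomial_eq, coeff_monomial, if_neg]
  rintro rfl
  simp [paramExponent] at he
  omega

theorem X0_mem_quadDegreeLT : X 0 ∈ quadDegreeLT 1 := by
  simpa [paramMonomial] using paramMonomial_mem_quadDegreeLT (i := 1) (j := 0) (a := 0) (b := 0)
    (c := 0) zero_lt_one

theorem X1_mem_quadDegreeLT : X 1 ∈ quadDegreeLT 1 := by
  simpa [paramMonomial] using paramMonomial_mem_quadDegreeLT (i := 0) (j := 1) (a := 0) (b := 0)
    (c := 0) zero_lt_one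

theorem X2_mem_quadDegreeLT : X 2 ∈ quadDegreeLT 2 := by
  simpa [paramMonomial] using paramMonomial_mem_quadDegreeLT (i := 0) (j := 0) (a := 1) (b := 0)
    (c := 0) one_lt_two

theorem X3_mem_quadDegreeLT : X 3 ∈ quadDegreeLT 2 := by
  simpa [paramMonomial] using paramMonomial_mem_quadDegreeLT (i := 0) (j := 0) (a := 0) (b := 1)
    (c := 0) one_lt_two

theorem X4_mem_quadDegreeLT : X 4 ∈ quadDegreeLT 2 := by
  simpa [paramMonomial] using paramMonomial_mem_quadDegreeLT (i := 0) (j := 0) (a := 0) (b := 0)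
    (c := 1) one_lt_two

theorem C_mem_quadDegreeLT (c : ℂ) : C c ∈ quadDegreeLT 1 := by
  have := Submodule.smul_mem _ c (paramMonomial_mem_quadDegreeLT (i := 0) (j := 0) (a := 0)
    (b := 0) (c := 0) zero_lt_one)
  simpa [paramMonomial, smul_eq_C_mul] using this

theorem linear_mul_mem {k : ℕ} {l f : MvPolynomial (Fin 5) ℂ} (hl : l ∈ quadDegreeLT 1)
    (hf : f ∈ quadDegreeLT k) : l * f ∈ quadDegreeLT k := by
  simpa using mul_mem_quadDegreeLT (k := 0) hl hf

theorem quadratic_mul_mem {k : ℕ} {q f : MvPolynomial (Fin 5) ℂ} (hq : q ∈ quadDegreeLT 2)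
    (hf : f ∈ quadDegreeLT k) : q * f ∈ quadDegreeLT (k + 1) := by
  simpa [add_comm] using mul_mem_quadDegreeLT (k := 1) hq hf

theorem paramCubic_mem_quadDegreeLT (l : Fin 4) : paramCubic l ∈ quadDegreeLT 2 := by
  have h0 := X0_mem_quadDegreeLT
  have h1 := X1_mem_quadDegreeLT
  have h2 := X2_mem_quadDegreeLT
  have h3 := X3_mem_quadDegreeLT
  have h4 := X4_mem_quadDegreeLT
  fin_cases l
  · exact linear_mul_mem h0 h2
  · exact add_mem (natCast_mul_mem 2 (linear_mul_mem h0 h3)) (linear_mul_mem h1 h2)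
  · exact add_mem (linear_mul_mem h0 h4) (natCast_mul_mem 2 (linear_mul_mem h1 h3))
  · exact linear_mul_mem h1 h4

theorem momentPoly_mem_quadDegreeLT (j : Fin 10) : momentPoly j ∈ quadDegreeLT 2 := by
  have h12 : quadDegreeLT 1 ≤ quadDegreeLT 2 := quadDegreeLT_mono one_le_two
  have h0 := X0_mem_quadDegreeLT
  have h1 := X1_mem_quadDegreeLT
  have h2 := X2_mem_quadDegreeLT
  have h3 := X3_mem_quadDegreeLT
  have h4 := X4_mem_quadDegreeLT
  fin_cases j
  · simpa [momentPoly] using h12 (C_mem_quadDegreeLT 1)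
  · exact natCast_mul_mem 3 (h12 h0)
  · exact natCast_mul_mem 3 (h12 h1)
  · simpa [momentPoly, pow_two] using
      add_mem h2 (natCast_mul_mem 6 (h12 (linear_mul_mem h0 h0)))
  · simpa [momentPoly, mul_assoc] using
      add_mem h3 (natCast_mul_mem 6 (h12 (linear_mul_mem h0 h1)))
  · simpa [momentPoly, pow_two] using
      add_mem h4 (natCast_mul_mem 6 (h12 (linear_mul_mem h1 h1)))
  · convert natCast_mul_mem 9 (paramCubic_mem_quadDegreeLT 0) using 1
    simp [momentPoly, paramCubic, mul_assoc]
  · convert natCast_mul_mem 3 (paramCubic_mem_quadDegreeLT 1) using 1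
    simp [momentPoly, paramCubic]; ring
  · convert natCast_mul_mem 3 (paramCubic_mem_quadDegreeLT 2) using 1
    simp [momentPoly, paramCubic]; ring
  · convert natCast_mul_mem 9 (paramCubic_mem_quadDegreeLT 3) using 1
    simp [momentPoly, paramCubic, mul_assoc]

/-- Every monomial of degree k+1 is a coordinate times one of degree k, which allows induction over
spaces of forms. -/
theorem momentForms_succ_le {k : ℕ} {W : Submodule ℂ (MvPolynomial (Fin 5) ℂ)}
    (h : ∀ j, ∀ f ∈ momentForms k, momentPoly j * f ∈ W) : momentForms (k + 1) ≤ W := by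
  rw [momentForms, Submodule.map_le_iff_le_comap]
  refine (homogeneousSubmodule_le_span _).trans (Submodule.span_le.mpr ?_)
  rintro f ⟨e, he, rfl⟩
  obtain ⟨j, hj⟩ : ∃ j, 1 ≤ e j := by
    by_contra! hc
    have : ∑ j, e j = 0 := Finset.sum_eq_zero fun j _ => by have := hc j; omega
    omega
  have hsum : ∑ l, (e - Pi.single j 1 : Fin 10 → ℕ) l = k := by
    have h1 : (e - Pi.single j 1 : Fin 10 → ℕ) + Pi.single j 1 = e := by
      funext l
      rcases eq_or_ne l j with rfl | hl
      · simp [Nat.sub_add_cancel hj]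
      · simp [hl]
    have h2 : ∑ l, ((e - Pi.single j 1 : Fin 10 → ℕ) + Pi.single j 1 : Fin 10 → ℕ) l = k + 1 := by
      rw [h1, he]
    simp only [Pi.add_apply, Finset.sum_add_distrib, Finset.sum_pi_single', Finset.mem_univ,
      if_true] at h2
    omega
  have hmul : momentMonomial e = momentVar j * momentMonomial (e - Pi.single j 1) := by
    have h1 : momentMonomial (Pi.single j 1) = momentVar j := by
      rw [momentMonomial, Finset.prod_eq_single j (by intro b _ hb; simp [Pi.single_eq_of_ne hb])
        (by simp)]
      simp
    rw [← h1, ← momentMonomial_add]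
    congr 1
    funext l
    rcases eq_or_ne l j with rfl | hl
    · simp only [Pi.add_apply, Pi.single_eq_same, Pi.sub_apply]; omega
    · simp [hl]
  have h3 := momentMonomial_isHomogeneous (e - Pi.single j 1)
  rw [hsum] at h3
  have h4 := h j (momentHom (momentMonomial (e - Pi.single j 1))) ⟨_, h3, rfl⟩
  rw [← momentHom_momentVar, ← map_mul, ← hmul] at h4
  exact h4

theorem momentForms_le_quadDegreeLT (k : ℕ) : momentForms k ≤ quadDegreeLT (k + 1) := by
  induction k with
  | zero =>
    rw [momentForms, Submodule.map_le_iff_le_comap]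
    intro f hf
    rw [totalDegree_eq_zero_iff_eq_C.mp ((totalDegree_zero_iff_isHomogeneous _).mpr hf)]
    simpa using C_mem_quadDegreeLT _
  | succ k ih =>
    exact momentForms_succ_le fun j f hf => quadratic_mul_mem (momentPoly_mem_quadDegreeLT j)
      (ih hf)

/-- Two bilinear covariants of the linear and the quadratic parameters. -/
def paramBilin : Fin 2 → MvPolynomial (Fin 5) ℂ := ![X 0 * X 3 - X 1 * X 2, X 0 * X 4 - X 1 * X 3]

theorem paramBilin_mem_quadDegreeLT (l : Fin 2) : paramBilin l ∈ quadDegreeLT 2 := by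
  fin_cases l
  · exact sub_mem (linear_mul_mem X0_mem_quadDegreeLT X3_mem_quadDegreeLT)
      (linear_mul_mem X1_mem_quadDegreeLT X2_mem_quadDegreeLT)
  · exact sub_mem (linear_mul_mem X0_mem_quadDegreeLT X4_mem_quadDegreeLT)
      (linear_mul_mem X1_mem_quadDegreeLT X3_mem_quadDegreeLT)

/-- The forms of degree `n + 1`, enlarged by multiples of the two bilinear covariants. -/
def bilinForms (n : ℕ) : Submodule ℂ (MvPolynomial (Fin 5) ℂ) :=
  momentForms (n + 1) ⊔ ⨆ l, (cubicForms n).map (LinearMap.mulLeft ℂ (paramBilin l))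

/-- The forms of degree `n + 1`, enlarged by multiples of the two bilinear covariants and by
the polynomials of degree at most `n` in the quadratic parameters. -/
def highForms (n : ℕ) : Submodule ℂ (MvPolynomial (Fin 5) ℂ) :=
  bilinForms n ⊔ quadDegreeLT (n + 1)

theorem momentForms_le_highForms (n : ℕ) : momentForms (n + 1) ≤ highForms n :=
  le_sup_left.trans le_sup_left

theorem quadDegreeLT_le_highForms (n : ℕ) : quadDegreeLT (n + 1) ≤ highForms n := le_sup_right

theorem paramBilin_mul_mem_highForms (l : Fin 2) {n : ℕ} {f : MvPolynomial (Fin 5) ℂ}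
    (hf : f ∈ cubicForms n) : paramBilin l * f ∈ highForms n :=
  Submodule.mem_sup_left (Submodule.mem_sup_right (Submodule.mem_iSup_of_mem l ⟨f, hf, rfl⟩))

theorem mul_mem_of_mem_highForms {n : ℕ} {W : Submodule ℂ (MvPolynomial (Fin 5) ℂ)}
    (g : MvPolynomial (Fin 5) ℂ) (h1 : ∀ f ∈ momentForms (n + 1), g * f ∈ W)
    (h2 : ∀ l, ∀ f ∈ cubicForms n, g * (paramBilin l * f) ∈ W)
    (h3 : ∀ f ∈ quadDegreeLT (n + 1), g * f ∈ W) {f : MvPolynomial (Fin 5) ℂ}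
    (hf : f ∈ highForms n) : g * f ∈ W := by
  have : highForms n ≤ W.comap (LinearMap.mulLeft ℂ g) := by
    refine sup_le (sup_le (fun f hf => h1 f hf) (iSup_le fun l => ?_)) (fun f hf => h3 f hf)
    rintro _ ⟨f, hf, rfl⟩
    exact h2 l f hf
  exact this hf

theorem highForms_le_quadDegreeLT (n : ℕ) : highForms n ≤ quadDegreeLT (n + 2) := by
  intro f hf
  rw [← one_mul f]
  refine mul_mem_of_mem_highForms 1 (fun f hf => ?_) (fun l f hf => ?_) (fun f hf => ?_) hf
  · rw [one_mul]; exact momentForms_le_quadDegreeLT _ hf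
  · rw [one_mul]
    exact quadratic_mul_mem (paramBilin_mem_quadDegreeLT l)
      (momentForms_le_quadDegreeLT _ (cubicForms_le_momentForms _ hf))
  · rw [one_mul]; exact quadDegreeLT_mono (by omega) hf

theorem paramCubic_mul_highForms (l : Fin 4) {n : ℕ} {f : MvPolynomial (Fin 5) ℂ}
    (hf : f ∈ highForms n) : paramCubic l * f ∈ highForms (n + 1) := by
  refine mul_mem_of_mem_highForms _ (fun f hf => ?_) (fun i f hf => ?_) (fun f hf => ?_) hf
  · rw [mul_comm]
    exact momentForms_le_highForms _ (momentForms_mul hf (paramCubic_mem_momentForms l))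
  · rw [mul_left_comm, mul_comm (paramCubic l)]
    exact paramBilin_mul_mem_highForms i (cubicForms_mul hf (paramCubic_mem_cubicForms l))
  · exact quadDegreeLT_le_highForms _ (quadratic_mul_mem (paramCubic_mem_quadDegreeLT l) hf)

/-- The quadratic parameters. -/
def quadParam : Fin 3 → MvPolynomial (Fin 5) ℂ := ![X 2, X 3, X 4]

/-- Modulo terms of lower degree in a, b, c, the parameters a, b, c are the second-order moments. -/
theorem quadParam_mul_momentForms (i : Fin 3) {n : ℕ} {f : MvPolynomial (Fin 5) ℂ}
    (hf : f ∈ momentForms (n + 1)) : quadParam i * f ∈ highForms (n + 1) := by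
  have h (j : Fin 10) : momentPoly j * f ∈ highForms (n + 1) := by
    rw [mul_comm]
    exact momentForms_le_highForms _ (momentForms_mul hf (momentPoly_mem j))
  have hq {l l' : MvPolynomial (Fin 5) ℂ} (hl : l ∈ quadDegreeLT 1) (hl' : l' ∈ quadDegreeLT 1) :
      l * l' * f ∈ highForms (n + 1) := by
    rw [mul_assoc]
    exact quadDegreeLT_le_highForms _ (linear_mul_mem hl (linear_mul_mem hl'
      (momentForms_le_quadDegreeLT _ hf)))
  have h0 := X0_mem_quadDegreeLT
  have h1 := X1_mem_quadDegreeLT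
  fin_cases i
  · convert sub_mem (h 3) (natCast_mul_mem 6 (hq h0 h0)) using 1
    simp [quadParam, momentPoly]; ring
  · convert sub_mem (h 4) (natCast_mul_mem 6 (hq h0 h1)) using 1
    simp [quadParam, momentPoly]; ring
  · convert sub_mem (h 5) (natCast_mul_mem 6 (hq h1 h1)) using 1
    simp [quadParam, momentPoly]; ring

/-- The product of a, b or c with a bilinear covariant is a combination of products of a, b, c with
third-order moments, for instance a(xb − ya) = 3b·xa − a(2xb + ya). Hence only multiples of the
covariants by third-order moments have to be added. -/
theorem quadParam_mul_highForms (i : Fin 3) {n : ℕ} {f : MvPolynomial (Fin 5) ℂ}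
    (hf : f ∈ highForms n) : quadParam i * f ∈ highForms (n + 1) := by
  have hq : quadParam i ∈ quadDegreeLT 2 := by
    fin_cases i
    exacts [X2_mem_quadDegreeLT, X3_mem_quadDegreeLT, X4_mem_quadDegreeLT]
  refine mul_mem_of_mem_highForms _ (fun f hf => quadParam_mul_momentForms i hf)
    (fun l f hf => ?_) (fun f hf => quadDegreeLT_le_highForms _ (quadratic_mul_mem hq hf)) hf
  have h (i : Fin 3) (l : Fin 4) : quadParam i * (f * paramCubic l) ∈ highForms (n + 1) :=
    quadParam_mul_momentForms i
      (cubicForms_le_momentForms _ (cubicForms_mul hf (paramCubic_mem_cubicForms l)))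
  fin_cases l
  · fin_cases i
    · convert sub_mem (natCast_mul_mem 3 (h 1 0)) (h 0 1) using 1
      simp [quadParam, paramBilin, paramCubic]; ring
    · refine mem_of_natCast_mul_mem 4 ?_
      convert sub_mem (natCast_mul_mem 2 (h 1 1))
        (natCast_mul_mem 3 (sub_mem (h 0 2) (h 2 0))) using 1
      simp [quadParam, paramBilin, paramCubic]; ring
    · refine mem_of_natCast_mul_mem 2 ?_
      convert sub_mem (h 2 1) (natCast_mul_mem 3 (h 0 3)) using 1
      simp [quadParam, paramBilin, paramCubic]; ring
  · fin_cases i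
    · refine mem_of_natCast_mul_mem 2 ?_
      convert sub_mem (natCast_mul_mem 3 (h 2 0)) (h 0 2) using 1
      simp [quadParam, paramBilin, paramCubic]; ring
    · refine mem_of_natCast_mul_mem 4 ?_
      convert sub_mem (natCast_mul_mem 3 (sub_mem (h 2 1) (h 0 3)))
        (natCast_mul_mem 2 (h 1 2)) using 1
      simp [quadParam, paramBilin, paramCubic]; ring
    · convert sub_mem (h 2 2) (natCast_mul_mem 3 (h 1 3)) using 1
      simp [quadParam, paramBilin, paramCubic]; ring

theorem linear_mul_highForms {n : ℕ} {l f : MvPolynomial (Fin 5) ℂ} (hl : l ∈ quadDegreeLT 1)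
    (hf : f ∈ highForms n) : l * f ∈ highForms (n + 1) :=
  quadDegreeLT_le_highForms _ (linear_mul_mem hl (highForms_le_quadDegreeLT _ hf))

theorem momentPoly_mul_highForms (j : Fin 10) {n : ℕ} {f : MvPolynomial (Fin 5) ℂ}
    (hf : f ∈ highForms n) : momentPoly j * f ∈ highForms (n + 1) := by
  have h0 := X0_mem_quadDegreeLT
  have h1 := X1_mem_quadDegreeLT
  have hl {l : MvPolynomial (Fin 5) ℂ} (hl : l ∈ quadDegreeLT 1) := linear_mul_highForms hl hf
  have hp (l : Fin 4) := paramCubic_mul_highForms l hf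
  have hq (l : Fin 3) := quadParam_mul_highForms l hf
  fin_cases j
  · convert hl (C_mem_quadDegreeLT 1) using 1
    simp [momentPoly]
  · convert natCast_mul_mem 3 (hl h0) using 1
    simp [momentPoly, mul_assoc]
  · convert natCast_mul_mem 3 (hl h1) using 1
    simp [momentPoly, mul_assoc]
  · convert add_mem (hq 0) (natCast_mul_mem 6 (hl (linear_mul_mem h0 h0))) using 1
    simp [momentPoly, quadParam]; ring
  · convert add_mem (hq 1) (natCast_mul_mem 6 (hl (linear_mul_mem h0 h1))) using 1
    simp [momentPoly, quadParam]; ring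
  · convert add_mem (hq 2) (natCast_mul_mem 6 (hl (linear_mul_mem h1 h1))) using 1
    simp [momentPoly, quadParam]; ring
  · convert natCast_mul_mem 9 (hp 0) using 1
    simp [momentPoly, paramCubic]; ring
  · convert natCast_mul_mem 3 (hp 1) using 1
    simp [momentPoly, paramCubic]; ring
  · convert natCast_mul_mem 3 (hp 2) using 1
    simp [momentPoly, paramCubic]; ring
  · convert natCast_mul_mem 9 (hp 3) using 1
    simp [momentPoly, paramCubic]; ring

/-- Induction over the degree of the form, moving the covariant past one coordinate at a time. -/
theorem paramBilin_mul_momentForms (l : Fin 2) (n : ℕ) :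
    ∀ f ∈ momentForms n, paramBilin l * f ∈ highForms n := by
  induction n with
  | zero =>
    rintro _ ⟨f, hf, rfl⟩
    rw [totalDegree_eq_zero_iff_eq_C.mp ((totalDegree_zero_iff_isHomogeneous _).mpr hf)]
    have := Submodule.smul_mem _ (coeff 0 f) one_mem_cubicForms
    convert paramBilin_mul_mem_highForms l this using 2
    simp [smul_eq_C_mul]
  | succ n ih =>
    have : momentForms (n + 1) ≤ (highForms (n + 1)).comap (LinearMap.mulLeft ℂ (paramBilin l)) :=
      momentForms_succ_le fun j f hf => by
        rw [Submodule.mem_comap, LinearMap.mulLeft_apply, mul_left_comm]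
        exact momentPoly_mul_highForms j (ih f hf)
    exact fun f hf => this hf

/-- A product of two covariants is a combination of products of two third-order moments and of
products of a covariant with a third-order moment. So no multiples of products of covariants have to
be added. -/
theorem paramBilin_mul_highForms (l : Fin 2) {n : ℕ} {f : MvPolynomial (Fin 5) ℂ}
    (hf : f ∈ highForms n) : paramBilin l * f ∈ highForms (n + 1) := by
  refine mul_mem_of_mem_highForms _ (fun f hf => paramBilin_mul_momentForms l _ f hf)
    (fun i f hf => ?_) (fun f hf => quadDegreeLT_le_highForms _
      (quadratic_mul_mem (paramBilin_mem_quadDegreeLT l) hf)) hf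
  have h1 (i j : Fin 4) : paramCubic i * (paramCubic j * f) ∈ highForms (n + 1) := by
    have h := cubicForms_mul (paramCubic_mem_cubicForms i)
      (cubicForms_mul (paramCubic_mem_cubicForms j) hf)
    rw [show 1 + (1 + n) = n + 1 + 1 by omega] at h
    exact momentForms_le_highForms _ (cubicForms_le_momentForms _ h)
  have h2 (i : Fin 4) (l : Fin 2) : paramBilin l * (f * paramCubic i) ∈ highForms (n + 1) :=
    paramBilin_mul_mem_highForms l (cubicForms_mul hf (paramCubic_mem_cubicForms i))
  have h11 : paramBilin 0 * (paramBilin 0 * f) ∈ highForms (n + 1) := by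
    refine mem_of_natCast_mul_mem 2 ?_
    convert add_mem (natCast_mul_mem 3 (sub_mem (h2 0 1) (h1 0 2))) (sub_mem (h1 1 1) (h2 1 0))
      using 1
    simp [paramBilin, paramCubic]; ring
  have h12 : paramBilin 0 * (paramBilin 1 * f) ∈ highForms (n + 1) := by
    refine mem_of_natCast_mul_mem 4 ?_
    convert add_mem (sub_mem (h1 1 2) (natCast_mul_mem 9 (h1 0 3)))
      (natCast_mul_mem 2 (sub_mem (h2 1 1) (h2 2 0))) using 1
    simp [paramBilin, paramCubic]; ring
  have h22 : paramBilin 1 * (paramBilin 1 * f) ∈ highForms (n + 1) := by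
    refine mem_of_natCast_mul_mem 2 ?_
    convert sub_mem (add_mem (h1 2 2) (h2 2 1)) (natCast_mul_mem 3 (add_mem (h1 1 3) (h2 3 0)))
      using 1
    simp [paramBilin, paramCubic]; ring
  fin_cases l <;> fin_cases i
  · exact h11
  · exact h12
  · rw [mul_left_comm]; exact h12
  · exact h22

theorem quad_mul_paramMonomial_mem {W : Submodule ℂ (MvPolynomial (Fin 5) ℂ)} {n : ℕ}
    {i j a b c : ℕ} (habc : a + b + c = n + 1) {g : MvPolynomial (Fin 5) ℂ}
    (h : ∀ l a b c, a + b + c = n → quadParam l * (g * paramMonomial i j a b c) ∈ W) :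
    g * paramMonomial i j a b c ∈ W := by
  rcases a with - | a
  · rcases b with - | b
    · obtain ⟨c, rfl⟩ := Nat.exists_eq_add_of_le' (show 1 ≤ c by omega)
      convert h 2 0 0 c (by omega) using 1
      simp [paramMonomial, quadParam]; ring
    · convert h 1 0 b c (by omega) using 1
      simp [paramMonomial, quadParam]; ring
  · convert h 0 a b c (by omega) using 1
    simp [paramMonomial, quadParam]; ring

/-- The splitting of linear times quadratic binary forms into cubic and linear ones: the four
third-order moments and the two covariants together span the six products of x, y with a, b, c. -/
theorem linear_mul_quadParam_mul_mem {W : Submodule ℂ (MvPolynomial (Fin 5) ℂ)}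
    {f : MvPolynomial (Fin 5) ℂ} (h1 : ∀ l, paramCubic l * f ∈ W)
    (h2 : ∀ l, paramBilin l * f ∈ W) (l : Fin 3) :
    quadParam l * (X 0 * f) ∈ W ∧ quadParam l * (X 1 * f) ∈ W := by
  fin_cases l
  · refine ⟨?_, mem_of_natCast_mul_mem 3 ?_⟩
    · convert h1 0 using 1
      simp [paramCubic, quadParam]; ring
    · convert sub_mem (h1 1) (natCast_mul_mem 2 (h2 0)) using 1
      simp [paramCubic, quadParam, paramBilin]; ring
  · refine ⟨mem_of_natCast_mul_mem 3 ?_, mem_of_natCast_mul_mem 3 ?_⟩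
    · convert add_mem (h1 1) (h2 0) using 1
      simp [paramCubic, quadParam, paramBilin]; ring
    · convert sub_mem (h1 2) (h2 1) using 1
      simp [paramCubic, quadParam, paramBilin]; ring
  · refine ⟨mem_of_natCast_mul_mem 3 ?_, ?_⟩
    · convert add_mem (h1 2) (natCast_mul_mem 2 (h2 1)) using 1
      simp [paramCubic, quadParam, paramBilin]; ring
    · convert h1 3 using 1
      simp [paramCubic, quadParam]; ring

/-- Each step splits off one of a, b, c; if the (x, y)-degree is maximal, it splits off one of x, y
with it. -/
theorem paramMonomial_mem_highForms (n : ℕ) : ∀ i j a b c : ℕ, i + j ≤ n + 1 →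
    a + b + c = n + 1 → paramMonomial i j a b c ∈ highForms n := by
  induction n with
  | zero =>
    intro i j a b c hij habc
    rw [← one_mul (paramMonomial i j a b c)]
    refine quad_mul_paramMonomial_mem (n := 0) habc fun l a b c h => ?_
    obtain ⟨rfl, rfl, rfl⟩ : a = 0 ∧ b = 0 ∧ c = 0 := by omega
    have h1 (l : Fin 4) : paramCubic l * 1 ∈ highForms 0 := by
      rw [mul_one]
      exact momentForms_le_highForms _ (paramCubic_mem_momentForms l)
    have h2 (l : Fin 2) : paramBilin l * 1 ∈ highForms 0 :=
      paramBilin_mul_mem_highForms l one_mem_cubicForms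
    obtain ⟨rfl, rfl⟩ | ⟨rfl, rfl⟩ | ⟨rfl, rfl⟩ :
        (i = 0 ∧ j = 0) ∨ (i = 1 ∧ j = 0) ∨ (i = 0 ∧ j = 1) := by omega
    · have h3 (j : Fin 10) : momentPoly j ∈ highForms 0 :=
        momentForms_le_highForms _ (momentPoly_mem j)
      have hq {l l' : MvPolynomial (Fin 5) ℂ} (hl : l ∈ quadDegreeLT 1)
          (hl' : l' ∈ quadDegreeLT 1) : l * l' ∈ highForms 0 :=
        quadDegreeLT_le_highForms _ (linear_mul_mem hl hl')
      have h0 := X0_mem_quadDegreeLT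
      have h1 := X1_mem_quadDegreeLT
      fin_cases l
      · convert sub_mem (h3 3) (natCast_mul_mem 6 (hq h0 h0)) using 1
        simp [quadParam, momentPoly, paramMonomial]; ring
      · convert sub_mem (h3 4) (natCast_mul_mem 6 (hq h0 h1)) using 1
        simp [quadParam, momentPoly, paramMonomial]
      · convert sub_mem (h3 5) (natCast_mul_mem 6 (hq h1 h1)) using 1
        simp [quadParam, momentPoly, paramMonomial]; ring
    · simpa [paramMonomial] using (linear_mul_quadParam_mul_mem h1 h2 l).1
    · simpa [paramMonomial] using (linear_mul_quadParam_mul_mem h1 h2 l).2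
  | succ n ih =>
    intro i j a b c hij habc
    rw [← one_mul (paramMonomial i j a b c)]
    refine quad_mul_paramMonomial_mem habc fun l a b c h => ?_
    rw [one_mul]
    rcases Nat.lt_or_ge (i + j) (n + 2) with h' | h'
    · exact quadParam_mul_highForms l (ih _ _ _ _ _ (by omega) h)
    · rcases i with - | i
      · obtain ⟨j, rfl⟩ := Nat.exists_eq_add_of_le' (show 1 ≤ j by omega)
        have h3 := ih 0 j a b c (by omega) h
        convert (linear_mul_quadParam_mul_mem (fun l => paramCubic_mul_highForms l h3)
          (fun l => paramBilin_mul_highForms l h3) l).2 using 2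
        simp only [paramMonomial]; ring
      · have h3 := ih i j a b c (by omega) h
        convert (linear_mul_quadParam_mul_mem (fun l => paramCubic_mul_highForms l h3)
          (fun l => paramBilin_mul_highForms l h3) l).1 using 2
        simp only [paramMonomial]; ring

/-! ### Triangular families -/

/-- In a relation, choose an index of maximal height among those with nonzero coefficient; its pivot
monomial occurs in no other term with nonzero coefficient. -/
theorem linearIndependent_of_triangular {ι σ : Type} (f : ι → MvPolynomial σ ℂ) (e : ι → σ →₀ ℕ)
    (ht : ι → ℕ) (h1 : ∀ i, coeff (e i) (f i) ≠ 0)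
    (h2 : ∀ i j, j ≠ i → ht j ≤ ht i → coeff (e i) (f j) = 0) : LinearIndependent ℂ f := by
  rw [linearIndependent_iff']
  intro s c hc
  by_contra! hne
  obtain ⟨i₀, hi₀, hne⟩ := hne
  obtain ⟨i, hi, hmax⟩ := Finset.exists_max_image (s.filter fun i => c i ≠ 0) ht
    ⟨i₀, by simp [hi₀, hne]⟩
  rw [Finset.mem_filter] at hi
  have h3 := congrArg (coeff (e i)) hc
  rw [coeff_sum, Finset.sum_eq_single i] at h3
  · simp only [coeff_smul, coeff_zero, smul_eq_mul, mul_eq_zero] at h3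
    exact h3.elim hi.2 (h1 i)
  · intro j hj hji
    by_cases hcj : c j = 0
    · simp [hcj]
    · rw [coeff_smul, h2 i j hji (hmax j (by simp [hj, hcj])), smul_zero]
  · exact fun h => absurd hi.1 h

theorem coeff_paramMonomial (i j a b c i' j' a' b' c' : ℕ) :
    coeff (paramExponent i j a b c) (paramMonomial i' j' a' b' c') =
      if i' = i ∧ j' = j ∧ a' = a ∧ b' = b ∧ c' = c then 1 else 0 := by
  rw [paramMonomial_eq, coeff_monomial]
  congr 1
  simp [paramExponent]

theorem paramRes_mul_paramMonomial (i j a b c : ℕ) :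
    paramRes * paramMonomial i j a b c = paramMonomial i (j + 2) (a + 1) b c -
      (2 : ℂ) • paramMonomial (i + 1) (j + 1) a (b + 1) c +
      paramMonomial (i + 2) j a b (c + 1) := by
  simp only [paramRes, paramMonomial, smul_eq_C_mul, map_ofNat C]
  ring

/-! ### Counting -/

theorem card_piAntidiag_fin_three (n : ℕ) :
    (Finset.piAntidiag (Finset.univ : Finset (Fin 3)) n).card = (n + 2).choose 2 := by
  rw [card_piAntidiag_eq_choose, Finset.card_univ, Fintype.card_fin,
    show 3 + n - 1 = n + 2 by omega, ← Nat.choose_symm_add]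

theorem card_piAntidiag_fin_two (n : ℕ) :
    (Finset.piAntidiag (Finset.univ : Finset (Fin 2)) n).card = n + 1 := by
  rw [card_piAntidiag_eq_choose, Finset.card_univ, Fintype.card_fin,
    show 2 + n - 1 = n + 1 by omega, Nat.choose_succ_self_right]

theorem cast_choose_three (n : ℕ) : (n.choose 3 : ℚ) = n * (n - 1) * (n - 2) / 6 := by
  induction n with
  | zero => simp
  | succ n ih =>
    rw [Nat.choose_succ_succ' n 2, Nat.cast_add, ih, Nat.cast_choose_two]; push_cast; ring

theorem cast_choose_four (n : ℕ) : (n.choose 4 : ℚ) = n * (n - 1) * (n - 2) * (n - 3) / 24 := by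
  induction n with
  | zero => simp
  | succ n ih =>
    rw [Nat.choose_succ_succ' n 3, Nat.cast_add, ih, cast_choose_three]; push_cast; ring

theorem cast_choose_five (n : ℕ) :
    (n.choose 5 : ℚ) = n * (n - 1) * (n - 2) * (n - 3) * (n - 4) / 120 := by
  induction n with
  | zero => simp
  | succ n ih =>
    rw [Nat.choose_succ_succ' n 4, Nat.cast_add, ih, cast_choose_four]; push_cast; ring

/-- Keeping `N` and `m` independent lets induction run over `m` alone. The hypothesis prevents
truncation of `N - b`. -/
theorem sum_choose_mul_choose (N m : ℕ) (h : m ≤ N + 1) :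
    ((∑ b ∈ Finset.range m, (N - b + 2).choose 2 * (b + 2).choose 2 : ℕ) : ℚ) =
      ((N + 2) * (N + 1) * ((m + 2) * (m + 1) * m / 6) -
        (2 * N + 2) * ((m + 2) * (m + 1) * m * (m - 1) / 8) +
        (m + 2) * (m + 1) * m * (m - 1) * (m - 2) / 10) / 2 := by
  induction m with
  | zero => simp
  | succ m ih =>
    rw [Finset.sum_range_succ, Nat.cast_add, ih (by omega), Nat.cast_mul, Nat.cast_choose_two,
      Nat.cast_choose_two]
    push_cast [Nat.cast_sub (show m ≤ N by omega)]
    ring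

theorem sum_mul_choose (N m : ℕ) (h : m ≤ N + 1) :
    ((∑ b ∈ Finset.range m, (N - b + 1) * (b + 2).choose 2 : ℕ) : ℚ) =
      (N + 1) * ((m + 2) * (m + 1) * m / 6) - (m + 2) * (m + 1) * m * (m - 1) / 8 := by
  induction m with
  | zero => simp
  | succ m ih =>
    rw [Finset.sum_range_succ, Nat.cast_add, ih (by omega), Nat.cast_mul, Nat.cast_choose_two]
    push_cast [Nat.cast_sub (show m ≤ N by omega)]
    ring

/-- The crux of the lower bound: the independent elements are exactly as many as the expected
dimension plus the allowance for the three added spaces. -/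
theorem count_identity (n : ℕ) :
    (∑ b ∈ Finset.range (n + 2), (2 * n + 3 - b + 2).choose 2 * (b + 2).choose 2) +
      (∑ b ∈ Finset.range n, (2 * n + 1 - b + 1) * (b + 2).choose 2) +
      (n + 4).choose 2 * (n + 4).choose 2 =
    (n + 7).choose 5 + 4 * (n + 6).choose 5 + 10 * (n + 5).choose 5 + (n + 4).choose 5 +
      5 * (n + 3).choose 4 + (n + 2).choose 4 + (n + 3).choose 3 + 2 * (n + 4).choose 3 := by
  have h1 := sum_choose_mul_choose (2 * n + 3) (n + 2) (by omega)
  have h2 := sum_mul_choose (2 * n + 1) n (by omega)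
  rw [← Nat.cast_inj (R := ℚ), Nat.cast_add, Nat.cast_add, h1, h2]
  push_cast [cast_choose_three, cast_choose_four, cast_choose_five, Nat.cast_choose_two]
  ring

/-! ### The dimension of the space of forms: lower bound -/

/-- Indices of the monomials of low degree. -/
def lowIndex (n : ℕ) : Finset (Σ _ : ℕ, (Fin 3 → ℕ) × (Fin 3 → ℕ)) :=
  (Finset.range (n + 2)).sigma fun b =>
    Finset.piAntidiag Finset.univ (2 * n + 3 - b) ×ˢ Finset.piAntidiag Finset.univ b

/-- Indices of the multiples of the resultant. -/
def resIndex (n : ℕ) : Finset (Σ _ : ℕ, (Fin 2 → ℕ) × (Fin 3 → ℕ)) :=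
  (Finset.range n).sigma fun b =>
    Finset.piAntidiag Finset.univ (2 * n + 1 - b) ×ˢ Finset.piAntidiag Finset.univ b

/-- Indices of the monomials of high degree. -/
def highIndex (n : ℕ) : Finset ((Fin 3 → ℕ) × (Fin 3 → ℕ)) :=
  Finset.piAntidiag Finset.univ (n + 2) ×ˢ Finset.piAntidiag Finset.univ (n + 2)

theorem mem_lowIndex {n : ℕ} {p : Σ _ : ℕ, (Fin 3 → ℕ) × (Fin 3 → ℕ)} : p ∈ lowIndex n ↔
    p.1 < n + 2 ∧ p.2.1 0 + p.2.1 1 + p.2.1 2 = 2 * n + 3 - p.1 ∧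
      p.2.2 0 + p.2.2 1 + p.2.2 2 = p.1 := by
  simp [lowIndex, Fin.sum_univ_three]

theorem mem_resIndex {n : ℕ} {p : Σ _ : ℕ, (Fin 2 → ℕ) × (Fin 3 → ℕ)} : p ∈ resIndex n ↔
    p.1 < n ∧ p.2.1 0 + p.2.1 1 = 2 * n + 1 - p.1 ∧ p.2.2 0 + p.2.2 1 + p.2.2 2 = p.1 := by
  simp [resIndex, Fin.sum_univ_three]

theorem mem_highIndex {n : ℕ} {p : (Fin 3 → ℕ) × (Fin 3 → ℕ)} : p ∈ highIndex n ↔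
    p.1 0 + p.1 1 + p.1 2 = n + 2 ∧ p.2 0 + p.2 1 + p.2 2 = n + 2 := by
  simp [highIndex, Fin.sum_univ_three]

theorem card_index (n : ℕ) :
    (lowIndex n).card + (resIndex n).card + (highIndex n).card =
    (n + 7).choose 5 + 4 * (n + 6).choose 5 + 10 * (n + 5).choose 5 + (n + 4).choose 5 +
      5 * (n + 3).choose 4 + (n + 2).choose 4 + (n + 3).choose 3 + 2 * (n + 4).choose 3 := by
  rw [← count_identity]
  simp only [lowIndex, resIndex, highIndex, Finset.card_sigma, Finset.card_product,
    card_piAntidiag_fin_three, card_piAntidiag_fin_two]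

/-- A space that contains the forms of degree `n + 2` with small codimension. -/
def extForms (n : ℕ) : Submodule ℂ (MvPolynomial (Fin 5) ℂ) :=
  lowForms n ⊔ bilinForms (n + 1)

theorem finrank_sup_le (p q : Submodule ℂ (MvPolynomial (Fin 5) ℂ)) [Module.Finite ℂ p]
    [Module.Finite ℂ q] :
    Module.finrank ℂ (p ⊔ q : Submodule ℂ (MvPolynomial (Fin 5) ℂ)) ≤
      Module.finrank ℂ p + Module.finrank ℂ q :=
  Submodule.finrank_add_le_finrank_add_finrank p q

theorem extForms_eq (n : ℕ) : extForms n = ((momentForms (n + 2) ⊔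
    (cubicForms n).map (LinearMap.mulLeft ℂ paramRes)) ⊔
    (cubicForms (n + 1)).map (LinearMap.mulLeft ℂ (paramBilin 0))) ⊔
    (cubicForms (n + 1)).map (LinearMap.mulLeft ℂ (paramBilin 1)) := by
  rw [extForms, lowForms, bilinForms]
  apply le_antisymm
  · refine sup_le (le_sup_of_le_left le_sup_left) (sup_le ?_ (iSup_le fun l => ?_))
    · exact le_sup_of_le_left (le_sup_of_le_left le_sup_left)
    · fin_cases l
      · exact le_sup_of_le_left le_sup_right
      · exact le_sup_right
  · refine sup_le (sup_le le_sup_left ?_) ?_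
    · exact le_sup_of_le_right (le_sup_of_le_right (le_iSup (fun l => (cubicForms (n + 1)).map
        (LinearMap.mulLeft ℂ (paramBilin l))) 0))
    · exact le_sup_of_le_right (le_sup_of_le_right (le_iSup (fun l => (cubicForms (n + 1)).map
        (LinearMap.mulLeft ℂ (paramBilin l))) 1))

instance extForms_finite (n : ℕ) : Module.Finite ℂ (extForms n) := by
  rw [extForms_eq]; infer_instance

theorem finrank_extForms_le (n : ℕ) : Module.finrank ℂ (extForms n) ≤
    Module.finrank ℂ (momentForms (n + 2)) + (n + 3).choose 3 + 2 * (n + 4).choose 3 := by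
  rw [extForms_eq]
  have h (m : ℕ) (g : MvPolynomial (Fin 5) ℂ) :
      Module.finrank ℂ ((cubicForms m).map (LinearMap.mulLeft ℂ g)) ≤ (m + 3).choose 3 :=
    (Submodule.finrank_map_le _ _).trans (finrank_cubicForms_le m)
  refine (finrank_sup_le _ _).trans ?_
  refine (Nat.add_le_add_right (finrank_sup_le _ _) _).trans ?_
  refine (Nat.add_le_add_right (Nat.add_le_add_right (finrank_sup_le _ _) _) _).trans ?_
  have h1 := h n paramRes
  have h2 := h (n + 1) (paramBilin 0)
  have h3 := h (n + 1) (paramBilin 1)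
  rw [show n + 1 + 3 = n + 4 by omega] at h2 h3
  omega

theorem exists_sub_mem_quadDegreeLT (n : ℕ) (p : highIndex n) : ∃ g ∈ extForms n,
    paramMonomial (p.1.1 0) (p.1.1 1) (p.1.2 0) (p.1.2 1) (p.1.2 2) - g ∈ quadDegreeLT (n + 2) := by
  obtain ⟨h1, h2⟩ := mem_highIndex.mp p.2
  obtain ⟨g, hg, r, hr, h⟩ := Submodule.mem_sup.mp (paramMonomial_mem_highForms (n + 1)
    (p.1.1 0) (p.1.1 1) (p.1.2 0) (p.1.2 1) (p.1.2 2) (by omega) h2)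
  exact ⟨g, Submodule.mem_sup_right hg, by rw [← h, add_sub_cancel_left]; exact hr⟩

/-- The low monomials, the multiples of the resultant and lifts of the high monomials form a
triangular family in `extForms n`. The dimension allowed for the enlargement is then subtracted from
its size. -/
theorem le_finrank_momentForms_add_two (n : ℕ) :
    (n + 7).choose 5 + 4 * (n + 6).choose 5 + 10 * (n + 5).choose 5 + (n + 4).choose 5 +
      5 * (n + 3).choose 4 + (n + 2).choose 4 ≤ Module.finrank ℂ (momentForms (n + 2)) := by
  choose g hg hg' using exists_sub_mem_quadDegreeLT n
  let f : lowIndex n ⊕ resIndex n ⊕ highIndex n → MvPolynomial (Fin 5) ℂ :=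
    Sum.elim (fun p => paramMonomial (p.1.2.1 0) (p.1.2.1 1) (p.1.2.2 0) (p.1.2.2 1) (p.1.2.2 2))
      (Sum.elim (fun p => paramRes * paramMonomial (p.1.2.1 0) (p.1.2.1 1) (p.1.2.2 0)
        (p.1.2.2 1) (p.1.2.2 2)) g)
  -- The pivot of a multiple of R comes from the term y²a. Its total degree is 2n+4, beyond the low
  -- monomials. The pivot of a high element has (a, b, c)-degree n+2, beyond both other families.
  let e : lowIndex n ⊕ resIndex n ⊕ highIndex n → Fin 5 →₀ ℕ :=
    Sum.elim (fun p => paramExponent (p.1.2.1 0) (p.1.2.1 1) (p.1.2.2 0) (p.1.2.2 1) (p.1.2.2 2))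
      (Sum.elim (fun p => paramExponent (p.1.2.1 0) (p.1.2.1 1 + 2) (p.1.2.2 0 + 1)
        (p.1.2.2 1) (p.1.2.2 2))
      (fun p => paramExponent (p.1.1 0) (p.1.1 1) (p.1.2 0) (p.1.2 1) (p.1.2 2)))
  -- The terms of R have y-degrees 2, 1 and 0, so ordering its multiples by the exponent of y makes
  -- them triangular. That height is at most 2n+2, below the height of the high elements.
  let ht : lowIndex n ⊕ resIndex n ⊕ highIndex n → ℕ :=
    Sum.elim (fun _ => 0) (Sum.elim (fun p => p.1.2.1 1 + 1) (fun _ => 2 * n + 3))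
  have hgc (p : highIndex n) (i j a b c : ℕ) (h : n + 2 ≤ a + b + c) :
      coeff (paramExponent i j a b c) (g p) = coeff (paramExponent i j a b c)
        (paramMonomial (p.1.1 0) (p.1.1 1) (p.1.2 0) (p.1.2 1) (p.1.2 2)) := by
    have := hg' p (paramExponent i j a b c) (by simpa [paramExponent] using h)
    rw [coeff_sub, sub_eq_zero] at this
    exact this.symm
  have hli : LinearIndependent ℂ f := by
    refine linearIndependent_of_triangular f e ht ?_ ?_
    · rintro (⟨p, hp⟩ | ⟨p, hp⟩ | ⟨p, hp⟩)
      · simp [f, e, coeff_paramMonomial]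
      · simp [f, e, paramRes_mul_paramMonomial, coeff_paramMonomial]
      · have := mem_highIndex.mp hp
        simp [f, e, hgc ⟨p, hp⟩ _ _ _ _ _ this.2.ge, coeff_paramMonomial]
    · rintro (⟨p, hp⟩ | ⟨p, hp⟩ | ⟨p, hp⟩) (⟨q, hq⟩ | ⟨q, hq⟩ | ⟨q, hq⟩) hne hle
      · have h1 := mem_lowIndex.mp hp
        have h2 := mem_lowIndex.mp hq
        simp only [f, e, Sum.elim_inl, coeff_paramMonomial]
        rw [if_neg]
        rintro ⟨h3, h4, h5, h6, h7⟩
        refine hne ?_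
        obtain ⟨b, u, v⟩ := p
        obtain ⟨b', u', v'⟩ := q
        dsimp only at h1 h2 h3 h4 h5 h6 h7
        obtain rfl : b' = b := by omega
        have : u' = u := by funext l; fin_cases l <;> simp <;> omega
        have : v' = v := by funext l; fin_cases l <;> simp <;> omega
        subst_vars
        rfl
      · simp [ht] at hle
      · simp [ht] at hle
      · have h1 := mem_resIndex.mp hp
        have h2 := mem_lowIndex.mp hq
        simp only [f, e, Sum.elim_inl, Sum.elim_inr, coeff_paramMonomial]
        rw [if_neg]
        omega
      · have h1 := mem_resIndex.mp hp
        have h2 := mem_resIndex.mp hq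
        simp only [ht, Sum.elim_inl, Sum.elim_inr] at hle
        simp only [f, e, Sum.elim_inl, Sum.elim_inr, paramRes_mul_paramMonomial, coeff_add,
          coeff_sub, coeff_smul, coeff_paramMonomial]
        rw [if_neg, if_neg, if_neg]
        · simp
        · omega
        · omega
        rintro ⟨h3, h4, h5, h6, h7⟩
        refine hne ?_
        obtain ⟨b, u, v⟩ := p
        obtain ⟨b', u', v'⟩ := q
        dsimp only at h1 h2 h3 h4 h5 h6 h7
        obtain rfl : b' = b := by omega
        have : u' = u := by funext l; fin_cases l <;> simp <;> omega
        have : v' = v := by funext l; fin_cases l <;> simp <;> omega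
        subst_vars
        rfl
      · have h1 := mem_resIndex.mp hp
        simp only [ht, Sum.elim_inr, Sum.elim_inl] at hle
        omega
      · have h1 := mem_highIndex.mp hp
        have h2 := mem_lowIndex.mp hq
        simp only [f, e, Sum.elim_inl, Sum.elim_inr, coeff_paramMonomial]
        rw [if_neg]
        omega
      · have h1 := mem_highIndex.mp hp
        have h2 := mem_resIndex.mp hq
        simp only [f, e, Sum.elim_inl, Sum.elim_inr, paramRes_mul_paramMonomial, coeff_add,
          coeff_sub, coeff_smul, coeff_paramMonomial]
        rw [if_neg, if_neg, if_neg]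
        · simp
        all_goals omega
      · have h1 := mem_highIndex.mp hp
        have h2 := mem_highIndex.mp hq
        simp only [f, e, Sum.elim_inr, hgc ⟨q, hq⟩ _ _ _ _ _ h1.2.ge, coeff_paramMonomial]
        rw [if_neg]
        rintro ⟨h3, h4, h5, h6, h7⟩
        refine hne ?_
        obtain ⟨u, v⟩ := p
        obtain ⟨u', v'⟩ := q
        dsimp only at h1 h2 h3 h4 h5 h6 h7
        have : u' = u := by funext l; fin_cases l <;> simp <;> omega
        have : v' = v := by funext l; fin_cases l <;> simp <;> omega
        subst_vars
        rfl
  have hmem (i) : f i ∈ extForms n := by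
    rcases i with ⟨p, hp⟩ | ⟨p, hp⟩ | p
    · have h1 := mem_lowIndex.mp hp
      exact Submodule.mem_sup_left
        (paramMonomial_mem_lowForms n _ _ _ _ _ (by dsimp only; omega) (by dsimp only; omega))
    · have h1 := mem_resIndex.mp hp
      obtain ⟨n, rfl⟩ := Nat.exists_eq_add_of_le' (show 1 ≤ n by omega)
      exact Submodule.mem_sup_left
        (paramRes_mul_paramMonomial_mem_lowForms n _ _ _ _ _ (by dsimp only; omega)
          (by dsimp only; omega))
    · exact hg p
  have hli' : LinearIndependent ℂ fun i => (⟨f i, hmem i⟩ : extForms n) :=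
    LinearIndependent.of_comp (extForms n).subtype hli
  have h1 := hli'.fintype_card_le_finrank
  simp only [Fintype.card_sum, Fintype.card_coe] at h1
  have h2 := card_index n
  have h3 := finrank_extForms_le n
  omega

theorem momentForms_zero_le : 1 ≤ Module.finrank ℂ (momentForms 0) := by
  have : Nontrivial (momentForms 0) :=
    ⟨⟨⟨1, momentForms_zero_one⟩, 0, fun h => one_ne_zero (congrArg Subtype.val h)⟩⟩
  exact Module.finrank_pos

theorem momentForms_one_le : 10 ≤ Module.finrank ℂ (momentForms 1) := by
  let e : Fin 10 → Fin 5 →₀ ℕ := ![paramExponent 0 0 0 0 0, paramExponent 1 0 0 0 0,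
    paramExponent 0 1 0 0 0, paramExponent 0 0 1 0 0, paramExponent 0 0 0 1 0,
    paramExponent 0 0 0 0 1, paramExponent 1 0 1 0 0, paramExponent 1 0 0 1 0,
    paramExponent 1 0 0 0 1, paramExponent 0 1 0 0 1]
  let p : Fin 10 → MvPolynomial (Fin 5) ℂ := ![paramMonomial 0 0 0 0 0,
    (3 : ℂ) • paramMonomial 1 0 0 0 0, (3 : ℂ) • paramMonomial 0 1 0 0 0,
    paramMonomial 0 0 1 0 0 + (6 : ℂ) • paramMonomial 2 0 0 0 0,
    paramMonomial 0 0 0 1 0 + (6 : ℂ) • paramMonomial 1 1 0 0 0,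
    paramMonomial 0 0 0 0 1 + (6 : ℂ) • paramMonomial 0 2 0 0 0,
    (9 : ℂ) • paramMonomial 1 0 1 0 0,
    (6 : ℂ) • paramMonomial 1 0 0 1 0 + (3 : ℂ) • paramMonomial 0 1 1 0 0,
    (3 : ℂ) • paramMonomial 1 0 0 0 1 + (6 : ℂ) • paramMonomial 0 1 0 1 0,
    (9 : ℂ) • paramMonomial 0 1 0 0 1]
  have hp : p = momentPoly := by
    funext j
    fin_cases j <;> simp [p, momentPoly, paramMonomial, smul_eq_C_mul, map_ofNat C]
  have hli : LinearIndependent ℂ p := by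
    refine linearIndependent_of_triangular p e (fun _ => 0) ?_ ?_
    · intro i
      fin_cases i <;> simp [p, e, coeff_paramMonomial]
    · intro i j hij _
      fin_cases i <;> fin_cases j <;> first | exact absurd rfl hij | simp [p, e, coeff_paramMonomial]
  have hli' : LinearIndependent ℂ fun i => (⟨p i, by rw [hp]; exact momentPoly_mem i⟩ :
      momentForms 1) :=
    LinearIndependent.of_comp (momentForms 1).subtype hli
  simpa using hli'.fintype_card_le_finrank

/-- The enlargement argument starts in degree two; in degrees zero and one the bound evaluates to 1
and 10. -/
theorem le_finrank_momentForms (k : ℕ) :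
    (k + 5).choose 5 + 4 * (k + 4).choose 5 + 10 * (k + 3).choose 5 + (k + 2).choose 5 +
      5 * (k + 1).choose 4 + k.choose 4 ≤ Module.finrank ℂ (momentForms k) := by
  rcases k with - | - | k
  · exact momentForms_zero_le
  · exact momentForms_one_le
  · exact le_finrank_momentForms_add_two k

/-! ### The ideal of the moment variety is generated by the cubics and quartics -/

/-- The homomorphism that multiplies all variables by a new variable. -/
def scaleHom : MvPolynomial (MomentIndex 2 3) ℂ →ₐ[ℂ]
    Polynomial (MvPolynomial (MomentIndex 2 3) ℂ) :=
  aeval fun i => Polynomial.C (X i) * Polynomial.X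

theorem scaleHom_of_isHomogeneous {f : MvPolynomial (MomentIndex 2 3) ℂ} {k : ℕ}
    (hf : f.IsHomogeneous k) : scaleHom f = Polynomial.C f * Polynomial.X ^ k := by
  have h1 (d : MomentIndex 2 3 →₀ ℕ) (c : ℂ) : scaleHom (monomial d c) =
      Polynomial.C (monomial d c) * Polynomial.X ^ d.degree := by
    rw [scaleHom, aeval_monomial]
    simp only [Finsupp.prod, mul_pow, Finset.prod_mul_distrib, Finset.prod_pow_eq_pow_sum]
    rw [monomial_eq, map_mul, Finsupp.prod, map_prod, mul_assoc]
    simp only [map_pow, Finsupp.degree_apply]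
    rfl
  conv_lhs => rw [← support_sum_monomial_coeff f]
  rw [map_sum]
  conv_rhs => rw [← support_sum_monomial_coeff f]
  rw [map_sum, Finset.sum_mul]
  refine Finset.sum_congr rfl fun d hd => ?_
  rw [h1, ← hf (mem_support_iff.mp hd), Finsupp.degree_eq_weight_one]
  rfl

/-- Reduces the homogeneity of an explicit polynomial to an identity that `ring` can check. -/
theorem isHomogeneous_of_scaleHom {f : MvPolynomial (MomentIndex 2 3) ℂ} {k : ℕ}
    (hf : scaleHom f = Polynomial.C f * Polynomial.X ^ k) : f.IsHomogeneous k := by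
  have h : f = homogeneousComponent k f := by
    have h1 : (scaleHom f).coeff k = homogeneousComponent k f := by
      conv_lhs => rw [← sum_homogeneousComponent f]
      simp only [map_sum, scaleHom_of_isHomogeneous (homogeneousComponent_isHomogeneous _ f),
        Polynomial.finsetSum_coeff, Polynomial.coeff_C_mul, Polynomial.coeff_X_pow, mul_ite,
        mul_one, mul_zero, Finset.sum_ite_eq, Finset.mem_range]
      split_ifs with h
      · rfl
      · exact (homogeneousComponent_eq_zero _ _ (by omega)).symm
    rw [← h1, hf]
    simp
  rw [h]
  exact homogeneousComponent_isHomogeneous k f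

theorem scaleHom_momentVar (j : Fin 10) :
    scaleHom (momentVar j) = Polynomial.C (momentVar j) * Polynomial.X := by
  simp [scaleHom, momentVar]

theorem momentCubic_isHomogeneous (j : Fin 14) : (momentCubic j).IsHomogeneous 3 := by
  apply isHomogeneous_of_scaleHom
  obtain ⟨h0, h1, h2, h3, h4, h5, h6, h7, h8, h9⟩ := momentVar_eq
  fin_cases j <;>
  · simp [momentCubic, cumulantCubic30, cumulantCubic21, cumulantCubic12, cumulantCubic03, h0, h1,
      h2, h3, h4, h5, h6, h7, h8, h9, scaleHom_momentVar,
      map_ofNat scaleHom, map_ofNat Polynomial.C]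
    ring

theorem momentQuartic_isHomogeneous (j : Fin 4) : (momentQuartic j).IsHomogeneous 4 := by
  apply isHomogeneous_of_scaleHom
  obtain ⟨h0, h1, h2, h3, h4, h5, h6, h7, h8, h9⟩ := momentVar_eq
  fin_cases j <;>
  · simp [momentQuartic, h0, h1, h2, h3, h4, h5, h6, h7, h8, h9, scaleHom_momentVar,
      map_ofNat scaleHom, map_ofNat Polynomial.C]
    ring

theorem momentHom_momentCubic (j : Fin 14) : momentHom (momentCubic j) = 0 := by
  fin_cases j <;>
  · simp [momentCubic, cumulantCubic30, cumulantCubic21, cumulantCubic12, cumulantCubic03,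
      map_ofNat momentHom]
    ring

theorem momentHom_momentQuartic (j : Fin 4) : momentHom (momentQuartic j) = 0 := by
  fin_cases j <;>
  · simp [momentQuartic, map_ofNat momentHom]
    ring

theorem momentGenIdeal_le : momentGenIdeal ≤ momentIdeal := by
  rw [momentGenIdeal, Ideal.span_le]
  rintro f (⟨j, rfl⟩ | ⟨j, rfl⟩)
  · exact (mem_momentIdeal_of_isHomogeneous (momentCubic_isHomogeneous j)).mpr
      (momentHom_momentCubic j)
  · exact (mem_momentIdeal_of_isHomogeneous (momentQuartic_isHomogeneous j)).mpr
      (momentHom_momentQuartic j)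

theorem standardSpan_le (k : ℕ) :
    standardSpan k ≤ homogeneousSubmodule (MomentIndex 2 3) ℂ k := by
  refine Submodule.span_le.mpr ?_
  rintro f ⟨e, rfl, -, rfl⟩
  exact momentMonomial_isHomogeneous e

theorem momentHom_eq_zero_of_mem {f : MvPolynomial (MomentIndex 2 3) ℂ} {k : ℕ}
    (hf : f.IsHomogeneous k) (h : f ∈ momentGenIdeal) : momentHom f = 0 :=
  (mem_momentIdeal_of_isHomogeneous hf).mp (momentGenIdeal_le h)

theorem momentForms_eq_map (k : ℕ) :
    momentForms k = (standardSpan k).map momentHom.toLinearMap := by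
  refine le_antisymm ?_ (Submodule.map_mono (standardSpan_le k))
  rintro _ ⟨f, hf, rfl⟩
  obtain ⟨a, ha, s, hs, rfl⟩ := Submodule.mem_sup.mp (homogeneousSubmodule_le_sup k hf)
  have ha' : a.IsHomogeneous k := by
    have := sub_mem hf (standardSpan_le k hs)
    rwa [add_sub_cancel_right] at this
  refine ⟨s, hs, ?_⟩
  have h0 := momentHom_eq_zero_of_mem ha' ha
  simp [h0]

theorem finrank_momentForms (k : ℕ) : Module.finrank ℂ (momentForms k) =
    (k + 5).choose 5 + 4 * (k + 4).choose 5 + 10 * (k + 3).choose 5 + (k + 2).choose 5 +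
      5 * (k + 1).choose 4 + k.choose 4 := by
  refine le_antisymm ?_ (le_finrank_momentForms k)
  rw [momentForms_eq_map]
  exact (Submodule.finrank_map_le _ _).trans (finrank_standardSpan_le k)

/-- The two bounds meet here: the standard monomials span a space of dimension at most that of its
image, so the restriction of `momentHom` to it is injective. -/
theorem eq_zero_of_mem_standardSpan {k : ℕ} {f : MvPolynomial (MomentIndex 2 3) ℂ}
    (hf : f ∈ standardSpan k) (h : momentHom f = 0) : f = 0 := by
  let ψ := momentHom.toLinearMap.domRestrict (standardSpan k)
  have h1 := ψ.finrank_range_add_finrank_ker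
  rw [LinearMap.range_domRestrict, ← momentForms_eq_map] at h1
  have h2 := finrank_momentForms k
  have h3 := finrank_standardSpan_le k
  have h4 : LinearMap.ker ψ = ⊥ := Submodule.finrank_eq_zero.mp (by omega)
  have h5 : (⟨f, hf⟩ : standardSpan k) ∈ LinearMap.ker ψ := h
  rw [h4, Submodule.mem_bot] at h5
  exact congrArg Subtype.val h5

/-- Each component of an element of I is an element of J plus a combination of standard monomials
that `momentHom` kills, and the latter is zero. -/
theorem momentIdeal_eq : momentIdeal = momentGenIdeal := by
  refine le_antisymm (fun f hf => ?_) momentGenIdeal_le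
  rw [← sum_homogeneousComponent f]
  refine sum_mem fun k _ => ?_
  have h1 := mem_momentIdeal.mp hf k
  obtain ⟨a, ha, s, hs, h2⟩ := Submodule.mem_sup.mp
    (homogeneousSubmodule_le_sup k (homogeneousComponent_isHomogeneous k f))
  have ha' : a.IsHomogeneous k := by
    have := sub_mem ((mem_homogeneousSubmodule k _).mpr (homogeneousComponent_isHomogeneous k f))
      (standardSpan_le k hs)
    rwa [← h2, add_sub_cancel_right] at this
  rw [← h2, map_add, momentHom_eq_zero_of_mem ha' ha, zero_add] at h1
  rw [← h2, eq_zero_of_mem_standardSpan hs h1, add_zero]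
  exact ha

/-! ### Hilbert series and degree -/

theorem hilbertFunction_eq (k : ℕ) : hilbertFunction momentIdeal k =
    (k + 5).choose 5 + 4 * (k + 4).choose 5 + 10 * (k + 3).choose 5 + (k + 2).choose 5 +
      5 * (k + 1).choose 4 + k.choose 4 := by
  rw [hilbertFunction_momentIdeal, finrank_momentForms]

theorem hilbertSeries_eq : hilbertSeries momentIdeal =
    (1 + 4 * PowerSeries.X + 10 * PowerSeries.X ^ 2 + 6 * PowerSeries.X ^ 3
        - 4 * PowerSeries.X ^ 4 - PowerSeries.X ^ 5) * ((1 - PowerSeries.X) ^ 6)⁻¹ := by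
  have h1 : ((1 - PowerSeries.X : PowerSeries ℚ) ^ 6)⁻¹ =
      PowerSeries.mk fun n => ((5 + n).choose 5 : ℚ) := by
    rw [PowerSeries.inv_eq_iff_mul_eq_one (by simp), mul_comm]
    exact (PowerSeries.invOneSubPow ℚ 6).inv_val
  rw [h1]
  set F : PowerSeries ℚ := PowerSeries.mk fun n => ((5 + n).choose 5 : ℚ) with hF
  -- For k < d the upper entry is below five, so the binomial coefficient vanishes and one formula
  -- covers all k. The bound d ≤ 5 avoids truncation.
  have h2 (d : ℕ) (hd : d ≤ 5) (k : ℕ) :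
      PowerSeries.coeff k (PowerSeries.X ^ d * F) = ((k + 5 - d).choose 5 : ℚ) := by
    rw [PowerSeries.coeff_X_pow_mul']
    split_ifs with h
    · rw [hF, PowerSeries.coeff_mk]
      congr 2
      omega
    · rw [Nat.choose_eq_zero_of_lt (by omega), Nat.cast_zero]
  have h3 : (1 + 4 * PowerSeries.X + 10 * PowerSeries.X ^ 2 + 6 * PowerSeries.X ^ 3
      - 4 * PowerSeries.X ^ 4 - PowerSeries.X ^ 5) * F =
      PowerSeries.X ^ 0 * F + 4 • (PowerSeries.X ^ 1 * F) + 10 • (PowerSeries.X ^ 2 * F) +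
      6 • (PowerSeries.X ^ 3 * F) - 4 • (PowerSeries.X ^ 4 * F) - PowerSeries.X ^ 5 * F := by
    simp only [nsmul_eq_mul]; push_cast; ring
  rw [h3]
  ext k
  rw [hilbertSeries, PowerSeries.coeff_mk, hilbertFunction_eq]
  simp only [map_add, map_sub, map_nsmul, h2 0 (by norm_num), h2 1 (by norm_num),
    h2 2 (by norm_num), h2 3 (by norm_num), h2 4 (by norm_num), h2 5 (by norm_num)]
  simp only [show k + 5 - 0 = k + 5 by omega, show k + 5 - 1 = k + 4 by omega,
    show k + 5 - 2 = k + 3 by omega, show k + 5 - 3 = k + 2 by omega,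
    show k + 5 - 4 = k + 1 by omega, show k + 5 - 5 = k by omega]
  push_cast [cast_choose_five, cast_choose_four]
  ring

theorem hasProjectiveDegree_momentVariety : HasProjectiveDegree (gaussianMomentVariety 2 3) 16 := by
  -- The Hilbert function agrees with this polynomial for every k, and 5! · 2/15 = 16.
  refine ⟨Polynomial.C (2 / 15) * Polynomial.X ^ 5 + Polynomial.C (9 / 8) * Polynomial.X ^ 4 +
    Polynomial.C (19 / 12) * Polynomial.X ^ 3 + Polynomial.C (27 / 8) * Polynomial.X ^ 2 +
    Polynomial.C (167 / 60) * Polynomial.X + Polynomial.C 1, Filter.Eventually.of_forall fun k => ?_, ?_⟩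
  · rw [homogeneousIdealOf_eq, hilbertFunction_eq]
    push_cast [cast_choose_five, cast_choose_four]
    simp
    ring
  · rw [Polynomial.leadingCoeff]
    have : (Polynomial.C (2 / 15 : ℚ) * Polynomial.X ^ 5 + Polynomial.C (9 / 8) * Polynomial.X ^ 4 +
    Polynomial.C (19 / 12) * Polynomial.X ^ 3 + Polynomial.C (27 / 8) * Polynomial.X ^ 2 +
    Polynomial.C (167 / 60) * Polynomial.X + Polynomial.C 1).natDegree = 5 := by
      compute_degree!
    rw [this]
    simp [Polynomial.coeff_X, Polynomial.coeff_one]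
    norm_num [Nat.factorial]

/-! ### Minimality of the generators -/

/-- The polynomials with no monomial dividing `m` form an ideal, which contains `T` but not `g`. -/
theorem not_mem_span_of_coeff {σ : Type} {T : Set (MvPolynomial σ ℂ)} {g : MvPolynomial σ ℂ}
    {m : σ →₀ ℕ} (hg : coeff m g ≠ 0) (hT : ∀ f ∈ T, ∀ d ≤ m, coeff d f = 0) :
    g ∉ Ideal.span T := by
  classical
  intro h
  suffices ∀ d ≤ m, coeff d g = 0 from hg (this m le_rfl)
  clear hg
  induction h using Submodule.span_induction with
  | mem f hf => exact hT f hf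
  | zero => simp
  | add f g _ _ hf' hg' => intro d hd; rw [coeff_add, hf' d hd, hg' d hd, add_zero]
  | smul a f _ hf' =>
    intro d hd
    rw [smul_eq_mul, coeff_mul]
    refine Finset.sum_eq_zero fun p hp => ?_
    rw [Finset.HasAntidiagonal.mem_antidiagonal] at hp
    rw [hf' p.2 ((hp ▸ le_add_self : p.2 ≤ d).trans hd), mul_zero]

/-- The exponent of a monomial in the ten coordinates, indexed by the pairs. -/
def momentExponent (e : Fin 10 → ℕ) : MomentIndex 2 3 →₀ ℕ :=
  Finsupp.equivFunOnFinite.symm fun i => e (momentEquiv.symm i)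

theorem momentExponent_le {d e : Fin 10 → ℕ} : momentExponent d ≤ momentExponent e ↔ d ≤ e := by
  constructor
  · intro h j
    simpa [momentExponent] using h (momentEquiv j)
  · exact fun h i => h _

theorem coeff_momentMonomial_of_not_le {e e' : Fin 10 → ℕ} (h : ¬ e' ≤ e)
    {d : MomentIndex 2 3 →₀ ℕ} (hd : d ≤ momentExponent e) : coeff d (momentMonomial e') = 0 := by
  classical
  rw [momentMonomial_eq, coeff_monomial, if_neg]
  rintro rfl
  exact h (momentExponent_le.mp hd)

theorem coeff_leadTail_eq_zero {i : Fin 20} {e : Fin 10 → ℕ} (h : ∀ p ∈ leadTail i, ¬ p.2 ≤ e)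
    {d : MomentIndex 2 3 →₀ ℕ} (hd : d ≤ momentExponent e) :
    coeff d ((leadTail i).map fun p => p.1 • momentMonomial p.2).sum = 0 := by
  rw [← lcoeff_apply (R := ℂ), map_list_sum, List.map_map]
  refine List.sum_eq_zero fun c hc => ?_
  obtain ⟨p, hp, rfl⟩ := List.mem_map.mp hc
  rw [Function.comp_apply, lcoeff_apply, coeff_smul,
    coeff_momentMonomial_of_not_le (h p hp) hd, smul_zero]

/-- The generators of the ideal. -/
def momentGen : Fin 14 ⊕ Fin 4 → MvPolynomial (MomentIndex 2 3) ℂ :=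
  Sum.elim momentCubic momentQuartic

/-- The position of the generators among the polynomials with given leading monomials. -/
def genIndex : Fin 14 ⊕ Fin 4 → Fin 20 := Sum.elim (Fin.castLE (by norm_num)) (Fin.natAdd 16)

/-- Together with the next check on tails, this says that a monomial of any generator divides the
leading monomial of a generator only if it is that leading monomial itself. -/
theorem exists_lt_leadExponent : ∀ i j, i ≠ j →
    ∃ l, leadExponent (genIndex j) l < leadExponent (genIndex i) l := by
  decide

theorem exists_lt_leadTail : ∀ i j, ∀ p ∈ leadTail (genIndex i),
    ∃ l, leadExponent (genIndex j) l < p.2 l := by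
  decide

theorem leadExponent_genIndex_not_le (i j : Fin 14 ⊕ Fin 4) (h : i ≠ j) :
    ¬ leadExponent (genIndex i) ≤ leadExponent (genIndex j) := fun h' =>
  let ⟨l, hl⟩ := exists_lt_leadExponent i j h
  (h' l).not_gt hl

theorem leadTail_genIndex_not_le (i j : Fin 14 ⊕ Fin 4) : ∀ p ∈ leadTail (genIndex i),
    ¬ p.2 ≤ leadExponent (genIndex j) := fun p hp h' =>
  let ⟨l, hl⟩ := exists_lt_leadTail i j p hp
  (h' l).not_gt hl

theorem leadSign_mul_self : ∀ j, leadSign j * leadSign j = 1 := by decide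

theorem momentGen_eq (i : Fin 14 ⊕ Fin 4) :
    ∃ c : ℤ, c ≠ 0 ∧ momentGen i = c • leadPoly (genIndex i) := by
  rcases i with j | j
  · have h := leadSign_mul_self j
    refine ⟨leadSign j, fun h0 => by simp [h0] at h, ?_⟩
    rw [genIndex, Sum.elim_inl, leadPoly_castLE, smul_smul, h, one_smul]
    rfl
  · exact ⟨1, one_ne_zero, by rw [genIndex, Sum.elim_inr, leadPoly_natAdd, one_smul]; rfl⟩

theorem coeff_momentGen_eq_zero {i j : Fin 14 ⊕ Fin 4} (h : i ≠ j) {d : MomentIndex 2 3 →₀ ℕ}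
    (hd : d ≤ momentExponent (leadExponent (genIndex j))) : coeff d (momentGen i) = 0 := by
  obtain ⟨c, -, hc⟩ := momentGen_eq i
  rw [hc, coeff_smul, leadPoly, coeff_sub,
    coeff_momentMonomial_of_not_le (leadExponent_genIndex_not_le i j h) hd,
    coeff_leadTail_eq_zero (leadTail_genIndex_not_le i j) hd, sub_zero, smul_zero]

theorem coeff_momentGen_self (i : Fin 14 ⊕ Fin 4) :
    coeff (momentExponent (leadExponent (genIndex i))) (momentGen i) ≠ 0 := by
  classical
  obtain ⟨c, h0, hc⟩ := momentGen_eq i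
  rw [hc, coeff_smul, leadPoly, coeff_sub,
    coeff_leadTail_eq_zero (leadTail_genIndex_not_le i i) le_rfl, momentMonomial_eq, sub_zero,
    coeff_monomial, momentExponent, if_pos rfl]
  simpa using h0

theorem momentGen_injective : Function.Injective momentGen := by
  intro i j h
  by_contra hne
  exact coeff_momentGen_self j (h ▸ coeff_momentGen_eq_zero hne le_rfl)

theorem range_momentGen : Set.range momentGen = Set.range momentCubic ∪ Set.range momentQuartic :=
  Set.Sum.elim_range _ _

theorem isMinimalGeneratingSet_momentGen :
    IsMinimalGeneratingSet momentIdeal (Set.range momentCubic ∪ Set.range momentQuartic) := by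
  refine ⟨momentIdeal_eq.symm, fun T hT h => ?_⟩
  rw [← range_momentGen] at hT
  obtain ⟨hTG, g, ⟨i, rfl⟩, hgT⟩ := Set.ssubset_iff_exists.mp hT
  refine not_mem_span_of_coeff (coeff_momentGen_self i) (T := T) (fun f hf d hd => ?_) ?_
  · obtain ⟨j, rfl⟩ := hTG hf
    exact coeff_momentGen_eq_zero (by rintro rfl; exact hgT hf) hd
  · rw [h, momentIdeal_eq]
    refine Ideal.subset_span ?_
    rw [← range_momentGen]
    exact ⟨i, rfl⟩

theorem exists_minimal_generators :
    ∃ C Q : Finset (MvPolynomial (MomentIndex 2 3) ℂ),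
      C.card = 14 ∧ Q.card = 4 ∧
      (∀ f ∈ C, f.IsHomogeneous 3) ∧ (∀ f ∈ Q, f.IsHomogeneous 4) ∧
      {cumulantCubic30, cumulantCubic21, cumulantCubic12, cumulantCubic03} ⊆
        (C : Set (MvPolynomial (MomentIndex 2 3) ℂ)) ∧
      IsMinimalGeneratingSet momentIdeal ((C : Set (MvPolynomial (MomentIndex 2 3) ℂ)) ∪ Q) := by
  classical
  have hC : Function.Injective momentCubic := fun i j h =>
    Sum.inl_injective (momentGen_injective (a₁ := Sum.inl i) (a₂ := Sum.inl j) h)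
  have hQ : Function.Injective momentQuartic := fun i j h =>
    Sum.inr_injective (momentGen_injective (a₁ := Sum.inr i) (a₂ := Sum.inr j) h)
  refine ⟨Finset.univ.image momentCubic, Finset.univ.image momentQuartic, ?_, ?_, ?_, ?_, ?_, ?_⟩
  · rw [Finset.card_image_of_injective _ hC]; simp
  · rw [Finset.card_image_of_injective _ hQ]; simp
  · intro f hf
    obtain ⟨j, -, rfl⟩ := Finset.mem_image.mp hf
    exact momentCubic_isHomogeneous j
  · intro f hf
    obtain ⟨j, -, rfl⟩ := Finset.mem_image.mp hf
    exact momentQuartic_isHomogeneous j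
  · have h (j : Fin 14) : momentCubic j ∈ ((Finset.univ.image momentCubic : Finset _) :
        Set (MvPolynomial (MomentIndex 2 3) ℂ)) := by simp
    rintro f (rfl | rfl | rfl | rfl)
    exacts [h 0, h 1, h 2, h 3]
  · simpa using isMinimalGeneratingSet_momentGen

/-! ### The saturation -/

/-- The colon ideals increase with the exponent, so membership in their supremum is membership in
one of them. -/
theorem mem_idealSaturation_span_singleton {R : Type} [CommRing R] {J : Ideal R} {z f : R} :
    f ∈ idealSaturation J (Ideal.span {z}) ↔ ∃ N : ℕ, z ^ N * f ∈ J := by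
  have hmem (N : ℕ) : f ∈ J.colon ((Ideal.span {z} ^ N : Ideal R) : Set R) ↔ z ^ N * f ∈ J := by
    rw [Ideal.span_singleton_pow, Submodule.mem_colon]
    constructor
    · intro h
      rw [mul_comm]
      exact h _ (Ideal.mem_span_singleton_self _)
    · intro h p hp
      obtain ⟨a, rfl⟩ := Ideal.mem_span_singleton'.mp hp
      rw [smul_eq_mul, mul_comm, mul_assoc]
      exact Ideal.mul_mem_left _ a h
  rw [idealSaturation, Submodule.mem_iSup_of_directed]
  · simp only [hmem]
  · refine Monotone.directed_le fun a b hab => ?_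
    exact Submodule.colon_mono le_rfl (Ideal.pow_le_pow_right hab)

/-- The first six coordinates. -/
def lowVar (j : Fin 6) : MomentIndex 2 3 := momentEquiv (j.castLE (by norm_num))

/-- The cone projects onto all points of the six-dimensional space with nonzero first coordinate:
one rescales and solves for the parameters. The factor `X 0` covers the remaining points. -/
theorem eq_zero_of_rename_lowVar_mem {h : MvPolynomial (Fin 6) ℂ}
    (hh : rename lowVar h ∈ momentIdeal) : h = 0 := by
  have hX : h * X 0 = 0 := by
    refine MvPolynomial.funext fun w => ?_
    rw [map_mul, eval_X, map_zero]
    by_cases hw : w 0 = 0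
    · rw [hw, mul_zero]
    let u : Fin 5 → ℂ := ![w 1 / (3 * w 0), w 2 / (3 * w 0),
      w 3 / w 0 - 6 * (w 1 / (3 * w 0)) ^ 2,
      w 4 / w 0 - 6 * (w 1 / (3 * w 0) * (w 2 / (3 * w 0))),
      w 5 / w 0 - 6 * (w 2 / (3 * w 0)) ^ 2]
    have h1 : eval (w 0 • momentPoint u) (rename lowVar h) = 0 := by
      rw [sum_homogeneousComponent_smul]
      refine Finset.sum_eq_zero fun k _ => ?_
      rw [eval_momentPoint, mem_momentIdeal.mp hh k, map_zero, mul_zero]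
    have h2 : (w 0 • momentPoint u) ∘ lowVar = w := by
      funext j
      fin_cases j <;> simp [momentPoint, lowVar, momentPoly, u] <;> field_simp
    rw [eval_rename, h2] at h1
    rw [h1, zero_mul]
  exact (mul_eq_zero.mp hX).resolve_right (X_ne_zero 0)

/-- The ideal generated by the cumulants of order three. -/
def cumulantIdeal : Ideal (MvPolynomial (MomentIndex 2 3) ℂ) :=
  Ideal.span {cumulantCubic30, cumulantCubic21, cumulantCubic12, cumulantCubic03}

/-- Each cumulant cubic is m₀₀² times a third-order moment plus a polynomial in the moments of order
at most two. -/
theorem exists_mul_momentVar_sub_mem (j : Fin 10) : ∃ h : MvPolynomial (Fin 6) ℂ,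
    m00 ^ 2 * momentVar j - rename lowVar h ∈ cumulantIdeal := by
  have hc {f : MvPolynomial (MomentIndex 2 3) ℂ} (hf : f ∈ ({cumulantCubic30, cumulantCubic21,
      cumulantCubic12, cumulantCubic03} : Set (MvPolynomial (MomentIndex 2 3) ℂ)))
      (h g : MvPolynomial (MomentIndex 2 3) ℂ) (hg : h - g = f) : h - g ∈ cumulantIdeal :=
    hg ▸ Ideal.subset_span hf
  have hlow (j : Fin 6) : rename lowVar (X j : MvPolynomial (Fin 6) ℂ) =
      momentVar (j.castLE (by norm_num)) := rename_X _ _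
  have h0 : rename lowVar (X 0 : MvPolynomial (Fin 6) ℂ) = m00 := hlow 0
  have h1 : rename lowVar (X 1 : MvPolynomial (Fin 6) ℂ) = m10 := hlow 1
  have h2 : rename lowVar (X 2 : MvPolynomial (Fin 6) ℂ) = m01 := hlow 2
  have h3 : rename lowVar (X 3 : MvPolynomial (Fin 6) ℂ) = m20 := hlow 3
  have h4 : rename lowVar (X 4 : MvPolynomial (Fin 6) ℂ) = m11 := hlow 4
  have h5 : rename lowVar (X 5 : MvPolynomial (Fin 6) ℂ) = m02 := hlow 5
  by_cases hj : j < 6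
  · refine ⟨X 0 ^ 2 * X ⟨j, hj⟩, ?_⟩
    have : (⟨j, hj⟩ : Fin 6).castLE (by norm_num) = j := rfl
    rw [map_mul, map_pow, h0, hlow, this, sub_self]
    exact zero_mem _
  obtain rfl | rfl | rfl | rfl : j = 6 ∨ j = 7 ∨ j = 8 ∨ j = 9 := by omega
  · refine ⟨3 * X 0 * X 1 * X 3 - 2 * X 1 ^ 3, hc (f := cumulantCubic30) (by simp) _ _ ?_⟩
    simp only [map_sub, map_mul, map_pow, h0, h1, h3, map_ofNat]
    rw [cumulantCubic30, ← momentVar_eq.2.2.2.2.2.2.1]; ring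
  · refine ⟨2 * X 0 * X 1 * X 4 + X 0 * X 2 * X 3 - 2 * X 2 * X 1 ^ 2, hc (f := cumulantCubic21) (by simp) _ _ ?_⟩
    simp only [map_sub, map_add, map_mul, map_pow, h0, h1, h2, h3, h4, map_ofNat]
    rw [cumulantCubic21, ← momentVar_eq.2.2.2.2.2.2.2.1]; ring
  · refine ⟨2 * X 0 * X 2 * X 4 + X 0 * X 1 * X 5 - 2 * X 1 * X 2 ^ 2, hc (f := cumulantCubic12) (by simp) _ _ ?_⟩
    simp only [map_sub, map_add, map_mul, map_pow, h0, h1, h2, h5, h4, map_ofNat]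
    rw [cumulantCubic12, ← momentVar_eq.2.2.2.2.2.2.2.2.1]; ring
  · refine ⟨3 * X 0 * X 2 * X 5 - 2 * X 2 ^ 3, hc (f := cumulantCubic03) (by simp) _ _ ?_⟩
    simp only [map_sub, map_mul, map_pow, h0, h2, h5, map_ofNat]
    rw [cumulantCubic03, ← momentVar_eq.2.2.2.2.2.2.2.2.2]; ring

theorem exists_pow_mul_sub_mem (f : MvPolynomial (MomentIndex 2 3) ℂ) :
    ∃ (N : ℕ) (h : MvPolynomial (Fin 6) ℂ), m00 ^ N * f - rename lowVar h ∈ cumulantIdeal := by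
  have h0 : rename lowVar (X 0 : MvPolynomial (Fin 6) ℂ) = m00 := rename_X _ _
  induction f using MvPolynomial.induction_on with
  | C a => exact ⟨0, C a, by simp⟩
  | add p q hp hq =>
    obtain ⟨N, g, hg⟩ := hp
    obtain ⟨M, h, hh⟩ := hq
    refine ⟨N + M, X 0 ^ M * g + X 0 ^ N * h, ?_⟩
    convert add_mem (Ideal.mul_mem_left _ (m00 ^ M) hg) (Ideal.mul_mem_left _ (m00 ^ N) hh) using 1
    simp only [map_add, map_mul, map_pow, h0]
    ring
  | mul_X p i hp =>
    obtain ⟨N, g, hg⟩ := hp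
    obtain ⟨h, hh⟩ := exists_mul_momentVar_sub_mem (momentEquiv.symm i)
    have hi : momentVar (momentEquiv.symm i) = X i := by simp [momentVar]
    rw [hi] at hh
    refine ⟨N + 2, g * h, ?_⟩
    convert add_mem (Ideal.mul_mem_left _ (m00 ^ 2 * X i) hg)
      (Ideal.mul_mem_left _ (rename lowVar g) hh) using 1
    simp only [map_mul]
    ring

theorem cumulantIdeal_le : cumulantIdeal ≤ momentIdeal := by
  rw [cumulantIdeal, Ideal.span_le, momentIdeal_eq]
  rintro f (rfl | rfl | rfl | rfl)
  exacts [momentCubic_mem 0, momentCubic_mem 1, momentCubic_mem 2, momentCubic_mem 3]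

theorem m00_notMem_momentIdeal : m00 ∉ momentIdeal := by
  rw [mem_momentIdeal_of_isHomogeneous (k := 1) (f := m00) (isHomogeneous_X _ _),
    momentHom_m00]
  exact one_ne_zero

/-- For f in I, some m₀₀^N f is congruent to a polynomial in the six lower coordinates, which lies
in I and hence is zero. Conversely, I is prime and does not contain m₀₀. -/
theorem momentIdeal_eq_saturation :
    momentIdeal = idealSaturation cumulantIdeal (Ideal.span {m00}) := by
  ext f
  rw [mem_idealSaturation_span_singleton]
  constructor
  · intro hf
    obtain ⟨N, h, hh⟩ := exists_pow_mul_sub_mem f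
    have h1 : rename lowVar h ∈ momentIdeal := by
      have := sub_mem (Ideal.mul_mem_left _ (m00 ^ N) hf) (cumulantIdeal_le hh)
      rwa [sub_sub_cancel] at this
    rw [eq_zero_of_rename_lowVar_mem h1, map_zero, sub_zero] at hh
    exact ⟨N, hh⟩
  · rintro ⟨N, hN⟩
    exact (momentIdeal_isPrime.mem_or_mem (cumulantIdeal_le hN)).resolve_left
      fun h => m00_notMem_momentIdeal (momentIdeal_isPrime.mem_of_pow_mem N h)

/-! ### Transcendence degrees -/

/-- Otherwise a transcendence basis of `B` lifts to one of `A`. A nonzero element of the kernel is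
algebraic over the subalgebra it generates, so the kernel meets this subalgebra nontrivially,
although π is injective there. -/
theorem trdeg_lt_of_surjective {A B : Type} [CommRing A] [IsDomain A] [CommRing B] [IsDomain B]
    [Algebra ℂ A] [Algebra ℂ B] (hB : Algebra.trdeg ℂ A < Cardinal.aleph0) (π : A →ₐ[ℂ] B)
    (hs : Function.Surjective π) (hi : ¬ Function.Injective π) :
    Algebra.trdeg ℂ B < Algebra.trdeg ℂ A := by
  by_contra! hle
  obtain ⟨ι, x, hx⟩ := exists_isTranscendenceBasis' ℂ B
  choose y hy using fun i => hs (x i)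
  have hxy : π ∘ y = x := funext hy
  have hy' : AlgebraicIndependent ℂ y := by
    refine AlgebraicIndependent.of_comp π ?_
    rw [hxy]
    exact hx.1
  have hyb : IsTranscendenceBasis ℂ y :=
    hy'.isTranscendenceBasis_of_trdeg_le hB (by rw [hx.cardinalMk_eq_trdeg]; exact hle)
  have halg := hyb.isAlgebraic
  obtain ⟨b, hb, hb0⟩ : ∃ b, π b = 0 ∧ b ≠ 0 := by
    by_contra! h
    exact hi ((injective_iff_map_eq_zero π).mpr h)
  have hne := Ideal.comap_ne_bot_of_algebraic_mem (R := Algebra.adjoin ℂ (Set.range y))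
    (I := RingHom.ker π) hb0 hb (halg.isAlgebraic b)
  refine hne ((Submodule.eq_bot_iff _).mpr fun c hc => ?_)
  have hc' : π c = 0 := hc
  obtain ⟨p, hp⟩ : ∃ p, aeval y p = (c : A) := by
    exact (Algebra.adjoin_range_eq_range_aeval ℂ y).le c.2
  have hp0 : p = 0 := by
    refine hx.1.eq_zero_of_aeval_eq_zero p ?_
    rw [← hxy, ← hc', ← hp, ← AlgHom.comp_apply, comp_aeval]
    rfl
  apply Subtype.ext
  rw [← hp, hp0, map_zero]
  rfl

/-- The dimension of the affine variety of a prime ideal. -/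
def coordDim (P : Ideal (MvPolynomial (MomentIndex 2 3) ℂ)) : Cardinal :=
  Algebra.trdeg ℂ (MvPolynomial (MomentIndex 2 3) ℂ ⧸ P)

theorem coordDim_le_of_le {P Q : Ideal (MvPolynomial (MomentIndex 2 3) ℂ)} (h : P ≤ Q) :
    coordDim Q ≤ coordDim P :=
  trdeg_le_of_surjective (Ideal.Quotient.factorₐ ℂ h) (Ideal.Quotient.factor_surjective h)

theorem coordDim_lt_aleph0 (P : Ideal (MvPolynomial (MomentIndex 2 3) ℂ)) :
    coordDim P < Cardinal.aleph0 := by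
  refine (trdeg_le_of_surjective (Ideal.Quotient.mkₐ ℂ P)
    Ideal.Quotient.mk_surjective).trans_lt ?_
  rw [MvPolynomial.trdeg_of_isDomain]
  have : Finite (MomentIndex 2 3) := Finite.of_equiv _ momentEquiv
  simp

theorem coordDim_lt_of_lt {P Q : Ideal (MvPolynomial (MomentIndex 2 3) ℂ)} [P.IsPrime] [Q.IsPrime]
    (h : P < Q) : coordDim Q < coordDim P := by
  refine trdeg_lt_of_surjective (coordDim_lt_aleph0 P) (Ideal.Quotient.factorₐ ℂ h.le)
    (Ideal.Quotient.factor_surjective h.le) fun hi => ?_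
  obtain ⟨f, hf, hf'⟩ := SetLike.exists_of_lt h
  refine hf' (Ideal.Quotient.eq_zero_iff_mem.mp (hi ?_))
  rw [map_zero]
  exact Ideal.Quotient.eq_zero_iff_mem.mpr hf

/-- The coordinate ring of the cone embeds into a polynomial ring in 5 + 1 variables. -/
theorem coordDim_momentIdeal_le : coordDim momentIdeal ≤ 6 := by
  have h := trdeg_le_of_injective (Ideal.kerLiftAlg momentConeHom)
    (Ideal.kerLiftAlg_injective momentConeHom)
  refine h.trans ?_
  rw [← trdeg_add_eq ℂ (MvPolynomial (Fin 5) ℂ), Polynomial.trdeg_of_isDomain,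
    MvPolynomial.trdeg_of_isDomain]
  norm_num

/-! ### Irreducible subsets of projective space -/

theorem ProjSpace.isTopologicalBasis (σ : Type) [Nonempty σ] :
    TopologicalSpace.IsTopologicalBasis {U : Set (ProjSpace σ) | ∃ (f : MvPolynomial σ ℂ) (k : ℕ),
      f.IsHomogeneous k ∧ U = ProjSpace.basicOpen f} := by
  refine ⟨?_, ?_, rfl⟩
  · rintro _ ⟨f, k, hf, rfl⟩ _ ⟨g, l, hg, rfl⟩ x hx
    obtain ⟨⟨v, hv, rfl, h1⟩, h2⟩ := hx
    rw [ProjSpace.mk_mem_basicOpen hg] at h2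
    refine ⟨_, ⟨f * g, k + l, hf.mul hg, rfl⟩, ⟨v, hv, rfl, ?_⟩, ?_⟩
    · rw [map_mul]; exact mul_ne_zero h1 h2
    · rintro _ ⟨w, hw, rfl, h⟩
      rw [map_mul] at h
      exact ⟨⟨w, hw, rfl, left_ne_zero_of_mul h⟩, ⟨w, hw, rfl, right_ne_zero_of_mul h⟩⟩
  · refine Set.eq_univ_of_forall fun x => ?_
    refine ⟨_, ⟨1, 0, isHomogeneous_one _ _, rfl⟩, ?_⟩
    induction x using Projectivization.ind with
    | h v hv => exact ⟨v, hv, rfl, by simp⟩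

theorem mem_homogeneousIdealOf_iff {σ : Type} {Z : Set (ProjSpace σ)} (hZ : IsClosed Z)
    {f : MvPolynomial σ ℂ} : f ∈ homogeneousIdealOf Z ↔ ∀ k, ∀ x ∈ Z,
      x ∉ ProjSpace.basicOpen (homogeneousComponent k f) := by
  have h := mem_homogeneousIdealOf_closure_iff Z f
  rw [hZ.closure_eq] at h
  rw [h]
  constructor
  · rintro h k _ hx ⟨v, hv, rfl, hne⟩
    exact hne (h k v hv hx)
  · intro h k v hv hx
    by_contra hne
    exact h k _ hx ⟨v, hv, rfl, hne⟩

theorem homogeneousIdealOf_anti {σ : Type} {Z W : Set (ProjSpace σ)} (h : Z ⊆ W) :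
    homogeneousIdealOf W ≤ homogeneousIdealOf Z :=
  vanishingIdeal_anti_mono fun _ ⟨hv, hZ⟩ => ⟨hv, h hZ⟩

/-- The restriction of a polynomial to the line through the origin and a given point. -/
def lineHom {σ : Type} (v : σ → ℂ) : MvPolynomial σ ℂ →ₐ[ℂ] Polynomial ℂ :=
  aeval fun i => Polynomial.C (v i) * Polynomial.X

theorem coeff_lineHom {σ : Type} (v : σ → ℂ) (f : MvPolynomial σ ℂ) (k : ℕ) :
    (lineHom v f).coeff k = eval v (homogeneousComponent k f) := by
  induction f using MvPolynomial.induction_on' with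
  | add p q hp hq => simp [hp, hq]
  | monomial d c =>
    have h1 : lineHom v (monomial d c) =
        Polynomial.C (eval v (monomial d c)) * Polynomial.X ^ d.degree := by
      rw [lineHom, aeval_monomial, eval_monomial, map_mul]
      simp only [Finsupp.prod, mul_pow, Finset.prod_mul_distrib, Finset.prod_pow_eq_pow_sum,
        Finsupp.degree_apply, map_prod, map_pow]
      rw [mul_assoc]
      rfl
    rw [h1, Polynomial.coeff_C_mul_X_pow]
    have h2 : monomial d c ∈ homogeneousSubmodule σ ℂ d.degree :=
      isHomogeneous_monomial c rfl
    rw [homogeneousComponent_of_mem h2]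
    split_ifs <;> simp

/-- Given f and g outside the ideal, irreducibility yields one point at which some component of each
is nonzero. Restricted to the line through this point both are nonzero polynomials in one variable,
while their product would be zero. -/
theorem isPrime_homogeneousIdealOf {σ : Type} {Z : Set (ProjSpace σ)} (hZ : IsClosed Z)
    (hZ' : IsIrreducible Z) : (homogeneousIdealOf Z).IsPrime := by
  have hex {f : MvPolynomial σ ℂ} (hf : f ∉ homogeneousIdealOf Z) :
      ∃ k, (Z ∩ ProjSpace.basicOpen (homogeneousComponent k f)).Nonempty := by
    rw [mem_homogeneousIdealOf_iff hZ] at hf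
    push Not at hf
    obtain ⟨k, x, hx, hxf⟩ := hf
    exact ⟨k, x, hx, hxf⟩
  refine Ideal.isPrime_iff.mpr ⟨fun h => ?_, fun {f g} hfg => ?_⟩
  · obtain ⟨x, hx⟩ := hZ'.1
    have h1 : (1 : MvPolynomial σ ℂ) ∈ homogeneousIdealOf Z := h ▸ Submodule.mem_top
    rw [mem_homogeneousIdealOf_iff hZ] at h1
    refine h1 0 x hx ?_
    induction x using Projectivization.ind with
    | h v hv => exact ⟨v, hv, rfl, by simp [homogeneousComponent_zero]⟩
  · by_contra! hne
    obtain ⟨k, hk⟩ := hex hne.1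
    obtain ⟨l, hl⟩ := hex hne.2
    have hfk := homogeneousComponent_isHomogeneous k f
    have hgl := homogeneousComponent_isHomogeneous l g
    obtain ⟨x, hx, ⟨v, hv, rfl, h1⟩, h2⟩ := hZ'.2 _ _ (ProjSpace.isOpen_basicOpen hfk)
      (ProjSpace.isOpen_basicOpen hgl) hk hl
    rw [ProjSpace.mk_mem_basicOpen hgl] at h2
    have h3 : lineHom v f * lineHom v g = 0 := by
      rw [← map_mul]
      ext j
      rw [coeff_lineHom, Polynomial.coeff_zero]
      by_contra h4
      exact (mem_homogeneousIdealOf_iff hZ).mp hfg j _ hx ⟨v, hv, rfl, h4⟩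
    rcases mul_eq_zero.mp h3 with h | h
    · exact h1 (by rw [← coeff_lineHom, h, Polynomial.coeff_zero])
    · exact h2 (by rw [← coeff_lineHom, h, Polynomial.coeff_zero])

theorem homogeneousIdealOf_lt {σ : Type} [Nonempty σ] {Z W : Set (ProjSpace σ)} (hZ : IsClosed Z)
    (hW : IsClosed W) (h : Z ⊂ W) : homogeneousIdealOf W < homogeneousIdealOf Z := by
  refine lt_of_le_not_ge (homogeneousIdealOf_anti h.subset) fun hle => ?_
  obtain ⟨x, hxW, hxZ⟩ := Set.exists_of_ssubset h
  obtain ⟨_, ⟨f, k, hf, rfl⟩, hxf, hfZ⟩ :=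
    (ProjSpace.isTopologicalBasis σ).exists_subset_of_mem_open hxZ hZ.isOpen_compl
  have hmem : f ∈ homogeneousIdealOf Z := by
    rw [mem_homogeneousIdealOf_iff hZ]
    intro l y hy hyf
    rw [homogeneousComponent_of_mem hf] at hyf
    split_ifs at hyf
    · exact hfZ hyf hy
    · obtain ⟨v, hv, -, h0⟩ := hyf
      simp at h0
  have h1 := (mem_homogeneousIdealOf_iff hW).mp (hle hmem) k x hxW
  rw [homogeneousComponent_of_mem hf, if_pos rfl] at h1
  exact h1 hxf

/-- The irrelevant ideal. -/
def irrelevantIdeal : Ideal (MvPolynomial (MomentIndex 2 3) ℂ) := RingHom.ker constantCoeff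

instance irrelevantIdeal_isPrime : irrelevantIdeal.IsPrime := RingHom.ker_isPrime _

theorem homogeneousIdealOf_lt_irrelevantIdeal {Z : Set (ProjSpace (MomentIndex 2 3))}
    (hZ : IsClosed Z) (hne : Z.Nonempty) : homogeneousIdealOf Z < irrelevantIdeal := by
  obtain ⟨x, hx⟩ := hne
  obtain ⟨v, hv, rfl⟩ : ∃ v hv, x = ProjSpace.mk v hv := by
    induction x using Projectivization.ind with
    | h v hv => exact ⟨v, hv, rfl⟩
  refine lt_of_le_not_ge (fun f hf => ?_) fun hle => ?_
  · have h := (mem_homogeneousIdealOf_iff hZ).mp hf 0 _ hx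
    rw [ProjSpace.mk_mem_basicOpen (homogeneousComponent_isHomogeneous 0 f),
      homogeneousComponent_zero, eval_C, not_not] at h
    exact h
  · obtain ⟨i, hi⟩ := Function.ne_iff.mp hv
    have h : X i ∈ homogeneousIdealOf Z := hle (by simp [irrelevantIdeal, RingHom.mem_ker])
    have h1 := (mem_homogeneousIdealOf_iff hZ).mp h 1 _ hx
    have hX : X i ∈ homogeneousSubmodule (MomentIndex 2 3) ℂ 1 := isHomogeneous_X _ _
    rw [homogeneousComponent_of_mem hX, if_pos rfl,
      ProjSpace.mk_mem_basicOpen (isHomogeneous_X _ _), eval_X] at h1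
    exact h1 hi

/-! ### Upper bound for the dimension -/

theorem topologicalKrullDim_le_five : topologicalKrullDim (gaussianMomentVariety 2 3) ≤ 5 := by
  have hG : IsClosed (gaussianMomentVariety 2 3) := isClosed_closure
  let P (Z : TopologicalSpace.IrreducibleCloseds (gaussianMomentVariety 2 3)) :=
    homogeneousIdealOf (Subtype.val '' (Z : Set (gaussianMomentVariety 2 3)))
  have hcl (Z : TopologicalSpace.IrreducibleCloseds (gaussianMomentVariety 2 3)) :
      IsClosed (Subtype.val '' (Z : Set (gaussianMomentVariety 2 3))) :=
    hG.isClosedEmbedding_subtypeVal.isClosedMap _ Z.isClosed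
  have hP (Z) : (P Z).IsPrime :=
    isPrime_homogeneousIdealOf (hcl Z) (Z.isIrreducible.image _ continuous_subtype_val.continuousOn)
  have : Nonempty (MomentIndex 2 3) := ⟨momentEquiv 0⟩
  -- The dimension of the affine cone is strictly increasing in the irreducible closed set. It is at
  -- least 1, since the irrelevant ideal is strictly larger, and at most 6, so a chain has at most
  -- five steps.
  let F (Z) : ℕ := (coordDim (P Z)).toNat
  have hF : StrictMono F := by
    intro Z W h
    have h1 : P W < P Z := homogeneousIdealOf_lt (hcl Z) (hcl W)
      ((Subtype.val_injective.injOn.image_ssubset_image_iff (Set.subset_univ _)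
        (Set.subset_univ _)).mpr h)
    have := hP Z
    have := hP W
    exact Cardinal.toNat_lt_toNat (coordDim_lt_of_lt h1) (coordDim_lt_aleph0 _)
  have h1 (Z) : 1 ≤ F Z := by
    have := hP Z
    have h2 := coordDim_lt_of_lt (homogeneousIdealOf_lt_irrelevantIdeal (hcl Z)
      (Z.isIrreducible.1.image _))
    have h3 := Cardinal.toNat_lt_toNat h2 (coordDim_lt_aleph0 _)
    exact Nat.one_le_of_lt h3
  have h6 (Z) : F Z ≤ 6 := by
    have h2 : momentIdeal ≤ P Z := by
      rw [← homogeneousIdealOf_eq]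
      exact homogeneousIdealOf_anti (Subtype.coe_image_subset _ _)
    have h3 := (coordDim_le_of_le h2).trans coordDim_momentIdeal_le
    have h4 := Cardinal.toNat_le_toNat h3 (by exact_mod_cast Cardinal.natCast_lt_aleph0 (n := 6))
    simpa using h4
  refine iSup_le fun p => ?_
  have h7 := (p.map F hF).head_add_length_le_nat
  have h8 := h1 p.head
  have h9 := h6 p.last
  have h10 : p.length ≤ 5 := by
    simp only [LTSeries.head_map, LTSeries.last_map, LTSeries.map_length] at h7
    omega
  exact_mod_cast h10

/-! ### A chain of irreducible closed subsets -/

theorem momentPoint_mem (u : Fin 5 → ℂ) :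
    ProjSpace.mk (momentPoint u) (momentPoint_ne_zero u) ∈ gaussianMomentVariety 2 3 := by
  obtain ⟨μ, Sg, hS, h⟩ := exists_gaussianMomentVector_eq u
  exact subset_closure ⟨μ, Sg, hS, by simp only [h]⟩

/-- The point of the moment variety with the given parameters. -/
def varietyPoint (u : Fin 5 → ℂ) : gaussianMomentVariety 2 3 := ⟨_, momentPoint_mem u⟩

/-- The points of the moment variety for which only the first `d` parameters may be nonzero. -/
def flagSet (d : ℕ) : Set (gaussianMomentVariety 2 3) :=
  varietyPoint '' {u | ∀ j : Fin 5, d ≤ j → u j = 0}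

theorem flagSet_mono {d e : ℕ} (h : d ≤ e) : flagSet d ⊆ flagSet e :=
  Set.image_mono fun _ hu j hj => hu j (h.trans hj)

theorem varietyPoint_mem_preimage {f : MvPolynomial (MomentIndex 2 3) ℂ} {k : ℕ}
    (hf : f.IsHomogeneous k) (u : Fin 5 → ℂ) :
    (varietyPoint u).1 ∈ ProjSpace.basicOpen f ↔ eval u (momentHom f) ≠ 0 := by
  rw [← eval_momentPoint]
  exact ProjSpace.mk_mem_basicOpen hf _

/-- Two nonempty open subsets give two parameter points in the same linear subspace. On the line
joining them, each of two detecting polynomials is nonzero somewhere, so both are nonzero at a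
common point. -/
theorem isIrreducible_flagSet (d : ℕ) : IsIrreducible (flagSet d) := by
  have : Nonempty (MomentIndex 2 3) := ⟨momentEquiv 0⟩
  refine ⟨⟨_, 0, fun _ _ => rfl, rfl⟩, ?_⟩
  have hopen {U : Set (gaussianMomentVariety 2 3)} (hU : IsOpen U) (hne : (flagSet d ∩ U).Nonempty) :
      ∃ (f : MvPolynomial (MomentIndex 2 3) ℂ) (k : ℕ) (u : Fin 5 → ℂ), f.IsHomogeneous k ∧
        (∀ j : Fin 5, d ≤ j → u j = 0) ∧ eval u (momentHom f) ≠ 0 ∧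
        Subtype.val ⁻¹' ProjSpace.basicOpen f ⊆ U := by
    obtain ⟨U', hU', rfl⟩ := isOpen_induced_iff.mp hU
    obtain ⟨_, ⟨u, hu, rfl⟩, huU⟩ := hne
    obtain ⟨_, ⟨f, k, hf, rfl⟩, hxf, hfU⟩ :=
      (ProjSpace.isTopologicalBasis _).exists_subset_of_mem_open huU hU'
    exact ⟨f, k, u, hf, hu, (varietyPoint_mem_preimage hf u).mp hxf, Set.preimage_mono hfU⟩
  intro U V hU hV hneU hneV
  obtain ⟨f, k, u, hf, hu, hfu, hfU⟩ := hopen hU hneU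
  obtain ⟨g, l, v, hg, hv, hgv, hgV⟩ := hopen hV hneV
  let ψ : MvPolynomial (Fin 5) ℂ →ₐ[ℂ] Polynomial ℂ :=
    aeval fun j => Polynomial.C (u j) + Polynomial.X * Polynomial.C (v j - u j)
  have hev (t : ℂ) (p : MvPolynomial (Fin 5) ℂ) :
      (ψ p).eval t = eval (fun j => u j + t * (v j - u j)) p := by
    induction p using MvPolynomial.induction_on with
    | C a => simp [ψ]
    | add p q hp hq => simp [hp, hq]
    | mul_X p i hp => rw [map_mul, Polynomial.eval_mul, hp]; simp [ψ]
  have h1 : ψ (momentHom f) ≠ 0 := fun h => hfu (by simpa [h] using (hev 0 (momentHom f)).symm)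
  have h2 : ψ (momentHom g) ≠ 0 := fun h => hgv (by simpa [h] using (hev 1 (momentHom g)).symm)
  obtain ⟨t, ht⟩ : ∃ t, (ψ (momentHom f) * ψ (momentHom g)).eval t ≠ 0 := by
    by_contra! h
    exact mul_ne_zero h1 h2 (Polynomial.funext fun t => by rw [h t, Polynomial.eval_zero])
  rw [Polynomial.eval_mul, hev, hev] at ht
  refine ⟨varietyPoint fun j => u j + t * (v j - u j), ⟨_, fun j hj => ?_, rfl⟩, hfU ?_, hgV ?_⟩
  · simp [hu j hj, hv j hj]
  · exact (varietyPoint_mem_preimage hf _).mpr (left_ne_zero_of_mul ht)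
  · exact (varietyPoint_mem_preimage hg _).mpr (right_ne_zero_of_mul ht)

/-- Quadratic forms that detect the parameters. -/
def detectForm : Fin 5 → MvPolynomial (MomentIndex 2 3) ℂ :=
  ![m00 * m10, m00 * m01, 3 * (m00 * m20) - 2 * m10 ^ 2, 3 * (m00 * m11) - 2 * (m10 * m01),
    3 * (m00 * m02) - 2 * m01 ^ 2]

theorem momentHom_detectForm (j : Fin 5) : momentHom (detectForm j) = 3 * X j := by
  fin_cases j <;> simp [detectForm, map_ofNat momentHom] <;> ring

theorem detectForm_isHomogeneous (j : Fin 5) : (detectForm j).IsHomogeneous 2 := by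
  apply isHomogeneous_of_scaleHom
  obtain ⟨h0, h1, h2, h3, h4, h5, h6, h7, h8, h9⟩ := momentVar_eq
  fin_cases j <;>
  · simp [detectForm, h0, h1, h2, h3, h4, h5, scaleHom_momentVar, map_ofNat scaleHom,
      map_ofNat Polynomial.C]
    ring

/-- The closures of the flag of parameter spaces. -/
def flagClosed (d : ℕ) : TopologicalSpace.IrreducibleCloseds (gaussianMomentVariety 2 3) :=
  ⟨closure (flagSet d), (isIrreducible_flagSet d).closure, isClosed_closure⟩

/-- The quadratic form detecting the parameter of index d vanishes on `flagSet d` but not at the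
corresponding unit point, whose neighbourhood it defines. -/
theorem flagClosed_lt (d : Fin 5) : flagClosed d < flagClosed (d + 1) := by
  refine lt_of_le_not_ge (closure_mono (flagSet_mono (Nat.le_succ _))) fun hle => ?_
  have h1 : varietyPoint (Pi.single d 1) ∈ closure (flagSet d) := by
    refine hle (subset_closure ⟨_, fun j hj => ?_, rfl⟩)
    rw [Pi.single_eq_of_ne]
    rintro rfl
    omega
  have hd := detectForm_isHomogeneous d
  obtain ⟨_, hx, u, hu, rfl⟩ := mem_closure_iff.mp h1 _
    ((ProjSpace.isOpen_basicOpen hd).preimage continuous_subtype_val)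
    ((varietyPoint_mem_preimage hd _).mpr (by simp [momentHom_detectForm]))
  refine (varietyPoint_mem_preimage hd u).mp hx ?_
  rw [momentHom_detectForm, map_mul, eval_X, hu d le_rfl, mul_zero]

theorem five_le_topologicalKrullDim : 5 ≤ topologicalKrullDim (gaussianMomentVariety 2 3) := by
  let p : LTSeries (TopologicalSpace.IrreducibleCloseds (gaussianMomentVariety 2 3)) :=
    { length := 5
      toFun := fun i => flagClosed i
      step := fun i => by simpa using flagClosed_lt i }
  exact Order.LTSeries.length_le_krullDim p

theorem topologicalKrullDim_eq_five : topologicalKrullDim (gaussianMomentVariety 2 3) = 5 :=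
  le_antisymm topologicalKrullDim_le_five five_le_topologicalKrullDim

end

/-! ### The theorem -/

theorem mainTheorem7 :
    Nat.card (MomentIndex 2 3) = 9 + 1 ∧
    topologicalKrullDim (gaussianMomentVariety 2 3) = 5 ∧
    HasProjectiveDegree (gaussianMomentVariety 2 3) 16 ∧
    (∀ f ∈ homogeneousIdealOf (gaussianMomentVariety 2 3), ∀ k : ℕ,
      MvPolynomial.homogeneousComponent k f ∈ homogeneousIdealOf (gaussianMomentVariety 2 3)) ∧
    (homogeneousIdealOf (gaussianMomentVariety 2 3)).IsPrime ∧
    (∃ C Q : Finset (MvPolynomial (MomentIndex 2 3) ℂ),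
      C.card = 14 ∧ Q.card = 4 ∧
      (∀ f ∈ C, f.IsHomogeneous 3) ∧ (∀ f ∈ Q, f.IsHomogeneous 4) ∧
      {cumulantCubic30, cumulantCubic21, cumulantCubic12, cumulantCubic03} ⊆
        (C : Set (MvPolynomial (MomentIndex 2 3) ℂ)) ∧
      IsMinimalGeneratingSet (homogeneousIdealOf (gaussianMomentVariety 2 3))
        ((C : Set (MvPolynomial (MomentIndex 2 3) ℂ)) ∪ Q)) ∧
    hilbertSeries (homogeneousIdealOf (gaussianMomentVariety 2 3)) =
      (1 + 4 * PowerSeries.X + 10 * PowerSeries.X ^ 2 + 6 * PowerSeries.X ^ 3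
        - 4 * PowerSeries.X ^ 4 - PowerSeries.X ^ 5) * ((1 - PowerSeries.X) ^ 6)⁻¹ ∧
    homogeneousIdealOf (gaussianMomentVariety 2 3) =
      idealSaturation
        (Ideal.span {cumulantCubic30, cumulantCubic21, cumulantCubic12, cumulantCubic03})
        (Ideal.span {m00}) :=
  ⟨card_momentIndex, topologicalKrullDim_eq_five, hasProjectiveDegree_momentVariety, by
    rw [homogeneousIdealOf_eq]
    exact ⟨fun f hf k => homogeneousComponent_mem_momentIdeal hf k, momentIdeal_isPrime,
      exists_minimal_generators, hilbertSeries_eq, momentIdeal_eq_saturation⟩⟩
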